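/- Consider sequences of integers $N, K, L \ge 1$ with $N\to\infty$ (along a strictly increasing sequence), where the ratio $c_1 = N/K$ (which may depend on $N$) stays between two positive constants and $c_2 = L/N = 1$, i.e. $L=N$. Let $\mathbf H = \mathbf R_1^{1/2}\tilde{\mathbf H}\in\mathbb C^{K\times N}$ and $\mathbf F=\mathbf R_2^{1/2}\tilde{\mathbf F}\in\mathbb C^{L\times N}$, where $\tilde{\mathbf H}=[\tilde h_{ij}/\sqrt N]$, $\tilde{\mathbf F}=[\tilde f_{ij}/\sqrt N]$ and, for each $N$, all the $\tilde h_{ij},\tilde f_{ij}$ are i.i.d. standard (circularly symmetric) complex Gaussian with mean $0$ and variance $1$; all these random variables live on one probability space. Let $\mathbf R_1=r_1\mathbf I_K$ with $r_1>0$ fixed and $\mathbf R_2=\mathrm{diag}(r_{2,1},\dots,r_{2,L})$ with $r_{2,l}>0$ bounded uniformly in $l$ and $N$. Let $P_T,\sigma^2,\alpha>0$ and $\beta\in[0,1)$ be fixed, put $\rho=P_T/\sigma^2$, and let $\theta_l>0$ $(l=1,\dots,L)$ and $\theta_{\rm all}>0$ be given (they may depend on $N$). Define $$\mathbf W=(\mathbf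 F\mathbf F^H)^{-1/2}\mathbf F,\quad \check{\mathbf H}=\mathbf H(\mathbf I_N-\beta\mathbf W^H\mathbf W),\quad \mathbf T=(\check{\mathbf H}^H\check{\mathbf H}+\alpha\mathbf I_N)^{-1}\check{\mathbf H}^H,\quad \mathbf G=[\mathbf g_1,\dots,\mathbf g_K]=\xi\,\mathbf T,$$ where, with $\mathbf h_k^H$ and $\mathbf f_l^H$ the rows of $\mathbf H$ and $\mathbf F$, the number $\xi>0$ is given by $$\xi^2=\min\Big\{\tfrac{P_T}{\mathsf E\{\frac1N\mathrm{tr}(\mathbf T\mathbf T^H)\}},\ \tfrac{\theta_lP_T}{\mathsf E\{\mathbf f_l^H\mathbf T\mathbf T^H\mathbf f_l\}},\ l=1,\dots,L\Big\}\ \text{(Case I)},$$ $$\xi^2=\min\Big\{\tfrac{P_T}{\mathsf E\{\frac1N\mathrm{tr}(\mathbf T\mathbf T^H)\}},\ \tfrac{\theta_{\rm all}P_T}{\mathsf E\{\mathrm{tr}(\mathbf F\mathbf T\mathbf T^H\mathbf F^H)\}}\Big\}\ \text{(Case II)}.$$ Let $$\gamma_k=\frac{|\mathbf h_k^H\mathbf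 g_k|^2}{\sum_{j\ne k}|\mathbf h_k^H\mathbf g_j|^2+\sigma^2}$$ be the resulting SINR of user $k$. Then, for each $N$, the fixed-point equation $$e=\frac{r_1\,(1+e(1-\beta)^2)}{c_1\alpha\,(1+e(1-\beta)^2)+c_1r_1(1-\beta)^2}$$ has exactly one positive solution $e$ (depending on $N$ only through $c_1$), and in each of the two cases, for every choice of user indices $k=k_N\in\{1,\dots,K\}$, almost surely $\gamma_k-\overline\gamma\to0$ as $N\to\infty$, where $$\overline\gamma=\frac{\rho\,\big(c_1r_1^2-(c_1\alpha e-r_1)^2\big)}{\rho\,(c_1\alpha e)^2+\nu_0},$$ with $\nu_0=r_1\max\{1,\ r_{2,l}/\theta_l,\ l=1,\dots,L\}$ in Case I and $\nu_0=r_1\max\{1,\ \mathrm{tr}\,\mathbf R_2/\theta_{\rm all}\}$ in Case II. -/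

import Mathlib

open MeasureTheory ProbabilityTheory Filter Topology
open scoped Matrix MatrixOrder NNReal

namespace CogRadio

noncomputable section

/-- The standard (circularly symmetric) complex Gaussian law: independent real and imaginary parts,
each `N(0, 1/2)`, so that the mean is `0` and the variance `E |z|²` is `1`. -/
def stdComplexGaussian : Measure ℂ :=
  ((gaussianReal 0 (1 / 2 : ℝ≥0)).prod (gaussianReal 0 (1 / 2 : ℝ≥0))).map
    (fun p : ℝ × ℝ => (⟨p.1, p.2⟩ : ℂ))

/-- The entries `x i j` of an `M × N` array and `y l j` of an `L × N` array are, all together,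
mutually independent standard complex Gaussian random variables. -/
structure IsIIDGaussianPair {Ω : Type*} [MeasurableSpace Ω] (P : Measure Ω) {M L N : ℕ}
    (x : Fin M → Fin N → Ω → ℂ) (y : Fin L → Fin N → Ω → ℂ) : Prop where
  law_left : ∀ i j, HasLaw (x i j) stdComplexGaussian P
  law_right : ∀ l j, HasLaw (y l j) stdComplexGaussian P
  indep : iIndepFun
    (fun s : (Fin M × Fin N) ⊕ (Fin L × Fin N) =>
      Sum.elim (fun p => x p.1 p.2) (fun p => y p.1 p.2) s) P

/-- The channel matrix `R^{1/2} [x_{ij} / √N]`, where `R = diag(r)` holds the path gains. Its `i`-th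
row is the (conjugate-transposed) channel vector of the `i`-th receiver. -/
def channel {Ω : Type*} {M N : ℕ} (r : Fin M → ℝ) (x : Fin M → Fin N → Ω → ℂ) (ω : Ω) :
    Matrix (Fin M) (Fin N) ℂ :=
  Matrix.diagonal (fun i => ((√(r i) : ℝ) : ℂ)) *
    Matrix.of (fun i j => ((1 / √(N : ℝ) : ℝ) : ℂ) * x i j ω)

section Deterministic

variable {K L N : ℕ}

/-- `W = (F Fᴴ)^{-1/2} F`, with the principal square root. -/
def rowSpaceIsometry (F : Matrix (Fin L) (Fin N) ℂ) : Matrix (Fin L) (Fin N) ℂ :=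
  (CFC.sqrt (F * Fᴴ))⁻¹ * F

/-- The partially projected channel `Ȟ = H (I - β Wᴴ W)`. -/
def partialProjection (β : ℝ) (H : Matrix (Fin K) (Fin N) ℂ) (F : Matrix (Fin L) (Fin N) ℂ) :
    Matrix (Fin K) (Fin N) ℂ :=
  H * (1 - (β : ℂ) • ((rowSpaceIsometry F)ᴴ * rowSpaceIsometry F))

/-- The precoder before normalization, `T = (Ȟᴴ Ȟ + α I)⁻¹ Ȟᴴ`. -/
def rawPrecoder (α β : ℝ) (H : Matrix (Fin K) (Fin N) ℂ) (F : Matrix (Fin L) (Fin N) ℂ) :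
    Matrix (Fin N) (Fin K) ℂ :=
  ((partialProjection β H F)ᴴ * partialProjection β H F + (α : ℂ) • 1)⁻¹ *
    (partialProjection β H F)ᴴ

/-- The normalized transmit power `(1/N) tr (T Tᴴ)`. -/
def txPower (T : Matrix (Fin N) (Fin K) ℂ) : ℝ :=
  (1 / (N : ℝ)) * (Matrix.trace (T * Tᴴ)).re

/-- The interference power `f_lᴴ T Tᴴ f_l` received by the `l`-th primary user (`f_lᴴ` is the
`l`-th row of `F`). -/
def interference (F : Matrix (Fin L) (Fin N) ℂ) (T : Matrix (Fin N) (Fin K) ℂ) (l : Fin L) : ℝ :=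
  ((F * (T * Tᴴ) * Fᴴ) l l).re

/-- The total interference power `tr (F T Tᴴ Fᴴ)` received by the primary users. -/
def totalInterference (F : Matrix (Fin L) (Fin N) ℂ) (T : Matrix (Fin N) (Fin K) ℂ) : ℝ :=
  (Matrix.trace (F * (T * Tᴴ) * Fᴴ)).re

/-- The SINR of secondary user `k` under the precoding matrix `G = [g_1, …, g_K]` with noise
variance `σ2`: `|h_kᴴ g_k|² / (∑_{j ≠ k} |h_kᴴ g_j|² + σ2)`. -/
def sinr (σ2 : ℝ) (H : Matrix (Fin K) (Fin N) ℂ) (G : Matrix (Fin N) (Fin K) ℂ) (k : Fin K) : ℝ :=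
  ‖(H * G) k k‖ ^ 2 / (∑ j ∈ Finset.univ.erase k, ‖(H * G) k j‖ ^ 2 + σ2)

end Deterministic

section Random

variable {Ω : Type*} [MeasurableSpace Ω] {K L N : ℕ}

/-- Case I: `ξ² = min {ξ_0², ξ_1², …, ξ_L²}`, where `ξ_0² = P_T / E[(1/N) tr T Tᴴ]` and
`ξ_l² = θ_l P_T / E[f_lᴴ T Tᴴ f_l]`. -/
def xiSqPerUser (P : Measure Ω) (α β PT : ℝ) (θ : Fin L → ℝ)
    (H : Ω → Matrix (Fin K) (Fin N) ℂ) (F : Ω → Matrix (Fin L) (Fin N) ℂ) : ℝ :=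
  Finset.univ.fold min
    (PT / ∫ ω, txPower (rawPrecoder α β (H ω) (F ω)) ∂P)
    (fun l => θ l * PT / ∫ ω, interference (F ω) (rawPrecoder α β (H ω) (F ω)) l ∂P)

/-- Case II: `ξ² = min {P_T / E[(1/N) tr T Tᴴ], θ_all P_T / E[tr (F T Tᴴ Fᴴ)]}`. -/
def xiSqSum (P : Measure Ω) (α β PT θall : ℝ)
    (H : Ω → Matrix (Fin K) (Fin N) ℂ) (F : Ω → Matrix (Fin L) (Fin N) ℂ) : ℝ :=
  min (PT / ∫ ω, txPower (rawPrecoder α β (H ω) (F ω)) ∂P)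
    (θall * PT / ∫ ω, totalInterference (F ω) (rawPrecoder α β (H ω) (F ω)) ∂P)

/-- The SINR `γ_k` of the precoder `G = ξ T` in Case I (per-user interference constraints). -/
def sinrPerUser (P : Measure Ω) (α β PT σ2 : ℝ) (θ : Fin L → ℝ)
    (H : Ω → Matrix (Fin K) (Fin N) ℂ) (F : Ω → Matrix (Fin L) (Fin N) ℂ)
    (k : Fin K) (ω : Ω) : ℝ :=
  sinr σ2 (H ω)
    (((√(xiSqPerUser P α β PT θ H F) : ℝ) : ℂ) • rawPrecoder α β (H ω) (F ω)) k

/-- The SINR `γ_k` of the precoder `G = ξ T` in Case II (sum interference constraint). -/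
def sinrSum (P : Measure Ω) (α β PT σ2 θall : ℝ)
    (H : Ω → Matrix (Fin K) (Fin N) ℂ) (F : Ω → Matrix (Fin L) (Fin N) ℂ)
    (k : Fin K) (ω : Ω) : ℝ :=
  sinr σ2 (H ω)
    (((√(xiSqSum P α β PT θall H F) : ℝ) : ℂ) • rawPrecoder α β (H ω) (F ω)) k

end Random

/-- `e` solves the scalar fixed-point equation. -/
def IsFixedPoint (c₁ α β r₁ e : ℝ) : Prop :=
  e = r₁ * (1 + e * (1 - β) ^ 2) /
    (c₁ * α * (1 + e * (1 - β) ^ 2) + c₁ * r₁ * (1 - β) ^ 2)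

/-- The deterministic equivalent `γ̄` of the SINR. -/
def gammaBar (ρ c₁ α r₁ e ν₀ : ℝ) : ℝ :=
  ρ * (c₁ * r₁ ^ 2 - (c₁ * α * e - r₁) ^ 2) / (ρ * (c₁ * α * e) ^ 2 + ν₀)

/-- `ν₀ = r₁ max {1, r_{2,l} / θ_l, l = 1, …, L}` (Case I). -/
def nuPerUser {L : ℕ} (r₁ : ℝ) (r₂ θ : Fin L → ℝ) : ℝ :=
  r₁ * Finset.univ.fold max 1 (fun l => r₂ l / θ l)

/-- `ν₀ = r₁ max {1, tr R₂ / θ_all}` with `R₂ = diag(r₂)` (Case II). -/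
def nuSum {L : ℕ} (r₁ : ℝ) (r₂ : Fin L → ℝ) (θall : ℝ) : ℝ :=
  r₁ * max 1 (Matrix.trace (Matrix.diagonal r₂) / θall)

end

end CogRadio

namespace CogRadio

/-! ### The standard complex Gaussian law -/

-- Since L = N, the matrix F is square, and its determinant is a nonzero polynomial in independent
-- atomless entries, so F is almost surely invertible. Then Wᴴ W = I and the partial projection is
-- multiplication by b = 1 - β: the precoder is T = b (b² Hᴴ H + α)⁻¹ Hᴴ, a function of H alone. As
-- F is independent of H with isotropic rows, the mean interference at primary user l is r₂ l times
-- the mean transmit power τ. Hence ξ² = PT / (τ ν) with an explicit ν ≥ 1, and the two cases differ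
-- only in ν.
--
-- Let R = (b² Hᴴ H + α)⁻¹ and let R_k be the same resolvent with row k of H set to zero. By the
-- rank-one update formula, `sinr_precoder` writes the SINR exactly as a rational function of U =
-- h_kᴴ R_k h_k, V = h_kᴴ R_k² h_k and ξ². As h_k is independent of R_k, a fourth moment bound for
-- Gaussian quadratic forms puts U and V within a summable error of (r/N) tr R_k and (r/N) tr R_k²;
-- replacing R_k by R changes these traces by O(1).
--
-- The limits of the traces come from two exact sum rules, the traces of b² Hᴴ H R = 1 - α R and of
-- this identity times R, written with leave-one-out quantities (`sum_looQuad_eq`,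
-- `sum_looQuadSq_eq`). If every U is replaced by a common value m, the first becomes a scalar
-- equation solved by `mBar`, a change of variable from e; the second is then linear and is solved
-- by `vBar`. Both equations are stable with constant r/α, so small average errors over the users
-- give small errors in the traces (`abs_trRes_sub_mBar_le`, `abs_trResSq_sub_vBar_le`). Dominated
-- convergence gives τ - `tauBar` → 0.
--
-- Finally the SINR is Lipschitz in (U, V, τ) uniformly in ν ≥ 1, which may be unbounded
-- (`tendsto_ratio_sub_ratio`), and `gammaBar_eq` identifies the resulting expression with the
-- stated one.

lemma measurable_complex_mk : Measurable (fun p : ℝ × ℝ => (⟨p.1, p.2⟩ : ℂ)) :=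
  Complex.measurableEquivRealProd.symm.measurable

instance : IsProbabilityMeasure stdComplexGaussian :=
  Measure.isProbabilityMeasure_map measurable_complex_mk.aemeasurable

/-- Absence of atoms is all that the almost sure invertibility of the primary channel needs from the
law. -/
instance : NullSingletonClass stdComplexGaussian := by
  refine ⟨fun z => ?_⟩
  have h0 : NullSingletonClass (gaussianReal 0 (1 / 2 : ℝ≥0)) :=
    nullSingletonClass_gaussianReal (by norm_num)
  rw [stdComplexGaussian, Measure.map_apply measurable_complex_mk (measurableSet_singleton z)]
  have : (fun p : ℝ × ℝ => (⟨p.1, p.2⟩ : ℂ)) ⁻¹' {z} = {(z.re, z.im)} := by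
    ext p
    simp [Complex.ext_iff, Prod.ext_iff]
  rw [this, ← Set.singleton_prod_singleton, Measure.prod_prod, measure_singleton, zero_mul]

/-- The variance 1/2 of each real coordinate produces the 1/4. The dependence on ‖t‖ alone is what
makes Gaussian vectors unitarily invariant. -/
lemma charFun_stdComplexGaussian (t : ℂ) :
    charFun stdComplexGaussian t = Complex.exp (-(‖t‖ ^ 2 / 4 : ℝ)) := by
  rw [charFun_apply, stdComplexGaussian,
    integral_map measurable_complex_mk.aemeasurable (Measurable.aestronglyMeasurable (by fun_prop))]
  have key : ∀ p : ℝ × ℝ, Complex.exp ((inner ℝ (⟨p.1, p.2⟩ : ℂ) t : ℝ) * Complex.I)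
      = Complex.exp (t.re * p.1 * Complex.I) * Complex.exp (t.im * p.2 * Complex.I) := by
    intro p
    rw [← Complex.exp_add]
    congr 1
    simp [Complex.inner]
    ring
  simp_rw [key]
  rw [integral_prod_mul (f := fun x : ℝ => Complex.exp (t.re * x * Complex.I))
    (g := fun x : ℝ => Complex.exp (t.im * x * Complex.I)), ← charFun_apply_real,
    ← charFun_apply_real, charFun_gaussianReal, charFun_gaussianReal, ← Complex.exp_add]
  congr 1
  rw [← Complex.normSq_eq_norm_sq, Complex.normSq_apply]
  push_cast
  ring

lemma memLp_id_stdComplexGaussian (p : ℝ≥0) : MemLp id p stdComplexGaussian := by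
  have h1 : MemLp (fun q : ℝ × ℝ => q.1) p
      ((gaussianReal 0 (1 / 2 : ℝ≥0)).prod (gaussianReal 0 (1 / 2 : ℝ≥0))) :=
    (memLp_id_gaussianReal p).comp_measurePreserving measurePreserving_fst
  have h2 : MemLp (fun q : ℝ × ℝ => q.2) p
      ((gaussianReal 0 (1 / 2 : ℝ≥0)).prod (gaussianReal 0 (1 / 2 : ℝ≥0))) :=
    (memLp_id_gaussianReal p).comp_measurePreserving measurePreserving_snd
  rw [stdComplexGaussian, memLp_map_measure_iff aestronglyMeasurable_id
    measurable_complex_mk.aemeasurable]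
  have h3 := h1.ofReal (K := ℂ)
  have h4 := (h2.ofReal (K := ℂ)).const_mul Complex.I
  convert h3.add h4 using 1
  ext q
  simp [Complex.ext_iff]

lemma integral_id_gaussianReal_sq : ∫ x : ℝ, x ^ 2 ∂(gaussianReal 0 (1 / 2 : ℝ≥0)) = 1 / 2 := by
  have h := variance_fun_id_gaussianReal (μ := 0) (v := (1 / 2 : ℝ≥0))
  rw [variance_of_integral_eq_zero (by fun_prop) (by simp)] at h
  simpa using h

lemma integral_normSq_stdComplexGaussian :
    ∫ z, ‖z‖ ^ 2 ∂stdComplexGaussian = 1 := by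
  rw [stdComplexGaussian,
    integral_map measurable_complex_mk.aemeasurable (Measurable.aestronglyMeasurable (by fun_prop))]
  have i0 : Integrable (fun x : ℝ => x ^ 2) (gaussianReal 0 (1 / 2 : ℝ≥0)) :=
    (memLp_id_gaussianReal 2).integrable_sq
  have : ∀ p : ℝ × ℝ, ‖(⟨p.1, p.2⟩ : ℂ)‖ ^ 2 = p.1 ^ 2 + p.2 ^ 2 := by
    intro p
    rw [← Complex.normSq_eq_norm_sq, Complex.normSq_apply]; ring
  simp_rw [this]
  rw [integral_add (i0.comp_fst _) (i0.comp_snd _), integral_fun_fst (f := fun x : ℝ => x ^ 2),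
    integral_fun_snd (f := fun x : ℝ => x ^ 2), integral_id_gaussianReal_sq]
  norm_num

lemma integral_id_stdComplexGaussian : ∫ z, z ∂stdComplexGaussian = 0 := by
  have i0 : Integrable (fun x : ℝ => (x : ℂ)) (gaussianReal 0 (1 / 2 : ℝ≥0)) :=
    ((memLp_id_gaussianReal 1).integrable (by norm_num)).ofReal
  rw [stdComplexGaussian,
    integral_map measurable_complex_mk.aemeasurable (Measurable.aestronglyMeasurable (by fun_prop))]
  have : ∀ p : ℝ × ℝ, (⟨p.1, p.2⟩ : ℂ) = (p.1 : ℂ) + Complex.I * p.2 := by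
    intro p
    simp [Complex.ext_iff]
  simp_rw [this]
  rw [integral_add (i0.comp_fst _) ((i0.const_mul _).comp_snd _),
    integral_fun_fst (f := fun x : ℝ => (x : ℂ)),
    integral_fun_snd (f := fun x : ℝ => Complex.I * (x : ℂ)), integral_const_mul,
    integral_complex_ofReal]
  simp

/-- The law of a vector with i.i.d. standard complex Gaussian entries. -/
noncomputable def gaussianVector (ι : Type*) [Fintype ι] : Measure (ι → ℂ) :=
  Measure.pi (fun _ => stdComplexGaussian)

instance (ι : Type*) [Fintype ι] : IsProbabilityMeasure (gaussianVector ι) := by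
  unfold gaussianVector; infer_instance

lemma charFun_gaussianVector {ι : Type*} [Fintype ι] (t : EuclideanSpace ℂ ι) :
    charFun ((gaussianVector ι).map (WithLp.toLp 2)) t = Complex.exp (-(‖t‖ ^ 2 / 4 : ℝ)) := by
  rw [gaussianVector, charFun_pi]
  simp_rw [charFun_stdComplexGaussian]
  rw [← Complex.exp_sum, EuclideanSpace.norm_sq_eq]
  push_cast
  rw [Finset.sum_neg_distrib, Finset.sum_div]

/-- Unitary invariance of the complex Gaussian vector. -/
lemma map_mulVec_gaussianVector {ι : Type*} [Fintype ι] [DecidableEq ι] (U : Matrix ι ι ℂ)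
    (hU : U * Uᴴ = 1) :
    (gaussianVector ι).map (fun x => U *ᵥ x) = gaussianVector ι := by
  have hm : Measurable (fun x : ι → ℂ => U *ᵥ x) :=
    (Continuous.matrix_mulVec continuous_const continuous_id).measurable
  have hpr : IsProbabilityMeasure ((gaussianVector ι).map (fun x => U *ᵥ x)) :=
    Measure.isProbabilityMeasure_map hm.aemeasurable
  rw [gaussianVector, ← charFun_eq_pi_iff, ← gaussianVector]
  intro t
  rw [Measure.map_map (by fun_prop) hm]
  have h1 := charFun_gaussianVector t
  rw [gaussianVector, charFun_pi] at h1
  rw [h1]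
  -- The characteristic function of U x at t is that of x at Uᴴ t, and Uᴴ preserves the norm.
  have h2 := charFun_gaussianVector (WithLp.toLp 2 (Uᴴ *ᵥ t.ofLp))
  have hn : ‖(WithLp.toLp 2 (Uᴴ *ᵥ t.ofLp) : EuclideanSpace ℂ ι)‖ ^ 2 = ‖t‖ ^ 2 := by
    have e : ∀ s : EuclideanSpace ℂ ι, ((‖s‖ ^ 2 : ℝ) : ℂ) = s.ofLp ⬝ᵥ star s.ofLp := by
      intro s
      rw [EuclideanSpace.norm_sq_eq]
      simp [dotProduct, Complex.mul_conj, Complex.normSq_eq_norm_sq]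
    have : ((‖(WithLp.toLp 2 (Uᴴ *ᵥ t.ofLp) : EuclideanSpace ℂ ι)‖ ^ 2 : ℝ) : ℂ)
        = ((‖t‖ ^ 2 : ℝ) : ℂ) := by
      rw [e, e]
      simp only [Matrix.star_mulVec, Matrix.conjTranspose_conjTranspose]
      rw [dotProduct_comm, ← Matrix.dotProduct_mulVec, Matrix.mulVec_mulVec, hU,
        Matrix.one_mulVec, dotProduct_comm]
    exact_mod_cast this
  rw [hn] at h2
  rw [← h2, charFun_apply, charFun_apply, integral_map (by fun_prop) (by fun_prop),
    integral_map (by fun_prop) (by fun_prop)]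
  congr 1
  ext x
  congr 3
  simp only [PiLp.inner_apply, Complex.inner, Function.comp]
  rw [← Complex.re_sum, ← Complex.re_sum]
  congr 1
  have : ∀ a b : ι → ℂ, ∑ i, a i * starRingEnd ℂ (b i) = a ⬝ᵥ star b := fun a b => rfl
  rw [this, this, Matrix.star_mulVec, dotProduct_comm, ← Matrix.dotProduct_mulVec, dotProduct_comm]

/-! ### Fourth moments of sums of independent variables and of quadratic forms -/

lemma integrable_pow_of_memLp_four {Ω : Type*} [MeasurableSpace Ω] {μ : Measure Ω}
    [IsProbabilityMeasure μ] {f : Ω → ℝ} (hf : MemLp f 4 μ) {k : ℕ} (hk : k ≤ 4) :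
    Integrable (fun ω => f ω ^ k) μ := by
  have h1 : MemLp f k μ := hf.mono_exponent (by exact_mod_cast hk)
  refine (h1.integrable_norm_pow').mono' (hf.aestronglyMeasurable.pow k) (ae_of_all _ fun ω => ?_)
  simp

/-- In the binomial expansions every mixed term with an odd exponent contains a factor of mean zero
after independence is used. -/
lemma moment_add_of_indepFun {Ω : Type*} [MeasurableSpace Ω] {μ : Measure Ω}
    [IsProbabilityMeasure μ] {S Y : Ω → ℝ} (hS : MemLp S 4 μ) (hY : MemLp Y 4 μ)
    (hSY : IndepFun S Y μ) (hS0 : ∫ ω, S ω ∂μ = 0) (hY0 : ∫ ω, Y ω ∂μ = 0) :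
    ∫ ω, (S ω + Y ω) ^ 2 ∂μ = ∫ ω, S ω ^ 2 ∂μ + ∫ ω, Y ω ^ 2 ∂μ ∧
    ∫ ω, (S ω + Y ω) ^ 4 ∂μ =
      ∫ ω, S ω ^ 4 ∂μ + 6 * (∫ ω, S ω ^ 2 ∂μ) * (∫ ω, Y ω ^ 2 ∂μ) + ∫ ω, Y ω ^ 4 ∂μ := by
  have hind : ∀ i j : ℕ, IndepFun (fun ω => S ω ^ i) (fun ω => Y ω ^ j) μ := fun i j =>
    hSY.comp (φ := fun x : ℝ => x ^ i) (ψ := fun x : ℝ => x ^ j) (by fun_prop) (by fun_prop)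
  have iS : ∀ {k : ℕ}, k ≤ 4 → Integrable (fun ω => S ω ^ k) μ :=
    fun hk => integrable_pow_of_memLp_four hS hk
  have iY : ∀ {k : ℕ}, k ≤ 4 → Integrable (fun ω => Y ω ^ k) μ :=
    fun hk => integrable_pow_of_memLp_four hY hk
  have hmul : ∀ {i j : ℕ}, i ≤ 4 → j ≤ 4 → Integrable (fun ω => S ω ^ i * Y ω ^ j) μ :=
    fun hi hj => (hind _ _).integrable_mul (iS hi) (iY hj)
  have hint : ∀ {i j : ℕ}, i ≤ 4 → j ≤ 4 →
      ∫ ω, S ω ^ i * Y ω ^ j ∂μ = (∫ ω, S ω ^ i ∂μ) * ∫ ω, Y ω ^ j ∂μ :=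
    fun {i j} hi hj => (hind i j).integral_fun_mul_eq_mul_integral (iS hi).1 (iY hj).1
  have z1 : ∫ ω, S ω ^ 1 * Y ω ^ 1 ∂μ = 0 := by
    rw [hint (by norm_num) (by norm_num)]; simp [hS0]
  have z2 : ∫ ω, S ω ^ 3 * Y ω ^ 1 ∂μ = 0 := by
    rw [hint (by norm_num) (by norm_num)]; simp [hY0]
  have z3 : ∫ ω, S ω ^ 1 * Y ω ^ 3 ∂μ = 0 := by
    rw [hint (by norm_num) (by norm_num)]; simp [hS0]
  constructor
  · have : ∀ ω, (S ω + Y ω) ^ 2 = S ω ^ 2 + 2 * (S ω ^ 1 * Y ω ^ 1) + Y ω ^ 2 := fun ω => by ring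
    simp_rw [this]
    have j2 : Integrable (fun ω => S ω ^ 2) μ := iS (by norm_num)
    have j11 : Integrable (fun ω => 2 * (S ω ^ 1 * Y ω ^ 1)) μ :=
      (hmul (i := 1) (j := 1) (by norm_num) (by norm_num)).const_mul 2
    have s1 : Integrable (fun ω => S ω ^ 2 + 2 * (S ω ^ 1 * Y ω ^ 1)) μ := j2.add j11
    rw [integral_add s1 (iY (by norm_num)), integral_add j2 j11, integral_const_mul, z1]
    ring
  · have : ∀ ω, (S ω + Y ω) ^ 4 = S ω ^ 4 + 4 * (S ω ^ 3 * Y ω ^ 1) + 6 * (S ω ^ 2 * Y ω ^ 2)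
        + 4 * (S ω ^ 1 * Y ω ^ 3) + Y ω ^ 4 := fun ω => by ring
    simp_rw [this]
    have j4 : Integrable (fun ω => S ω ^ 4) μ := iS le_rfl
    have j31 := (hmul (i := 3) (j := 1) (by norm_num) (by norm_num)).const_mul 4
    have j22 := (hmul (i := 2) (j := 2) (by norm_num) (by norm_num)).const_mul 6
    have j13 := (hmul (i := 1) (j := 3) (by norm_num) (by norm_num)).const_mul 4
    have s1 : Integrable (fun ω => S ω ^ 4 + 4 * (S ω ^ 3 * Y ω ^ 1)) μ := j4.add j31
    have s2 : Integrable (fun ω => S ω ^ 4 + 4 * (S ω ^ 3 * Y ω ^ 1)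
        + 6 * (S ω ^ 2 * Y ω ^ 2)) μ := s1.add j22
    have s3 : Integrable (fun ω => S ω ^ 4 + 4 * (S ω ^ 3 * Y ω ^ 1)
        + 6 * (S ω ^ 2 * Y ω ^ 2) + 4 * (S ω ^ 1 * Y ω ^ 3)) μ := s2.add j13
    rw [integral_add s3 (iY le_rfl), integral_add s2 j13, integral_add s1 j22,
      integral_add j4 j31, integral_const_mul, integral_const_mul, integral_const_mul, z2, z3,
      hint (by norm_num) (by norm_num)]
    ring

/-- Induction on the index set. With A the sum so far, the new fourth moment is at most 3A² + 6A a +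
a² ≤ 3(A + a)², so the constant 3 does not grow with the number of terms. -/
lemma moment_sum_le_of_iIndepFun {Ω ι : Type*} [MeasurableSpace Ω] {μ : Measure Ω}
    [IsProbabilityMeasure μ] {Y : ι → Ω → ℝ} (hind : iIndepFun Y μ) (hY : ∀ i, MemLp (Y i) 4 μ)
    (hY0 : ∀ i, ∫ ω, Y i ω ∂μ = 0) {a : ι → ℝ} (ha : ∀ i, 0 ≤ a i)
    (h2 : ∀ i, ∫ ω, Y i ω ^ 2 ∂μ ≤ a i) (h4 : ∀ i, ∫ ω, Y i ω ^ 4 ∂μ ≤ a i ^ 2)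
    (s : Finset ι) :
    ∫ ω, (∑ i ∈ s, Y i ω) ^ 2 ∂μ ≤ ∑ i ∈ s, a i ∧
      ∫ ω, (∑ i ∈ s, Y i ω) ^ 4 ∂μ ≤ 3 * (∑ i ∈ s, a i) ^ 2 := by
  classical
  induction s using Finset.induction_on with
  | empty => simp
  | insert i s his ih =>
    have hSm : MemLp (fun ω => ∑ j ∈ s, Y j ω) 4 μ := memLp_finsetSum s fun j _ => hY j
    have hS0 : ∫ ω, ∑ j ∈ s, Y j ω ∂μ = 0 := by
      rw [integral_finsetSum _ fun j _ => (hY j).integrable (by norm_num)]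
      simp [hY0]
    have hI : IndepFun (fun ω => ∑ j ∈ s, Y j ω) (Y i) μ := by
      have := hind.indepFun_finsetSum_of_notMem₀ (fun j => (hY j).aestronglyMeasurable.aemeasurable) his
      convert this using 1
      ext ω; simp
    obtain ⟨e2, e4⟩ := moment_add_of_indepFun hSm (hY i) hI hS0 (hY0 i)
    simp_rw [Finset.sum_insert his, add_comm (Y i _)]
    have hA : 0 ≤ ∑ j ∈ s, a j := Finset.sum_nonneg fun j _ => ha j
    have hq : 0 ≤ ∫ ω, Y i ω ^ 2 ∂μ := integral_nonneg fun ω => sq_nonneg _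
    rw [e2, e4]
    refine ⟨by linarith [ih.1, h2 i], ?_⟩
    have := mul_le_mul ih.1 (h2 i) hq hA
    nlinarith [ih.2, h4 i, ha i]

lemma memLp_normSq_sub_one_stdComplexGaussian :
    MemLp (fun z : ℂ => ‖z‖ ^ 2 - 1) 4 stdComplexGaussian := by
  have h := memLp_id_stdComplexGaussian 8
  have h2 : MemLp (fun z : ℂ => ‖z‖ ^ 2) 4 stdComplexGaussian := by
    have := h.norm_rpow_div (q := 2)
    have e : ((8 : ℝ≥0) : ENNReal) / 2 = 4 := by
      exact ((ENNReal.eq_div_iff (by norm_num) (by norm_num)).2 (by norm_num)).symm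
    rw [e] at this
    simpa using this
  exact h2.sub (memLp_const 1)

/-- A dimension-free constant in the fourth moment bound for Gaussian quadratic forms. -/
noncomputable def quadConst : ℝ :=
  1 + ∫ z, (‖z‖ ^ 2 - 1) ^ 2 ∂stdComplexGaussian + ∫ z, (‖z‖ ^ 2 - 1) ^ 4 ∂stdComplexGaussian

lemma one_le_quadConst : 1 ≤ quadConst := by
  have h1 : 0 ≤ ∫ z, (‖z‖ ^ 2 - 1) ^ 2 ∂stdComplexGaussian := integral_nonneg fun z => sq_nonneg _
  have h2 : 0 ≤ ∫ z, (‖z‖ ^ 2 - 1) ^ 4 ∂stdComplexGaussian := integral_nonneg fun z => by positivity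
  unfold quadConst; linarith

lemma integral_weighted_sum_pow_four_le {ι : Type*} [Fintype ι] (l : ι → ℝ) :
    ∫ x, (∑ i, l i * (‖x i‖ ^ 2 - 1)) ^ 4 ∂(gaussianVector ι) ≤
      3 * quadConst ^ 2 * (∑ i, l i ^ 2) ^ 2 := by
  have hmp : ∀ i, MeasurePreserving (fun x : ι → ℂ => x i) (gaussianVector ι) stdComplexGaussian :=
    fun i => measurePreserving_eval (fun _ : ι => stdComplexGaussian) i
  have hm : ∀ i, Measurable (fun z : ℂ => l i * (‖z‖ ^ 2 - 1)) := fun i => by fun_prop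
  have hind : iIndepFun (fun i (x : ι → ℂ) => l i * (‖x i‖ ^ 2 - 1)) (gaussianVector ι) :=
    iIndepFun_pi (μ := fun _ : ι => stdComplexGaussian)
      (X := fun i z => l i * (‖z‖ ^ 2 - 1)) fun i => (hm i).aemeasurable
  have hcomp : ∀ i (g : ℂ → ℝ), Measurable g →
      ∫ x, g (x i) ∂(gaussianVector ι) = ∫ z, g z ∂stdComplexGaussian := fun i g hg => by
    rw [← (hmp i).map_eq, integral_map (hmp i).measurable.aemeasurable hg.aestronglyMeasurable]
  have h1 := one_le_quadConst
  have h2 : 0 ≤ ∫ z, (‖z‖ ^ 2 - 1) ^ 2 ∂stdComplexGaussian := integral_nonneg fun z => sq_nonneg _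
  have h4 : 0 ≤ ∫ z, (‖z‖ ^ 2 - 1) ^ 4 ∂stdComplexGaussian := integral_nonneg fun z => by positivity
  -- The weight l i ² * `quadConst` dominates the second moment, and its square the fourth, because
  -- 1 ≤ `quadConst` gives `quadConst` ≤ `quadConst` ².
  have := (moment_sum_le_of_iIndepFun hind (a := fun i => l i ^ 2 * quadConst) ?_ ?_ ?_ ?_ ?_
    Finset.univ).2
  · rw [← Finset.sum_mul] at this
    linarith [this]
  · exact fun i => (memLp_normSq_sub_one_stdComplexGaussian.const_mul (l i)).comp_measurePreserving
      (hmp i)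
  · intro i
    rw [hcomp i (fun z => l i * (‖z‖ ^ 2 - 1)) (hm i), integral_const_mul, integral_sub _
      (integrable_const _), integral_normSq_stdComplexGaussian]
    · simp
    · exact (memLp_id_stdComplexGaussian 2).integrable_norm_pow (by norm_num)
  · intro i; positivity
  · intro i
    rw [hcomp i (fun z => (l i * (‖z‖ ^ 2 - 1)) ^ 2) (by fun_prop)]
    simp_rw [mul_pow]
    rw [integral_const_mul]
    gcongr
    unfold quadConst; linarith
  · intro i
    rw [hcomp i (fun z => (l i * (‖z‖ ^ 2 - 1)) ^ 4) (by fun_prop)]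
    simp_rw [mul_pow]
    rw [integral_const_mul, ← pow_mul]
    gcongr
    calc _ ≤ quadConst := by unfold quadConst; linarith
      _ ≤ _ := by nlinarith

lemma lintegral_weighted_sum_pow_four_le {ι : Type*} [Fintype ι] (l : ι → ℝ) :
    ∫⁻ x, ENNReal.ofReal ((∑ i, l i * (‖x i‖ ^ 2 - 1)) ^ 4) ∂(gaussianVector ι) ≤
      ENNReal.ofReal (3 * quadConst ^ 2 * (∑ i, l i ^ 2) ^ 2) := by
  have hmp : ∀ i, MeasurePreserving (fun x : ι → ℂ => x i) (gaussianVector ι) stdComplexGaussian :=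
    fun i => measurePreserving_eval (fun _ : ι => stdComplexGaussian) i
  rw [← ofReal_integral_eq_lintegral_ofReal]
  · exact ENNReal.ofReal_le_ofReal (integral_weighted_sum_pow_four_le l)
  · refine integrable_pow_of_memLp_four (memLp_finsetSum _ fun i _ => ?_) le_rfl
    exact (memLp_normSq_sub_one_stdComplexGaussian.const_mul (l i)).comp_measurePreserving (hmp i)
  · exact ae_of_all _ fun x => by positivity

/-- Fourth moment of a centered Hermitian quadratic form in a complex Gaussian vector. -/
lemma lintegral_quadForm_pow_four_le {ι : Type*} [Fintype ι] [DecidableEq ι] {A : Matrix ι ι ℂ}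
    (hA : A.IsHermitian) :
    ∫⁻ x, ENNReal.ofReal (((star x ⬝ᵥ A *ᵥ x).re - A.trace.re) ^ 4) ∂(gaussianVector ι) ≤
      ENNReal.ofReal (3 * quadConst ^ 2 * (∑ i, ∑ j, ‖A i j‖ ^ 2) ^ 2) := by
  -- In an eigenbasis of A the centered form is ∑ l i (‖y i‖² - 1), and unitary invariance lets y be
  -- Gaussian again. The Frobenius norm squared is ∑ l i ².
  obtain ⟨U, l, hUU, hUU', hspec⟩ : ∃ (U : Matrix ι ι ℂ) (l : ι → ℝ), U * Uᴴ = 1 ∧ Uᴴ * U = 1 ∧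
      A = U * Matrix.diagonal (fun i => ((l i : ℝ) : ℂ)) * Uᴴ :=
    ⟨hA.eigenvectorUnitary, hA.eigenvalues, Unitary.coe_mul_star_self hA.eigenvectorUnitary,
      Unitary.coe_star_mul_self hA.eigenvectorUnitary, by
        have := hA.spectral_theorem
        simpa [Unitary.conjStarAlgAut_apply, Matrix.star_eq_conjTranspose, Function.comp_def]
          using this⟩
  set D : Matrix ι ι ℂ := Matrix.diagonal (fun i => ((l i : ℝ) : ℂ)) with hD
  have hquad : ∀ y, star (U *ᵥ y) ⬝ᵥ A *ᵥ (U *ᵥ y) = ∑ i, ((l i * ‖y i‖ ^ 2 : ℝ) : ℂ) := by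
    intro y
    rw [Matrix.star_mulVec, Matrix.mulVec_mulVec, ← Matrix.dotProduct_mulVec, Matrix.mulVec_mulVec]
    have : Uᴴ * (A * U) = D := by
      rw [hspec]
      calc Uᴴ * (U * D * Uᴴ * U) = (Uᴴ * U) * D * (Uᴴ * U) := by simp only [Matrix.mul_assoc]
        _ = D := by simp [hUU']
    rw [this, hD]
    simp only [dotProduct, Matrix.mulVec_diagonal, Pi.star_apply]
    refine Finset.sum_congr rfl fun i _ => ?_
    push_cast
    rw [← Complex.ofReal_pow, ← Complex.normSq_eq_norm_sq, ← Complex.mul_conj]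
    simp only [RCLike.star_def]
    ring
  have htr : A.trace = ∑ i, ((l i : ℝ) : ℂ) := by
    rw [hspec, Matrix.trace_mul_cycle, hUU', Matrix.one_mul, hD, Matrix.trace_diagonal]
  have hfro : ∑ i, ∑ j, ‖A i j‖ ^ 2 = ∑ i, l i ^ 2 := by
    have h1 : (Aᴴ * A).trace = ∑ i, ((l i ^ 2 : ℝ) : ℂ) := by
      rw [hA.eq, hspec]
      have : U * D * Uᴴ * (U * D * Uᴴ) = U * (D * D) * Uᴴ := by
        calc U * D * Uᴴ * (U * D * Uᴴ) = U * D * (Uᴴ * U) * D * Uᴴ := by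
              simp only [Matrix.mul_assoc]
          _ = _ := by rw [hUU']; simp only [Matrix.mul_assoc, Matrix.one_mul]
      rw [this, Matrix.trace_mul_cycle, hUU', Matrix.one_mul, hD, Matrix.diagonal_mul_diagonal,
        Matrix.trace_diagonal]
      simp [sq]
    have h2 : (Aᴴ * A).trace = ((∑ i, ∑ j, ‖A i j‖ ^ 2 : ℝ) : ℂ) := by
      rw [Finset.sum_comm]
      simp only [Matrix.trace, Matrix.diag_apply, Matrix.mul_apply, Matrix.conjTranspose_apply]
      push_cast
      refine Finset.sum_congr rfl fun i _ => Finset.sum_congr rfl fun j _ => ?_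
      rw [← Complex.ofReal_pow, ← Complex.normSq_eq_norm_sq, ← Complex.mul_conj, mul_comm]
      rfl
    rw [h1] at h2
    exact_mod_cast h2.symm
  have hm : Measurable (fun x : ι → ℂ => U *ᵥ x) :=
    (Continuous.matrix_mulVec continuous_const continuous_id).measurable
  conv_lhs => rw [← map_mulVec_gaussianVector U hUU]
  have hq : Measurable (fun x : ι → ℂ => (star x ⬝ᵥ A *ᵥ x).re) :=
    (Complex.continuous_re.comp (Continuous.dotProduct continuous_star
      (Continuous.matrix_mulVec continuous_const continuous_id))).measurable
  rw [lintegral_map (((hq.sub_const _).pow_const 4).ennreal_ofReal) hm, hfro]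
  refine le_trans (le_of_eq (lintegral_congr fun x => ?_))
    (lintegral_weighted_sum_pow_four_le l)
  rw [hquad, htr, Complex.re_sum, Complex.re_sum, ← Finset.sum_sub_distrib]
  simp only [Complex.ofReal_re, mul_sub, mul_one]

/-! ### Polynomials in independent atomless variables vanish with probability zero -/

/-- Induction on the number of variables by Fubini. Viewed as a polynomial in the first variable, p
has a nonzero coefficient; by induction it stays nonzero at almost every value of the others, and
then only finitely many values of the first variable, a null set, are roots. -/
lemma ae_eval_mvPolynomial_ne_zero_fin {ν : Measure ℂ} [IsProbabilityMeasure ν]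
    [NullSingletonClass ν] {n : ℕ} (p : MvPolynomial (Fin n) ℂ) (hp : p ≠ 0) :
    ∀ᵐ x ∂(Measure.pi fun _ : Fin n => ν), MvPolynomial.eval x p ≠ 0 := by
  induction n with
  | zero =>
    refine ae_of_all _ fun x hx => hp ?_
    rw [MvPolynomial.eq_C_of_isEmpty p] at hx ⊢
    simpa using hx
  | succ n ih =>
    have mp := (measurePreserving_piFinSuccAbove (fun _ : Fin (n + 1) => ν) 0).symm
    have hms : MeasurableSet {x : Fin (n + 1) → ℂ | MvPolynomial.eval x p ≠ 0} :=
      ((MvPolynomial.continuous_eval p).measurable (measurableSet_singleton 0)).compl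
    rw [← mp.map_eq, ae_map_iff mp.measurable.aemeasurable hms]
    refine (Measure.ae_prod_iff_ae_ae (mp.measurable hms)).2 ?_
    simp only [Set.mem_ofPred_eq]
    have hev : ∀ (y : ℂ) (s : Fin n → ℂ),
        (MeasurableEquiv.piFinSuccAbove (fun _ : Fin (n + 1) => ℂ) 0).symm (y, s) =
          (Fin.cons y s : Fin (n + 1) → ℂ) := fun y s => by
      ext i
      simp [MeasurableEquiv.piFinSuccAbove, Fin.insertNthEquiv]
    simp_rw [hev]
    -- The order of the quantifiers is exchanged so that the remaining variables are fixed before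
    -- the first one.
    rw [Measure.ae_ae_comm]
    · have hq : MvPolynomial.finSuccEquiv ℂ n p ≠ 0 := by simpa using hp
      obtain ⟨d, hd⟩ : ∃ d, (MvPolynomial.finSuccEquiv ℂ n p).coeff d ≠ 0 := by
        by_contra! hcon
        exact hq (Polynomial.ext fun d => by simpa using hcon d)
      filter_upwards [ih _ hd] with s hs
      simp_rw [MvPolynomial.eval_eq_eval_mv_eval']
      set q := Polynomial.map (MvPolynomial.eval s) (MvPolynomial.finSuccEquiv ℂ n p) with hqdef
      have hq0 : q ≠ 0 := fun h0 => hs (by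
        have := congrArg (fun r => Polynomial.coeff r d) h0
        simpa [hqdef, Polynomial.coeff_map] using this)
      have hfin : {y : ℂ | Polynomial.eval y q = 0}.Finite := by
        refine (q.roots.toFinset.finite_toSet).subset fun y hy => ?_
        simpa [hq0] using hy
      exact (measure_eq_zero_iff_ae_notMem.1 (hfin.measure_zero ν)).mono fun y hy => hy
    · have := mp.measurable hms
      convert this using 1
      ext z
      simp [← hev]

lemma ae_eval_mvPolynomial_ne_zero {ν : Measure ℂ} [IsProbabilityMeasure ν]
    [NullSingletonClass ν] {σ : Type*} [Fintype σ] (p : MvPolynomial σ ℂ) (hp : p ≠ 0) :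
    ∀ᵐ x ∂(Measure.pi fun _ : σ => ν), MvPolynomial.eval x p ≠ 0 := by
  let e := Fintype.equivFin σ
  have mp := measurePreserving_piCongrLeft (fun _ : Fin (Fintype.card σ) => ν) e
  have h0 : MvPolynomial.rename e p ≠ 0 := by
    rw [Ne, ← map_zero (MvPolynomial.rename e), (MvPolynomial.rename_injective _ e.injective).eq_iff]
    exact hp
  have h := ae_eval_mvPolynomial_ne_zero_fin (ν := ν) _ h0
  rw [← mp.map_eq] at h
  filter_upwards [ae_of_ae_map mp.measurable.aemeasurable h] with x hx
  rw [MvPolynomial.eval_rename] at hx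
  have hxe : MeasurableEquiv.piCongrLeft (fun _ => ℂ) e x ∘ e = x := by
    ext i
    simp [MeasurableEquiv.coe_piCongrLeft]
  rwa [hxe] at hx

/-! ### The regularized Gram resolvent -/

section Resolvent

variable {ι κ : Type*} [Fintype ι] [Fintype κ] [DecidableEq ι] [DecidableEq κ]

/-- The squared Euclidean norm of a complex vector. -/
noncomputable def nsq {ι : Type*} [Fintype ι] (v : ι → ℂ) : ℝ := ∑ i, ‖v i‖ ^ 2

lemma nsq_nonneg {ι : Type*} [Fintype ι] (v : ι → ℂ) : 0 ≤ nsq v :=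
  Finset.sum_nonneg fun _ _ => by positivity

lemma star_dotProduct_self {ι : Type*} [Fintype ι] (v : ι → ℂ) : star v ⬝ᵥ v = (nsq v : ℂ) := by
  simp only [nsq, dotProduct, Pi.star_apply]
  push_cast
  refine Finset.sum_congr rfl fun i _ => ?_
  rw [← Complex.ofReal_pow, ← Complex.normSq_eq_norm_sq, ← Complex.mul_conj, mul_comm]
  rfl

/-- The regularized Gram matrix `b² Hᴴ H + α I`. -/
noncomputable def regGram (α b : ℝ) (H : Matrix κ ι ℂ) : Matrix ι ι ℂ :=
  ((b ^ 2 : ℝ) : ℂ) • (Hᴴ * H) + (α : ℂ) • 1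

/-- The resolvent `(b² Hᴴ H + α I)⁻¹`. -/
noncomputable def resolvent (α b : ℝ) (H : Matrix κ ι ℂ) : Matrix ι ι ℂ := (regGram α b H)⁻¹

omit [Fintype ι] [DecidableEq κ] in
lemma regGram_isHermitian (α b : ℝ) (H : Matrix κ ι ℂ) : (regGram α b H).IsHermitian := by
  simp [regGram, Matrix.IsHermitian, Matrix.conjTranspose_add, Matrix.conjTranspose_smul,
    Matrix.conjTranspose_mul]

omit [DecidableEq κ] in
-- This identity replaces spectral theory throughout: it yields the invertibility for α > 0 and, at
-- q = R p, the positivity and the bounds of the resolvent.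
lemma star_dotProduct_regGram (α b : ℝ) (H : Matrix κ ι ℂ) (q : ι → ℂ) :
    star q ⬝ᵥ regGram α b H *ᵥ q = ((b ^ 2 * nsq (H *ᵥ q) + α * nsq q : ℝ) : ℂ) := by
  have h1 : star q ⬝ᵥ (Hᴴ * H) *ᵥ q = (nsq (H *ᵥ q) : ℂ) := by
    rw [← star_dotProduct_self, Matrix.star_mulVec, ← Matrix.mulVec_mulVec, Matrix.dotProduct_mulVec]
  rw [regGram, Matrix.add_mulVec, dotProduct_add, Matrix.smul_mulVec, Matrix.smul_mulVec,
    dotProduct_smul, dotProduct_smul, h1, Matrix.one_mulVec, star_dotProduct_self]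
  push_cast
  simp only [smul_eq_mul]

variable {α : ℝ} (hα : 0 < α) (b : ℝ) (H : Matrix κ ι ℂ)
include hα

omit [DecidableEq κ] in
lemma isUnit_det_regGram : IsUnit (regGram α b H).det := by
  rw [← Matrix.isUnit_iff_isUnit_det, ← Matrix.mulVec_injective_iff_isUnit]
  intro x y hxy
  rw [← sub_eq_zero, ← Matrix.mulVec_sub] at hxy
  have h := star_dotProduct_regGram α b H (x - y)
  rw [hxy, dotProduct_zero] at h
  have h2 : b ^ 2 * nsq (H *ᵥ (x - y)) + α * nsq (x - y) = 0 := by exact_mod_cast h.symm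
  have h3 := nsq_nonneg (H *ᵥ (x - y))
  have h4 : nsq (x - y) = 0 := by
    have h5 := nsq_nonneg (x - y)
    nlinarith [mul_nonneg (sq_nonneg b) h3, mul_nonneg hα.le h5]
  ext i
  have := (Finset.sum_eq_zero_iff_of_nonneg (fun _ _ => by positivity)).1 h4 i (Finset.mem_univ i)
  simpa [sub_eq_zero] using this

omit [DecidableEq κ] in
lemma regGram_mul_resolvent : regGram α b H * resolvent α b H = 1 :=
  Matrix.mul_nonsing_inv _ (isUnit_det_regGram hα b H)

omit [DecidableEq κ] in
lemma resolvent_mul_regGram : resolvent α b H * regGram α b H = 1 :=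
  Matrix.nonsing_inv_mul _ (isUnit_det_regGram hα b H)

omit hα [DecidableEq κ] in
lemma resolvent_isHermitian : (resolvent α b H).IsHermitian :=
  (regGram_isHermitian α b H).inv

omit [DecidableEq κ] in
-- The equation defining the inverse, solved for the Gram part. Its traces, alone and after
-- multiplication by the resolvent, become the two sum rules over the users.
lemma gram_mul_resolvent :
    ((b ^ 2 : ℝ) : ℂ) • (Hᴴ * H) * resolvent α b H = 1 - (α : ℂ) • resolvent α b H := by
  have h := regGram_mul_resolvent hα b H
  rw [regGram, add_mul, smul_mul_assoc (α : ℂ), one_mul] at h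
  exact eq_sub_of_add_eq h

omit [DecidableEq κ] in
lemma regGram_mulVec_resolvent (p : ι → ℂ) : regGram α b H *ᵥ (resolvent α b H *ᵥ p) = p := by
  rw [Matrix.mulVec_mulVec, regGram_mul_resolvent hα, Matrix.one_mulVec]

/-- The quadratic form of the resolvent. -/
noncomputable def resQuad {ι κ : Type*} [Fintype ι] [Fintype κ] [DecidableEq ι]
    (α b : ℝ) (H : Matrix κ ι ℂ) (p : ι → ℂ) : ℝ :=
  (star p ⬝ᵥ resolvent α b H *ᵥ p).re

omit [DecidableEq κ] in
lemma star_dotProduct_resolvent_eq (p : ι → ℂ) :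
    star p ⬝ᵥ resolvent α b H *ᵥ p =
      ((b ^ 2 * nsq (H *ᵥ (resolvent α b H *ᵥ p)) + α * nsq (resolvent α b H *ᵥ p) : ℝ) : ℂ) := by
  have h := regGram_mulVec_resolvent hα b H p
  rw [← star_dotProduct_regGram, Matrix.dotProduct_mulVec]
  rw [h, Matrix.star_mulVec, (resolvent_isHermitian b H).eq]

omit [DecidableEq κ] in
lemma star_dotProduct_resolvent (p : ι → ℂ) :
    star p ⬝ᵥ resolvent α b H *ᵥ p = (resQuad α b H p : ℂ) := by
  rw [resQuad, star_dotProduct_resolvent_eq hα, Complex.ofReal_re]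

omit hα [DecidableEq κ] in
lemma star_dotProduct_resolvent_sq (p : ι → ℂ) :
    star p ⬝ᵥ (resolvent α b H * resolvent α b H) *ᵥ p = (nsq (resolvent α b H *ᵥ p) : ℂ) := by
  rw [← star_dotProduct_self, Matrix.star_mulVec, (resolvent_isHermitian b H).eq,
    ← Matrix.mulVec_mulVec, Matrix.dotProduct_mulVec]

omit [DecidableEq κ] in
lemma mul_nsq_resolvent_le (p : ι → ℂ) :
    α * nsq (resolvent α b H *ᵥ p) ≤ resQuad α b H p := by
  rw [resQuad, star_dotProduct_resolvent_eq hα, Complex.ofReal_re]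
  have := nsq_nonneg (H *ᵥ (resolvent α b H *ᵥ p))
  nlinarith [mul_nonneg (sq_nonneg b) this]

omit [DecidableEq κ] in
lemma resQuad_nonneg (p : ι → ℂ) : 0 ≤ resQuad α b H p :=
  (mul_nonneg hα.le (nsq_nonneg _)).trans (mul_nsq_resolvent_le hα b H p)

omit [DecidableEq κ] in
-- With q = R p and y = Hᴴ H q one has p = b² y + α q. Expanding both sides leaves the difference b⁴
-- ‖y‖² + α b² ‖H q‖² ≥ 0.
lemma mul_resQuad_le (p : ι → ℂ) : α * resQuad α b H p ≤ nsq p := by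
  obtain ⟨q, hq⟩ : ∃ q, q = resolvent α b H *ᵥ p := ⟨_, rfl⟩
  have hp : p = ((b ^ 2 : ℝ) : ℂ) • (Hᴴ *ᵥ (H *ᵥ q)) + (α : ℂ) • q := by
    conv_lhs => rw [← regGram_mulVec_resolvent hα b H p, ← hq, regGram, Matrix.add_mulVec,
      Matrix.smul_mulVec, Matrix.smul_mulVec, Matrix.one_mulVec, ← Matrix.mulVec_mulVec]
  obtain ⟨y, hy⟩ : ∃ y, y = Hᴴ *ᵥ (H *ᵥ q) := ⟨_, rfl⟩
  rw [← hy] at hp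
  have hqy : star q ⬝ᵥ y = (nsq (H *ᵥ q) : ℂ) := by
    rw [hy, ← star_dotProduct_self, Matrix.star_mulVec, Matrix.dotProduct_mulVec]
  have hyq : star y ⬝ᵥ q = (nsq (H *ᵥ q) : ℂ) := by
    rw [hy, ← star_dotProduct_self, Matrix.star_mulVec, Matrix.conjTranspose_conjTranspose,
      ← Matrix.dotProduct_mulVec]
  have h1 : (nsq p : ℂ) = ((b ^ 4 * nsq y + 2 * α * b ^ 2 * nsq (H *ᵥ q) + α ^ 2 * nsq q : ℝ) : ℂ) := by
    rw [← star_dotProduct_self, hp]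
    simp only [star_add, star_smul, add_dotProduct, dotProduct_add, smul_dotProduct,
      dotProduct_smul, hqy, hyq, star_dotProduct_self, smul_eq_mul, RCLike.star_def,
      Complex.conj_ofReal]
    push_cast
    ring
  have h2 : nsq p = b ^ 4 * nsq y + 2 * α * b ^ 2 * nsq (H *ᵥ q) + α ^ 2 * nsq q := by
    exact_mod_cast h1
  rw [h2, resQuad, star_dotProduct_resolvent_eq hα, Complex.ofReal_re, ← hq]
  have e1 := mul_nonneg (by positivity : 0 ≤ b ^ 4) (nsq_nonneg y)
  have e2 := mul_nonneg (by positivity : 0 ≤ α * b ^ 2) (nsq_nonneg (H *ᵥ q))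
  nlinarith

omit [DecidableEq κ] in
lemma nsq_resolvent_le (p : ι → ℂ) : nsq (resolvent α b H *ᵥ p) ≤ (1 / α) ^ 2 * nsq p := by
  have h1 := mul_nsq_resolvent_le hα b H p
  have h2 := mul_resQuad_le hα b H p
  have h3 : α ^ 2 * nsq (resolvent α b H *ᵥ p) ≤ nsq p := by nlinarith
  rw [div_pow, one_pow, one_div, ← div_eq_inv_mul, le_div_iff₀ (by positivity)]
  linarith

omit hα in
omit [DecidableEq κ] [Fintype κ] in
lemma sum_norm_sq_eq_sum_nsq (A : Matrix κ ι ℂ) [Fintype κ] :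
    ∑ i, ∑ j, ‖A i j‖ ^ 2 = ∑ j, nsq (A *ᵥ Pi.single j 1) := by
  rw [Finset.sum_comm]
  simp [nsq]

omit hα in
omit [Fintype κ] [DecidableEq κ] in
lemma nsq_single (j : ι) : nsq (Pi.single j (1 : ℂ)) = 1 := by
  rw [nsq, Finset.sum_eq_single j]
  · simp
  · intro i _ hi; simp [hi]
  · simp

omit [DecidableEq κ] in
-- Each column R e_j has squared norm at most 1/α². Growth only linear in the dimension is what
-- makes the normalized quadratic forms concentrate.
lemma sum_norm_sq_resolvent_le :
    ∑ i, ∑ j, ‖resolvent α b H i j‖ ^ 2 ≤ Fintype.card ι * (1 / α) ^ 2 := by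
  rw [sum_norm_sq_eq_sum_nsq]
  calc _ ≤ ∑ _j : ι, (1 / α) ^ 2 := Finset.sum_le_sum fun j _ => by
        simpa [nsq_single] using nsq_resolvent_le hα b H (Pi.single j 1)
    _ = _ := by simp

omit [DecidableEq κ] in
lemma sum_norm_sq_resolvent_sq_le :
    ∑ i, ∑ j, ‖(resolvent α b H * resolvent α b H) i j‖ ^ 2 ≤ Fintype.card ι * (1 / α) ^ 4 := by
  rw [sum_norm_sq_eq_sum_nsq]
  calc _ ≤ ∑ _j : ι, (1 / α) ^ 4 := Finset.sum_le_sum fun j _ => by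
        rw [← Matrix.mulVec_mulVec]
        calc _ ≤ (1 / α) ^ 2 * nsq (resolvent α b H *ᵥ Pi.single j 1) := nsq_resolvent_le hα b H _
          _ ≤ (1 / α) ^ 2 * ((1 / α) ^ 2 * nsq (Pi.single j 1)) := by
            gcongr; exact nsq_resolvent_le hα b H _
          _ = (1 / α) ^ 4 := by rw [nsq_single]; ring
    _ = _ := by simp

/-! ### Removing one row -/

omit hα [Fintype ι] [DecidableEq ι] in
-- Zeroing a row, rather than deleting it, keeps the matrix type while having the same effect on the
-- Gram matrix.
lemma gram_updateRow_zero (k : κ) :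
    Hᴴ * H = (H.updateRow k 0)ᴴ * H.updateRow k 0 + Matrix.vecMulVec (star (H k)) (H k) := by
  ext i j
  simp only [Matrix.mul_apply, Matrix.conjTranspose_apply, Matrix.add_apply, Matrix.vecMulVec_apply,
    Pi.star_apply]
  rw [← Finset.add_sum_erase _ _ (Finset.mem_univ k), ← Finset.add_sum_erase _ (fun x =>
    star (H.updateRow k 0 x i) * H.updateRow k 0 x j) (Finset.mem_univ k)]
  have : ∀ x ∈ Finset.univ.erase k, star (H x i) * H x j =
      star (H.updateRow k 0 x i) * H.updateRow k 0 x j := fun x hx => by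
    rw [Matrix.updateRow_ne (Finset.ne_of_mem_erase hx)]
  rw [Finset.sum_congr rfl this]
  simp
  ring

omit hα [Fintype ι] in
lemma regGram_eq_updateRow (k : κ) :
    regGram α b H = regGram α b (H.updateRow k 0) +
      ((b ^ 2 : ℝ) : ℂ) • Matrix.vecMulVec (star (H k)) (H k) := by
  rw [regGram, gram_updateRow_zero H k, regGram, smul_add]
  abel

/-- `h_kᴴ R_k h_k`, with `R_k` the resolvent with the `k`-th row left out. -/
noncomputable def looQuad {ι κ : Type*} [Fintype ι] [Fintype κ] [DecidableEq ι] [DecidableEq κ]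
    (α b : ℝ) (H : Matrix κ ι ℂ) (k : κ) : ℝ :=
  resQuad α b (H.updateRow k 0) (star (H k))

/-- `h_kᴴ R_k² h_k`, with `R_k` the resolvent with the `k`-th row left out. -/
noncomputable def looQuadSq {ι κ : Type*} [Fintype ι] [Fintype κ] [DecidableEq ι] [DecidableEq κ]
    (α b : ℝ) (H : Matrix κ ι ℂ) (k : κ) : ℝ :=
  nsq (resolvent α b (H.updateRow k 0) *ᵥ star (H k))

lemma looQuad_nonneg (k : κ) : 0 ≤ looQuad α b H k := resQuad_nonneg hα b _ _

omit hα in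
lemma looQuadSq_nonneg (k : κ) : 0 ≤ looQuadSq α b H k := nsq_nonneg _

lemma mul_looQuadSq_le (k : κ) : α * looQuadSq α b H k ≤ looQuad α b H k :=
  mul_nsq_resolvent_le hα b _ _

lemma one_add_looQuad_pos (k : κ) : 0 < 1 + b ^ 2 * looQuad α b H k := by
  have := mul_nonneg (sq_nonneg b) (looQuad_nonneg hα b H k)
  linarith

/-- Sherman–Morrison applied to h_k: the full regularized Gram matrix sends R_k h_k to (1 + b² h_kᴴ
R_k h_k) h_k. -/
lemma resolvent_updateRow_mulVec (k : κ) :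
    resolvent α b (H.updateRow k 0) *ᵥ star (H k) =
      ((1 + b ^ 2 * looQuad α b H k : ℝ) : ℂ) • (resolvent α b H *ᵥ star (H k)) := by
  have h1 : regGram α b H *ᵥ (resolvent α b (H.updateRow k 0) *ᵥ star (H k)) =
      ((1 + b ^ 2 * looQuad α b H k : ℝ) : ℂ) • star (H k) := by
    rw [regGram_eq_updateRow b H k, Matrix.add_mulVec, regGram_mulVec_resolvent hα,
      Matrix.smul_mulVec, Matrix.vecMulVec_mulVec]
    have := star_dotProduct_resolvent hα b (H.updateRow k 0) (star (H k))
    rw [star_star] at this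
    rw [this, looQuad]
    ext i
    simp
    ring
  have h2 := congrArg (fun v => resolvent α b H *ᵥ v) h1
  simpa [Matrix.mulVec_mulVec, ← Matrix.mul_assoc, resolvent_mul_regGram hα, Matrix.mulVec_smul]
    using h2

lemma resQuad_row (k : κ) :
    resQuad α b H (star (H k)) = looQuad α b H k / (1 + b ^ 2 * looQuad α b H k) := by
  have hpos := one_add_looQuad_pos hα b H k
  rw [eq_div_iff hpos.ne']
  conv_rhs => rw [looQuad, resQuad, resolvent_updateRow_mulVec hα]
  rw [dotProduct_smul, star_dotProduct_resolvent hα, smul_eq_mul, ← Complex.ofReal_mul,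
    Complex.ofReal_re, mul_comm]

omit hα [DecidableEq ι] in
lemma nsq_smul_real (c : ℝ) (v : ι → ℂ) : nsq ((c : ℂ) • v) = c ^ 2 * nsq v := by
  simp [nsq, mul_pow, Finset.mul_sum]

lemma nsq_resolvent_row (k : κ) :
    nsq (resolvent α b H *ᵥ star (H k)) = looQuadSq α b H k / (1 + b ^ 2 * looQuad α b H k) ^ 2 := by
  have hpos := one_add_looQuad_pos hα b H k
  rw [eq_div_iff (by positivity), looQuadSq, resolvent_updateRow_mulVec hα, nsq_smul_real]
  ring

/-! ### Traces -/

/-- The trace of the resolvent. -/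
noncomputable def trRes {ι κ : Type*} [Fintype ι] [Fintype κ] [DecidableEq ι]
    (α b : ℝ) (H : Matrix κ ι ℂ) : ℝ := (resolvent α b H).trace.re

/-- The trace of the squared resolvent. -/
noncomputable def trResSq {ι κ : Type*} [Fintype ι] [Fintype κ] [DecidableEq ι]
    (α b : ℝ) (H : Matrix κ ι ℂ) : ℝ := (resolvent α b H * resolvent α b H).trace.re

omit hα [DecidableEq ι] [DecidableEq κ] in
lemma trace_mul_gram (A : Matrix ι ι ℂ) :
    (Hᴴ * H * A).trace = ∑ k, star (star (H k)) ⬝ᵥ A *ᵥ star (H k) := by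
  rw [Matrix.mul_assoc, Matrix.trace_mul_comm, Matrix.trace]
  refine Finset.sum_congr rfl fun k _ => ?_
  rw [Matrix.diag_apply, star_star, Matrix.mul_assoc, Matrix.mul_apply]
  rfl

/-- The trace of `gram_mul_resolvent`, each summand h_kᴴ R h_k being rewritten by `resQuad_row`.
Dividing by N and replacing all `looQuad` by one value gives the scalar equation `mBar_equation`. -/
lemma sum_looQuad_eq :
    ∑ k, b ^ 2 * looQuad α b H k / (1 + b ^ 2 * looQuad α b H k) =
      Fintype.card ι - α * trRes α b H := by
  have h := congrArg Matrix.trace (gram_mul_resolvent hα b H)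
  rw [smul_mul_assoc, Matrix.trace_smul, trace_mul_gram, Matrix.trace_sub, Matrix.trace_smul,
    Matrix.trace_one] at h
  simp_rw [star_dotProduct_resolvent hα, resQuad_row hα] at h
  have h2 := congrArg Complex.re h
  rw [← Complex.ofReal_sum, smul_eq_mul, ← Complex.ofReal_mul, Complex.ofReal_re] at h2
  simp_rw [mul_div_assoc]
  rw [← Finset.mul_sum, h2, trRes]
  simp

omit [DecidableEq κ] in
lemma gram_mul_resolvent_sq :
    ((b ^ 2 : ℝ) : ℂ) • (Hᴴ * H) * (resolvent α b H * resolvent α b H) =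
      resolvent α b H - (α : ℂ) • (resolvent α b H * resolvent α b H) := by
  rw [← Matrix.mul_assoc, gram_mul_resolvent hα, sub_mul, one_mul, smul_mul_assoc]

/-- The second-order companion of `sum_looQuad_eq`; its scalar version is `vBar_equation`. -/
lemma sum_looQuadSq_eq :
    ∑ k, b ^ 2 * looQuadSq α b H k / (1 + b ^ 2 * looQuad α b H k) ^ 2 =
      trRes α b H - α * trResSq α b H := by
  have h := congrArg Matrix.trace (gram_mul_resolvent_sq hα b H)
  rw [smul_mul_assoc, Matrix.trace_smul, trace_mul_gram, Matrix.trace_sub, Matrix.trace_smul] at h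
  simp_rw [star_dotProduct_resolvent_sq, nsq_resolvent_row hα] at h
  have h2 := congrArg Complex.re h
  rw [← Complex.ofReal_sum, smul_eq_mul, ← Complex.ofReal_mul, Complex.ofReal_re] at h2
  simp_rw [mul_div_assoc]
  rw [← Finset.mul_sum, h2, trRes, trResSq]
  simp

omit [DecidableEq κ] in
lemma trRes_nonneg : 0 ≤ trRes α b H := by
  rw [trRes, Matrix.trace, Complex.re_sum]
  refine Finset.sum_nonneg fun i _ => ?_
  have := resQuad_nonneg hα b H (Pi.single i 1)
  simpa [resQuad, ← Pi.single_star] using this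

omit hα [DecidableEq κ] in
lemma trResSq_nonneg : 0 ≤ trResSq α b H := by
  rw [trResSq, Matrix.trace, Complex.re_sum]
  refine Finset.sum_nonneg fun i _ => ?_
  have := star_dotProduct_resolvent_sq (α := α) b H (Pi.single i 1)
  have h2 := congrArg Complex.re this
  rw [Complex.ofReal_re] at h2
  have h3 := nsq_nonneg (resolvent α b H *ᵥ Pi.single i 1)
  rw [← h2] at h3
  simpa [← Pi.single_star] using h3

lemma mul_trRes_le : α * trRes α b H ≤ Fintype.card ι := by
  have h := sum_looQuad_eq hα b H
  have : 0 ≤ ∑ k, b ^ 2 * looQuad α b H k / (1 + b ^ 2 * looQuad α b H k) :=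
    Finset.sum_nonneg fun k _ => div_nonneg (mul_nonneg (sq_nonneg b) (looQuad_nonneg hα b H k))
      (one_add_looQuad_pos hα b H k).le
  linarith

lemma mul_trResSq_le : α * trResSq α b H ≤ trRes α b H := by
  have h := sum_looQuadSq_eq hα b H
  have : 0 ≤ ∑ k, b ^ 2 * looQuadSq α b H k / (1 + b ^ 2 * looQuad α b H k) ^ 2 :=
    Finset.sum_nonneg fun k _ => div_nonneg (mul_nonneg (sq_nonneg b) (looQuadSq_nonneg b H k))
      (sq_nonneg _)
  linarith

/-- The resolvent identity for a rank-one difference; R h_k is a multiple of R_k h_k, so the result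
is a nonnegative multiple of a rank-one projection. -/
lemma resolvent_updateRow_sub (k : κ) :
    resolvent α b (H.updateRow k 0) - resolvent α b H =
      ((b ^ 2 / (1 + b ^ 2 * looQuad α b H k) : ℝ) : ℂ) •
        Matrix.vecMulVec (resolvent α b (H.updateRow k 0) *ᵥ star (H k))
          (star (resolvent α b (H.updateRow k 0) *ᵥ star (H k))) := by
  set R0 := resolvent α b (H.updateRow k 0) with hR0
  set R := resolvent α b H with hR
  have hpos := one_add_looQuad_pos hα b H k
  have h1 : R0 - R = R0 * (regGram α b H - regGram α b (H.updateRow k 0)) * R := by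
    rw [mul_sub, sub_mul, Matrix.mul_assoc, hR, regGram_mul_resolvent hα, hR0,
      resolvent_mul_regGram hα, mul_one, one_mul]
  have h2 : R *ᵥ star (H k) =
      (((1 + b ^ 2 * looQuad α b H k)⁻¹ : ℝ) : ℂ) • (R0 *ᵥ star (H k)) := by
    rw [hR0, resolvent_updateRow_mulVec hα, smul_smul, ← Complex.ofReal_mul,
      inv_mul_cancel₀ hpos.ne']
    simp [hR]
  have h3 : H k ᵥ* R = star (R *ᵥ star (H k)) := by
    rw [Matrix.star_mulVec, star_star, hR, (resolvent_isHermitian b H).eq]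
  rw [h1, regGram_eq_updateRow b H k, add_sub_cancel_left, Matrix.mul_smul, Matrix.smul_mul,
    Matrix.mul_vecMulVec, Matrix.vecMulVec_mul, h3, h2, star_smul, Matrix.vecMulVec_smul, smul_smul]
  congr 1
  simp [div_eq_mul_inv]

lemma trRes_updateRow_sub (k : κ) :
    trRes α b (H.updateRow k 0) - trRes α b H =
      b ^ 2 * looQuadSq α b H k / (1 + b ^ 2 * looQuad α b H k) := by
  have h := congrArg (fun A => (Matrix.trace A).re) (resolvent_updateRow_sub hα b H k)
  simp only [Matrix.trace_sub, Matrix.trace_smul, Matrix.trace_vecMulVec, Complex.sub_re] at h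
  rw [trRes, trRes, h, dotProduct_comm, star_dotProduct_self, smul_eq_mul, ← Complex.ofReal_mul,
    Complex.ofReal_re, looQuadSq]
  ring

/-- Since α R_k² ≤ R_k as forms, the ratio is at most x / (1 + x) divided by α. The bound is uniform
in H and in the dimension, so one row affects the trace by O(1) only. -/
lemma looQuadSq_div_le (k : κ) :
    b ^ 2 * looQuadSq α b H k / (1 + b ^ 2 * looQuad α b H k) ≤ 1 / α := by
  rw [div_le_div_iff₀ (one_add_looQuad_pos hα b H k) hα]
  have := mul_le_mul_of_nonneg_left (mul_looQuadSq_le hα b H k) (sq_nonneg b)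
  linarith

lemma abs_trRes_updateRow_sub_le (k : κ) :
    |trRes α b (H.updateRow k 0) - trRes α b H| ≤ 1 / α := by
  rw [trRes_updateRow_sub hα, abs_of_nonneg]
  · exact looQuadSq_div_le hα b H k
  · exact div_nonneg (mul_nonneg (sq_nonneg b) (looQuadSq_nonneg b H k))
      (one_add_looQuad_pos hα b H k).le

lemma abs_trResSq_updateRow_sub_le (k : κ) :
    |trResSq α b (H.updateRow k 0) - trResSq α b H| ≤ 2 / α ^ 2 := by
  set R0 := resolvent α b (H.updateRow k 0) with hR0
  set R := resolvent α b H with hR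
  set p := R0 *ᵥ star (H k) with hp
  set c := b ^ 2 / (1 + b ^ 2 * looQuad α b H k) with hc
  have hpos := one_add_looQuad_pos hα b H k
  have hc0 : 0 ≤ c := div_nonneg (sq_nonneg b) hpos.le
  -- R0 and R need not commute, but the cross terms cancel under the trace.
  have h1 : (R0 * R0).trace - (R * R).trace = ((R0 - R) * (R0 + R)).trace := by
    rw [sub_mul, mul_add, mul_add, Matrix.trace_sub, Matrix.trace_add, Matrix.trace_add,
      Matrix.trace_mul_comm R R0]
    ring
  have h2 : (R0 * R0).trace - (R * R).trace =
      ((c * (resQuad α b (H.updateRow k 0) p + resQuad α b H p) : ℝ) : ℂ) := by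
    rw [h1, resolvent_updateRow_sub hα b H k, smul_mul_assoc, Matrix.trace_smul,
      Matrix.vecMulVec_mul, Matrix.trace_vecMulVec, dotProduct_comm, Matrix.vecMul_add,
      add_dotProduct, ← Matrix.dotProduct_mulVec, ← Matrix.dotProduct_mulVec, ← hp,
      star_dotProduct_resolvent hα, star_dotProduct_resolvent hα, ← hc]
    push_cast
    rfl
  have h3 : trResSq α b (H.updateRow k 0) - trResSq α b H =
      c * (resQuad α b (H.updateRow k 0) p + resQuad α b H p) := by
    rw [trResSq, trResSq, ← Complex.sub_re, ← hR0, ← hR, h2, Complex.ofReal_re]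
  have e1 : resQuad α b (H.updateRow k 0) p ≤ nsq p / α := by
    rw [le_div_iff₀ hα, mul_comm]; exact mul_resQuad_le hα b _ p
  have e2 : resQuad α b H p ≤ nsq p / α := by
    rw [le_div_iff₀ hα, mul_comm]; exact mul_resQuad_le hα b _ p
  have e3 : c * nsq p ≤ 1 / α := by
    have := looQuadSq_div_le hα b H k
    rw [looQuadSq, ← hR0, ← hp] at this
    calc c * nsq p = b ^ 2 * nsq p / (1 + b ^ 2 * looQuad α b H k) := by rw [hc]; ring
      _ ≤ _ := this
  rw [h3, abs_of_nonneg (mul_nonneg hc0 (add_nonneg (resQuad_nonneg hα b _ p)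
    (resQuad_nonneg hα b _ p)))]
  calc c * (resQuad α b (H.updateRow k 0) p + resQuad α b H p)
      ≤ c * (nsq p / α + nsq p / α) := by gcongr
    _ = 2 / α * (c * nsq p) := by ring
    _ ≤ 2 / α * (1 / α) := by gcongr
    _ = 2 / α ^ 2 := by ring

end Resolvent

/-! ### The precoder when the primary channel matrix is invertible -/

section Precoder

variable {K N : ℕ}

open scoped ComplexOrder in
-- Wᴴ W = Fᴴ (F Fᴴ)⁻¹ F is the projection onto the row space of F, here the whole space.
lemma conjTranspose_mul_rowSpaceIsometry (F : Matrix (Fin N) (Fin N) ℂ) (hF : IsUnit F.det) :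
    (rowSpaceIsometry F)ᴴ * rowSpaceIsometry F = 1 := by
  set S := CFC.sqrt (F * Fᴴ) with hS
  have hnn : 0 ≤ F * Fᴴ := (Matrix.posSemidef_self_mul_conjTranspose F).nonneg
  have hSS : S * S = F * Fᴴ := CFC.sqrt_mul_sqrt_self _ hnn
  have hSh : Sᴴ = S := (Matrix.nonneg_iff_posSemidef.1 (CFC.sqrt_nonneg (F * Fᴴ))).1
  have hFh : IsUnit (Fᴴ).det := by rw [Matrix.det_conjTranspose]; exact hF.star
  rw [rowSpaceIsometry, ← hS, Matrix.conjTranspose_mul, Matrix.conjTranspose_nonsing_inv, hSh]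
  calc Fᴴ * S⁻¹ * (S⁻¹ * F) = Fᴴ * (S⁻¹ * S⁻¹) * F := by simp only [Matrix.mul_assoc]
    _ = Fᴴ * ((Fᴴ)⁻¹ * F⁻¹) * F := by rw [← Matrix.mul_inv_rev, hSS, Matrix.mul_inv_rev]
    _ = (Fᴴ * (Fᴴ)⁻¹) * (F⁻¹ * F) := by simp only [Matrix.mul_assoc]
    _ = 1 := by rw [Matrix.mul_nonsing_inv _ hFh, Matrix.nonsing_inv_mul _ hF, one_mul]

lemma rawPrecoder_eq (α β : ℝ) (H : Matrix (Fin K) (Fin N) ℂ) (F : Matrix (Fin N) (Fin N) ℂ)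
    (hF : IsUnit F.det) :
    rawPrecoder α β H F = ((1 - β : ℝ) : ℂ) • (resolvent α (1 - β) H * Hᴴ) := by
  have h1 : partialProjection β H F = ((1 - β : ℝ) : ℂ) • H := by
    rw [partialProjection, conjTranspose_mul_rowSpaceIsometry F hF]
    push_cast
    rw [Matrix.mul_sub, Matrix.mul_one, Matrix.mul_smul, Matrix.mul_one, sub_smul, one_smul]
  rw [rawPrecoder, h1, resolvent, regGram, Matrix.conjTranspose_smul]
  have hst : star ((1 - β : ℝ) : ℂ) = ((1 - β : ℝ) : ℂ) := Complex.conj_ofReal _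
  rw [hst, Matrix.smul_mul, Matrix.mul_smul, Matrix.mul_smul, smul_smul, ← Complex.ofReal_mul, ← sq]

/-- The precoder `b (b² Hᴴ H + α)⁻¹ Hᴴ`. -/
noncomputable def precoder (α b : ℝ) (H : Matrix (Fin K) (Fin N) ℂ) : Matrix (Fin N) (Fin K) ℂ :=
  (b : ℂ) • (resolvent α b H * Hᴴ)

variable {α : ℝ} (hα : 0 < α) (b : ℝ) (H : Matrix (Fin K) (Fin N) ℂ)
include hα

/-- One use of `gram_mul_resolvent` removes H, so transmit power, interference and received power
involve only R and R². -/
lemma precoder_mul_conjTranspose :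
    precoder α b H * (precoder α b H)ᴴ =
      resolvent α b H - (α : ℂ) • (resolvent α b H * resolvent α b H) := by
  have hst : star (b : ℂ) = b := Complex.conj_ofReal _
  rw [precoder, Matrix.conjTranspose_smul, Matrix.conjTranspose_mul,
    Matrix.conjTranspose_conjTranspose, (resolvent_isHermitian b H).eq, hst, Matrix.smul_mul,
    Matrix.mul_smul, smul_smul, ← Complex.ofReal_mul, ← sq]
  calc ((b ^ 2 : ℝ) : ℂ) • (resolvent α b H * Hᴴ * (H * resolvent α b H))
      = resolvent α b H * (((b ^ 2 : ℝ) : ℂ) • (Hᴴ * H) * resolvent α b H) := by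
        rw [Matrix.smul_mul, Matrix.mul_smul]; simp only [Matrix.mul_assoc]
    _ = _ := by rw [gram_mul_resolvent hα, mul_sub, mul_one, Matrix.mul_smul]

lemma txPower_precoder :
    txPower (precoder α b H) = (1 / (N : ℝ)) * (trRes α b H - α * trResSq α b H) := by
  rw [txPower, precoder_mul_conjTranspose hα, Matrix.trace_sub, Matrix.trace_smul, trRes, trResSq]
  simp

omit hα in
lemma mul_precoder_apply (i j : Fin K) :
    (H * precoder α b H) i j = b * (star (star (H i)) ⬝ᵥ resolvent α b H *ᵥ star (H j)) := by
  rw [precoder, Matrix.mul_smul, Matrix.smul_apply, smul_eq_mul, star_star, Matrix.mul_apply]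
  rfl

lemma mul_precoder_diag (k : Fin K) :
    (H * precoder α b H) k k =
      ((b * looQuad α b H k / (1 + b ^ 2 * looQuad α b H k) : ℝ) : ℂ) := by
  rw [mul_precoder_apply, star_dotProduct_resolvent hα, resQuad_row hα]
  push_cast
  ring

/-- The total power received by user k is a diagonal entry of H T Tᴴ Hᴴ. The interference alone is
then found by subtracting the useful signal. -/
lemma sum_norm_sq_mul_precoder (k : Fin K) :
    ∑ j, ‖(H * precoder α b H) k j‖ ^ 2 =
      looQuad α b H k / (1 + b ^ 2 * looQuad α b H k) -
        α * (looQuadSq α b H k / (1 + b ^ 2 * looQuad α b H k) ^ 2) := by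
  have h1 : ((H * precoder α b H) * (H * precoder α b H)ᴴ) k k =
      ((∑ j, ‖(H * precoder α b H) k j‖ ^ 2 : ℝ) : ℂ) := by
    rw [Matrix.mul_apply]
    push_cast
    refine Finset.sum_congr rfl fun j _ => ?_
    rw [Matrix.conjTranspose_apply, ← Complex.ofReal_pow, ← Complex.normSq_eq_norm_sq,
      ← Complex.mul_conj]
    rfl
  have h2 : (H * precoder α b H) * (H * precoder α b H)ᴴ =
      H * (resolvent α b H - (α : ℂ) • (resolvent α b H * resolvent α b H)) * Hᴴ := by
    rw [← precoder_mul_conjTranspose hα, Matrix.conjTranspose_mul]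
    simp only [Matrix.mul_assoc]
  have h3 : (H * (resolvent α b H - (α : ℂ) • (resolvent α b H * resolvent α b H)) * Hᴴ) k k =
      star (star (H k)) ⬝ᵥ (resolvent α b H - (α : ℂ) • (resolvent α b H * resolvent α b H)) *ᵥ
        star (H k) := by
    rw [star_star, Matrix.mul_assoc, Matrix.mul_apply]
    rfl
  rw [h2, h3, Matrix.sub_mulVec, Matrix.smul_mulVec, dotProduct_sub, dotProduct_smul,
    star_dotProduct_resolvent hα, star_dotProduct_resolvent_sq, resQuad_row hα,
    nsq_resolvent_row hα, smul_eq_mul] at h1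
  exact_mod_cast h1.symm

/-- The SINR of the precoder in terms of the leave-one-out quadratic forms. -/
lemma sinr_precoder (σ2 : ℝ) {x : ℝ} (hx : 0 ≤ x) (k : Fin K) :
    sinr σ2 H (((√x : ℝ) : ℂ) • precoder α b H) k =
      x * (b ^ 2 * looQuad α b H k ^ 2) /
        (x * (looQuad α b H k - α * looQuadSq α b H k) +
          σ2 * (1 + b ^ 2 * looQuad α b H k) ^ 2) := by
  have hpos := one_add_looQuad_pos hα b H k
  have h1 : ∀ j, ‖(H * (((√x : ℝ) : ℂ) • precoder α b H)) k j‖ ^ 2 =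
      x * ‖(H * precoder α b H) k j‖ ^ 2 := fun j => by
    rw [Matrix.mul_smul, Matrix.smul_apply, norm_smul, mul_pow, Complex.norm_real, Real.norm_eq_abs,
      sq_abs, Real.sq_sqrt hx]
  have h2 := sum_norm_sq_mul_precoder hα b H k
  rw [← Finset.add_sum_erase _ _ (Finset.mem_univ k)] at h2
  have h3 : ‖(H * precoder α b H) k k‖ ^ 2 =
      (b * looQuad α b H k / (1 + b ^ 2 * looQuad α b H k)) ^ 2 := by
    rw [mul_precoder_diag hα, Complex.norm_real, Real.norm_eq_abs, sq_abs]
  -- With U, V the two leave-one-out forms and p = 1 + b² U, this is U/p - α V/p² - b² U²/p² = (U -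
  -- α V)/p².
  have h4 : ∑ j ∈ Finset.univ.erase k, ‖(H * precoder α b H) k j‖ ^ 2 =
      (looQuad α b H k - α * looQuadSq α b H k) / (1 + b ^ 2 * looQuad α b H k) ^ 2 := by
    rw [← eq_sub_iff_add_eq'] at h2
    rw [h2, h3]
    field_simp
    ring
  rw [sinr]
  simp_rw [h1]
  rw [← Finset.mul_sum, h4, h3]
  rw [← mul_div_mul_right _ _ (pow_pos hpos 2).ne']
  have hne := hpos.ne'
  congr 1
  · field_simp
  · rw [add_mul, mul_assoc, div_mul_cancel₀ _ (pow_ne_zero 2 hne)]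

end Precoder

/-! ### Continuity and measurability -/

lemma continuous_resolvent {ι κ : Type*} [Fintype ι] [Fintype κ] [DecidableEq ι] [DecidableEq κ]
    {α : ℝ} (hα : 0 < α) (b : ℝ) :
    Continuous (fun H : Matrix κ ι ℂ => resolvent α b H) := by
  have hG : Continuous (fun H : Matrix κ ι ℂ => regGram α b H) := by
    unfold regGram
    fun_prop
  have : (fun H : Matrix κ ι ℂ => resolvent α b H) =
      fun H => ((regGram α b H).det)⁻¹ • (regGram α b H).adjugate := by
    ext1 H
    rw [resolvent, Matrix.inv_def, Ring.inverse_eq_inv']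
  rw [this]
  exact (hG.matrix_det.inv₀ fun H => (isUnit_det_regGram hα b H).ne_zero).smul hG.matrix_adjugate

lemma continuous_trRes {ι κ : Type*} [Fintype ι] [Fintype κ] [DecidableEq ι] [DecidableEq κ]
    {α : ℝ} (hα : 0 < α) (b : ℝ) : Continuous (fun H : Matrix κ ι ℂ => trRes α b H) :=
  Complex.continuous_re.comp (continuous_resolvent hα b).matrix_trace

lemma continuous_trResSq {ι κ : Type*} [Fintype ι] [Fintype κ] [DecidableEq ι] [DecidableEq κ]
    {α : ℝ} (hα : 0 < α) (b : ℝ) : Continuous (fun H : Matrix κ ι ℂ => trResSq α b H) :=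
  Complex.continuous_re.comp
    ((continuous_resolvent hα b).matrix_mul (continuous_resolvent hα b)).matrix_trace

-- Laws, independence and quadratic forms in the Gaussian model

section Model

variable {Ω : Type*} [MeasurableSpace Ω] {P : Measure Ω} [IsProbabilityMeasure P] {K L N : ℕ}
  {x : Fin K → Fin N → Ω → ℂ} {y : Fin L → Fin N → Ω → ℂ}

namespace IsIIDGaussianPair

variable (hiid : IsIIDGaussianPair P x y)
include hiid

omit [IsProbabilityMeasure P] in
lemma aemeasurable_elim (s : (Fin K × Fin N) ⊕ (Fin L × Fin N)) :
    AEMeasurable (Sum.elim (fun p : Fin K × Fin N => x p.1 p.2)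
      (fun p : Fin L × Fin N => y p.1 p.2) s) P := by
  rcases s with p | p
  · exact (hiid.law_left p.1 p.2).aemeasurable
  · exact (hiid.law_right p.1 p.2).aemeasurable

omit [IsProbabilityMeasure P] in
lemma aemeasurable_left : AEMeasurable (fun ω i j => x i j ω) P :=
  aemeasurable_pi_lambda _ fun i => aemeasurable_pi_lambda _ fun j =>
    (hiid.law_left i j).aemeasurable

omit [IsProbabilityMeasure P] in
lemma hasLaw_row (k : Fin K) : HasLaw (fun ω j => x k j ω) (gaussianVector (Fin N)) P := by
  have h := hiid.indep.precomp (g := fun j : Fin N => Sum.inl (k, j))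
    (fun i j hij => by simpa using hij)
  exact iIndepFun.hasLaw_pi (μ := fun _ => stdComplexGaussian) (X := fun j => x k j)
    (fun j => hiid.law_left k j) h

omit [IsProbabilityMeasure P] in
lemma hasLaw_right :
    HasLaw (fun ω (p : Fin L × Fin N) => y p.1 p.2 ω)
      (Measure.pi fun _ : Fin L × Fin N => stdComplexGaussian) P := by
  have h := hiid.indep.precomp (g := fun p : Fin L × Fin N => Sum.inr p)
    (fun i j hij => by simpa using hij)
  exact iIndepFun.hasLaw_pi (μ := fun _ => stdComplexGaussian)
    (X := fun p : Fin L × Fin N => y p.1 p.2) (fun p => hiid.law_right p.1 p.2) h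

omit [IsProbabilityMeasure P] in
-- The two arrays are functions of disjoint blocks of the independent family: the entries of row k,
-- and all the others.
lemma indepFun_row_update (k : Fin K) :
    IndepFun (fun ω j => x k j ω) (fun ω => Function.update (fun i j => x i j ω) k 0) P := by
  classical
  set S : Finset ((Fin K × Fin N) ⊕ (Fin L × Fin N)) :=
    Finset.univ.filter fun s => ∃ j, s = Sum.inl (k, j) with hS
  have hST : Disjoint S Sᶜ := disjoint_compl_right
  have h := hiid.indep.indepFun_finset₀ S Sᶜ hST hiid.aemeasurable_elim
  have hmS : ∀ j, Sum.inl (k, j) ∈ S := fun j => by simp [hS]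
  have hmT : ∀ i j, i ≠ k → Sum.inl (i, j) ∈ Sᶜ := fun i j hij => by
    simp only [hS, Finset.mem_compl, Finset.mem_filter, Finset.mem_univ, true_and, not_exists]
    intro j' h'
    exact hij (by simpa using (congrArg Prod.fst (Sum.inl.inj h')))
  have h2 := h.comp
    (φ := fun (v : S → ℂ) (j : Fin N) => v ⟨Sum.inl (k, j), hmS j⟩)
    (ψ := fun (v : (Sᶜ : Finset _) → ℂ) (i : Fin K) (j : Fin N) =>
      if hi : i = k then 0 else v ⟨Sum.inl (i, j), hmT i j hi⟩)
    (by fun_prop)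
    (by
      refine measurable_pi_lambda _ fun i => measurable_pi_lambda _ fun j => ?_
      by_cases hi : i = k
      · simp [hi]
      · simp only [hi, dite_false]; fun_prop)
  have hψ : (fun ω => Function.update (fun i j => x i j ω) k 0) =
      (fun (v : (Sᶜ : Finset _) → ℂ) (i : Fin K) (j : Fin N) =>
        if hi : i = k then 0 else v ⟨Sum.inl (i, j), hmT i j hi⟩) ∘
        fun ω (s : (Sᶜ : Finset _)) => Sum.elim (fun p : Fin K × Fin N => x p.1 p.2)
          (fun p : Fin L × Fin N => y p.1 p.2) s ω := by
    ext ω i j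
    by_cases hi : i = k
    · subst hi; simp
    · simp [hi]
  rw [hψ]
  exact h2

omit [IsProbabilityMeasure P] in
lemma indepFun_left_right :
    IndepFun (fun ω i j => x i j ω) (fun ω i j => y i j ω) P := by
  classical
  set S : Finset ((Fin K × Fin N) ⊕ (Fin L × Fin N)) :=
    Finset.univ.filter fun s => ∃ p, s = Sum.inl p with hS
  have hST : Disjoint S Sᶜ := disjoint_compl_right
  have h := hiid.indep.indepFun_finset₀ S Sᶜ hST hiid.aemeasurable_elim
  have hmS : ∀ p, Sum.inl p ∈ S := fun p => by simp [hS, -Prod.exists]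
  have hmT : ∀ p, Sum.inr p ∈ Sᶜ := fun p => by simp [hS]
  exact h.comp
    (φ := fun (v : S → ℂ) (i : Fin K) (j : Fin N) => v ⟨Sum.inl (i, j), hmS _⟩)
    (ψ := fun (v : (Sᶜ : Finset _) → ℂ) (i : Fin L) (j : Fin N) => v ⟨Sum.inr (i, j), hmT _⟩)
    (by fun_prop) (by fun_prop)

/-- Concentration of the quadratic form of one row in a matrix depending on the other rows. -/
lemma lintegral_row_quadForm_le (k : Fin K)
    {A : (Fin K → Fin N → ℂ) → Matrix (Fin N) (Fin N) ℂ} (hAc : Continuous A)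
    (hAh : ∀ z, (A z).IsHermitian) {B : ℝ} (hB : ∀ z, ∑ i, ∑ j, ‖A z i j‖ ^ 2 ≤ B) :
    ∫⁻ ω, ENNReal.ofReal ((((fun j => x k j ω) ⬝ᵥ
        A (Function.update (fun i j => x i j ω) k 0) *ᵥ star (fun j => x k j ω)).re -
        (A (Function.update (fun i j => x i j ω) k 0)).trace.re) ^ 4) ∂P ≤
      ENNReal.ofReal (3 * quadConst ^ 2 * B ^ 2) := by
  have hZ : AEMeasurable (fun ω => Function.update (fun i j => x i j ω) k 0) P := by
    refine aemeasurable_pi_lambda _ fun i => ?_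
    by_cases hi : i = k
    · subst hi; simp
    · simpa [hi] using aemeasurable_pi_lambda _ fun j => (hiid.law_left i j).aemeasurable
  have hlaw := hiid.hasLaw_row k
  have hprod := (indepFun_iff_map_prod_eq_prod_map_map hlaw.aemeasurable hZ).1
    (hiid.indepFun_row_update k)
  rw [hlaw.map_eq] at hprod
  have hpr : IsProbabilityMeasure (P.map fun ω => Function.update (fun i j => x i j ω) k 0) :=
    Measure.isProbabilityMeasure_map hZ
  set g : (Fin N → ℂ) × (Fin K → Fin N → ℂ) → ENNReal := fun q =>
    ENNReal.ofReal (((q.1 ⬝ᵥ A q.2 *ᵥ star q.1).re - (A q.2).trace.re) ^ 4) with hg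
  have hgm : Measurable g := by
    have c2 : Continuous fun q : (Fin N → ℂ) × (Fin K → Fin N → ℂ) => A q.2 :=
      hAc.comp continuous_snd
    have c1 : Continuous fun q : (Fin N → ℂ) × (Fin K → Fin N → ℂ) =>
        (q.1 ⬝ᵥ A q.2 *ᵥ star q.1).re :=
      Complex.continuous_re.comp (continuous_fst.dotProduct
        (c2.matrix_mulVec (continuous_star.comp continuous_fst)))
    exact ((c1.sub (Complex.continuous_re.comp c2.matrix_trace)).pow 4).measurable.ennreal_ofReal
  calc _ = ∫⁻ q, g q ∂(P.map fun ω => ((fun j => x k j ω),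
        Function.update (fun i j => x i j ω) k 0)) := by
        rw [lintegral_map' hgm.aemeasurable (hlaw.aemeasurable.prodMk hZ)]
    _ = ∫⁻ z, ∫⁻ a, g (a, z) ∂(gaussianVector (Fin N))
        ∂(P.map fun ω => Function.update (fun i j => x i j ω) k 0) := by
        rw [hprod, lintegral_prod_symm' _ hgm]
    _ ≤ ∫⁻ _z, ENNReal.ofReal (3 * quadConst ^ 2 * B ^ 2)
        ∂(P.map fun ω => Function.update (fun i j => x i j ω) k 0) := by
        refine lintegral_mono fun z => ?_
        -- With the other rows frozen, the matrix is constant. Its transpose appears because the row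
        -- a enters as a A a* rather than a* A a.
        have h := lintegral_quadForm_pow_four_le (A := (A z)ᵀ) (hAh z).transpose
        have e : ∀ a : Fin N → ℂ, star a ⬝ᵥ (A z)ᵀ *ᵥ a = a ⬝ᵥ A z *ᵥ star a := fun a => by
          rw [Matrix.dotProduct_mulVec a, ← Matrix.mulVec_transpose, dotProduct_comm]
        simp_rw [e, Matrix.trace_transpose] at h
        refine h.trans (ENNReal.ofReal_le_ofReal ?_)
        have e2 : ∑ i, ∑ j, ‖(A z)ᵀ i j‖ ^ 2 = ∑ i, ∑ j, ‖A z i j‖ ^ 2 := by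
          rw [Finset.sum_comm]; rfl
        have h0 : 0 ≤ ∑ i, ∑ j, ‖A z i j‖ ^ 2 := by positivity
        rw [e2]
        gcongr
        exact hB z
    _ = _ := by simp

omit [IsProbabilityMeasure P] in
lemma integral_right_mul_conj (l : Fin L) (i j : Fin N) :
    Integrable (fun ω => y l i ω * star (y l j ω)) P ∧
      ∫ ω, y l i ω * star (y l j ω) ∂P = if i = j then 1 else 0 := by
  have hmem : ∀ i, MemLp (y l i) 2 P := fun i => by
    have h := memLp_id_stdComplexGaussian 2
    rw [← (hiid.law_right l i).map_eq] at h
    exact (memLp_map_measure_iff aestronglyMeasurable_id (hiid.law_right l i).aemeasurable).1 h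
  have hint : Integrable (fun ω => y l i ω * star (y l j ω)) P :=
    (hmem i).integrable_mul (hmem j).star
  refine ⟨hint, ?_⟩
  split_ifs with hij
  · subst hij
    have h1 : ∀ ω, y l i ω * star (y l i ω) = ((‖y l i ω‖ ^ 2 : ℝ) : ℂ) := fun ω => by
      rw [← Complex.normSq_eq_norm_sq, ← Complex.mul_conj]; rfl
    simp_rw [h1]
    rw [integral_complex_ofReal]
    have := (hiid.law_right l i).integral_comp (f := fun z : ℂ => ‖z‖ ^ 2) (by fun_prop)
    rw [integral_normSq_stdComplexGaussian] at this
    exact_mod_cast congrArg (fun r : ℝ => (r : ℂ)) this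
  · have hI : IndepFun (y l i) (y l j) P :=
      hiid.indep.indepFun (i := Sum.inr (l, i)) (j := Sum.inr (l, j)) (by simpa using hij)
    have hI2 : IndepFun (y l i) (fun ω => star (y l j ω)) P :=
      hI.comp (φ := id) (ψ := fun z : ℂ => star z) measurable_id continuous_star.measurable
    rw [hI2.integral_fun_mul_eq_mul_integral (hmem i).1 (hmem j).star.1]
    have h0 := (hiid.law_right l i).integral_eq
    rw [integral_id_stdComplexGaussian] at h0
    rw [h0, zero_mul]

/-- The mean of a quadratic form of a row of `y` in an independent bounded matrix. -/
lemma integral_right_quadForm (l : Fin L)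
    {B : (Fin K → Fin N → ℂ) → Matrix (Fin N) (Fin N) ℂ} (hBc : Continuous B) {C : ℝ}
    (hC : ∀ z i j, ‖B z i j‖ ≤ C) :
    Integrable (fun ω => ((fun j => y l j ω) ⬝ᵥ
      B (fun i j => x i j ω) *ᵥ star (fun j => y l j ω)).re) P ∧
    ∫ ω, ((fun j => y l j ω) ⬝ᵥ B (fun i j => x i j ω) *ᵥ star (fun j => y l j ω)).re ∂P =
      ∫ ω, (B (fun i j => x i j ω)).trace.re ∂P := by
  have hBm : ∀ i j, AEMeasurable (fun ω => B (fun i j => x i j ω) i j) P := fun i j =>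
    ((hBc.matrix_elem i j).measurable).comp_aemeasurable hiid.aemeasurable_left
  have hBi : ∀ i j, Integrable (fun ω => B (fun i j => x i j ω) i j) P := fun i j =>
    Integrable.of_bound (hBm i j).aestronglyMeasurable C (ae_of_all _ fun ω => hC _ i j)
  have hI : ∀ i j, IndepFun (fun ω => B (fun i j => x i j ω) i j)
      (fun ω => y l i ω * star (y l j ω)) P := fun i j =>
    hiid.indepFun_left_right.comp (φ := fun z => B z i j)
      (ψ := fun v : Fin L → Fin N → ℂ => v l i * star (v l j)) (hBc.matrix_elem i j).measurable
      (Continuous.measurable (by fun_prop))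
  have hi : ∀ i j, Integrable
      (fun ω => B (fun i j => x i j ω) i j * (y l i ω * star (y l j ω))) P := fun i j =>
    (hI i j).integrable_mul (hBi i j) (hiid.integral_right_mul_conj l i j).1
  have e : ∀ ω, (fun j => y l j ω) ⬝ᵥ B (fun i j => x i j ω) *ᵥ star (fun j => y l j ω) =
      ∑ i, ∑ j, B (fun i j => x i j ω) i j * (y l i ω * star (y l j ω)) := fun ω => by
    simp only [dotProduct, Matrix.mulVec, Finset.mul_sum, Pi.star_apply]
    exact Finset.sum_congr rfl fun i _ => Finset.sum_congr rfl fun j _ => by ring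
  have hint : Integrable (fun ω => ∑ i, ∑ j, B (fun i j => x i j ω) i j *
      (y l i ω * star (y l j ω))) P :=
    integrable_finsetSum _ fun i _ => integrable_finsetSum _ fun j _ => hi i j
  have hre : ∀ {g : Ω → ℂ}, Integrable g P → ∫ ω, (g ω).re ∂P = (∫ ω, g ω ∂P).re :=
    fun {g} hg => integral_re (𝕜 := ℂ) hg
  simp_rw [e]
  refine ⟨hint.re, ?_⟩
  rw [hre hint, hre (g := fun ω => (B (fun i j => x i j ω)).trace)
    (integrable_finsetSum _ fun i _ => hBi i i),
    integral_finsetSum _ fun i _ => integrable_finsetSum _ fun j _ => hi i j]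
  congr 1
  rw [show (∫ ω, (B (fun i j => x i j ω)).trace ∂P) = ∑ i, ∫ ω, B (fun i j => x i j ω) i i ∂P from
    integral_finsetSum _ fun i _ => hBi i i]
  refine Finset.sum_congr rfl fun i _ => ?_
  rw [integral_finsetSum _ fun j _ => hi i j, Finset.sum_eq_single i]
  · rw [(hI i i).integral_fun_mul_eq_mul_integral (hBi i i).1
      (hiid.integral_right_mul_conj l i i).1.1, (hiid.integral_right_mul_conj l i i).2]
    simp
  · intro j _ hj
    rw [(hI i j).integral_fun_mul_eq_mul_integral (hBi i j).1
      (hiid.integral_right_mul_conj l i j).1.1, (hiid.integral_right_mul_conj l i j).2,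
      if_neg (Ne.symm hj), mul_zero]
  · simp

end IsIIDGaussianPair

end Model

/-! ### The channel model at a fixed dimension -/

section FixedDimension

variable {Ω : Type*} [MeasurableSpace Ω] {P : Measure Ω} {K L N : ℕ}

omit [MeasurableSpace Ω] in
lemma channel_apply {M : ℕ} (r : Fin M → ℝ) (x : Fin M → Fin N → Ω → ℂ) (ω : Ω) (i : Fin M) :
    channel r x ω i = ((√(r i) * (1 / √(N : ℝ)) : ℝ) : ℂ) • fun j => x i j ω := by
  ext j
  rw [channel, Matrix.diagonal_mul]
  simp [mul_assoc]

lemma sq_sqrt_mul_inv_sqrt {r : ℝ} (hr : 0 ≤ r) : (√r * (1 / √(N : ℝ))) ^ 2 = r / N := by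
  rw [mul_pow, div_pow, Real.sq_sqrt hr, Real.sq_sqrt (Nat.cast_nonneg N)]
  ring

/-- The matrix `√(r / N) X`. -/
noncomputable def scaledMatrix (r : ℝ) (X : Fin K → Fin N → ℂ) : Matrix (Fin K) (Fin N) ℂ :=
  ((√r * (1 / √(N : ℝ)) : ℝ) : ℂ) • Matrix.of X

lemma continuous_scaledMatrix (r : ℝ) :
    Continuous (scaledMatrix r : (Fin K → Fin N → ℂ) → Matrix (Fin K) (Fin N) ℂ) := by
  have : Continuous (fun X : Fin K → Fin N → ℂ => Matrix.of X) := continuous_id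
  exact Continuous.const_smul this ((√r * (1 / √(N : ℝ)) : ℝ) : ℂ)

omit [MeasurableSpace Ω] in
lemma channel_eq_scaledMatrix (r : ℝ) (x : Fin K → Fin N → Ω → ℂ) (ω : Ω) :
    channel (fun _ => r) x ω = scaledMatrix r (fun i j => x i j ω) := by
  ext i j
  rw [channel_apply]
  rfl

lemma updateRow_scaledMatrix (r : ℝ) (X : Fin K → Fin N → ℂ) (k : Fin K) :
    (scaledMatrix r X).updateRow k 0 = scaledMatrix r (Function.update X k 0) := by
  ext i j
  by_cases hi : i = k
  · subst hi; simp [scaledMatrix]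
  · simp [scaledMatrix, hi]

/-- Extracts r/N, leaving a form in an unscaled Gaussian row with a matrix that depends on the other
rows only, as `lintegral_row_quadForm_le` requires. -/
lemma looQuad_scaledMatrix {α : ℝ} (b : ℝ) {r : ℝ} (hr : 0 ≤ r)
    (X : Fin K → Fin N → ℂ) (k : Fin K) :
    looQuad α b (scaledMatrix r X) k =
      r / N * (X k ⬝ᵥ resolvent α b (scaledMatrix r (Function.update X k 0)) *ᵥ star (X k)).re := by
  have h1 : scaledMatrix r X k = ((√r * (1 / √(N : ℝ)) : ℝ) : ℂ) • X k := rfl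
  have hst : ∀ c : ℝ, star (c : ℂ) = c := fun c => Complex.conj_ofReal c
  rw [looQuad, resQuad, updateRow_scaledMatrix, star_star, h1, star_smul, hst, Matrix.mulVec_smul,
    dotProduct_smul, smul_dotProduct, smul_smul, ← Complex.ofReal_mul, ← sq,
    sq_sqrt_mul_inv_sqrt hr, smul_eq_mul, Complex.re_ofReal_mul]

lemma looQuadSq_scaledMatrix {α : ℝ} (b : ℝ) {r : ℝ} (hr : 0 ≤ r)
    (X : Fin K → Fin N → ℂ) (k : Fin K) :
    looQuadSq α b (scaledMatrix r X) k =
      r / N * (X k ⬝ᵥ (resolvent α b (scaledMatrix r (Function.update X k 0)) *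
        resolvent α b (scaledMatrix r (Function.update X k 0))) *ᵥ star (X k)).re := by
  have h1 : scaledMatrix r X k = ((√r * (1 / √(N : ℝ)) : ℝ) : ℂ) • X k := rfl
  have hst : ∀ c : ℝ, star (c : ℂ) = c := fun c => Complex.conj_ofReal c
  have h2 := star_dotProduct_resolvent_sq (α := α) b (scaledMatrix r (Function.update X k 0))
    (star (X k))
  rw [star_star] at h2
  rw [h2, Complex.ofReal_re, looQuadSq, updateRow_scaledMatrix, h1, star_smul, hst,
    Matrix.mulVec_smul, nsq_smul_real, sq_sqrt_mul_inv_sqrt hr]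

lemma continuous_update_zero (k : Fin K) :
    Continuous fun X : Fin K → Fin N → ℂ => Function.update X k 0 :=
  continuous_id.update k continuous_const

lemma continuous_looQuad_scaledMatrix {α : ℝ} (hα : 0 < α) (b : ℝ) {r : ℝ} (hr : 0 ≤ r)
    (k : Fin K) : Continuous fun X : Fin K → Fin N → ℂ => looQuad α b (scaledMatrix r X) k := by
  simp_rw [looQuad_scaledMatrix b hr]
  have h1 := (continuous_resolvent hα b).comp
    ((continuous_scaledMatrix r).comp (continuous_update_zero (N := N) k))
  exact continuous_const.mul (Complex.continuous_re.comp ((continuous_apply k).dotProduct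
    (h1.matrix_mulVec (continuous_star.comp (continuous_apply k)))))

lemma continuous_looQuadSq_scaledMatrix {α : ℝ} (hα : 0 < α) (b : ℝ) {r : ℝ} (hr : 0 ≤ r)
    (k : Fin K) : Continuous fun X : Fin K → Fin N → ℂ => looQuadSq α b (scaledMatrix r X) k := by
  simp_rw [looQuadSq_scaledMatrix b hr]
  have h1 := (continuous_resolvent hα b).comp
    ((continuous_scaledMatrix r).comp (continuous_update_zero (N := N) k))
  exact continuous_const.mul (Complex.continuous_re.comp ((continuous_apply k).dotProduct
    ((h1.matrix_mul h1).matrix_mulVec (continuous_star.comp (continuous_apply k)))))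

/-- Deviation of a leave-one-out quadratic form from its conditional mean. -/
noncomputable def quadDev (α b r : ℝ) (X : Fin K → Fin N → ℂ) (k : Fin K) : ℝ :=
  looQuad α b (scaledMatrix r X) k - r / N * trRes α b ((scaledMatrix r X).updateRow k 0)

/-- Deviation of a squared leave-one-out quadratic form from its conditional mean. -/
noncomputable def quadDevSq (α b r : ℝ) (X : Fin K → Fin N → ℂ) (k : Fin K) : ℝ :=
  looQuadSq α b (scaledMatrix r X) k - r / N * trResSq α b ((scaledMatrix r X).updateRow k 0)

lemma continuous_quadDev {α : ℝ} (hα : 0 < α) (b : ℝ) {r : ℝ} (hr : 0 ≤ r) (k : Fin K) :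
    Continuous fun X : Fin K → Fin N → ℂ => quadDev α b r X k := by
  unfold quadDev
  simp_rw [updateRow_scaledMatrix]
  exact (continuous_looQuad_scaledMatrix hα b hr k).sub (continuous_const.mul
    ((continuous_trRes hα b).comp ((continuous_scaledMatrix r).comp (continuous_update_zero k))))

lemma continuous_quadDevSq {α : ℝ} (hα : 0 < α) (b : ℝ) {r : ℝ} (hr : 0 ≤ r) (k : Fin K) :
    Continuous fun X : Fin K → Fin N → ℂ => quadDevSq α b r X k := by
  unfold quadDevSq
  simp_rw [updateRow_scaledMatrix]
  exact (continuous_looQuadSq_scaledMatrix hα b hr k).sub (continuous_const.mul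
    ((continuous_trResSq hα b).comp ((continuous_scaledMatrix r).comp (continuous_update_zero k))))

namespace IsIIDGaussianPair

variable [IsProbabilityMeasure P] {x : Fin K → Fin N → Ω → ℂ} {y : Fin L → Fin N → Ω → ℂ}
  (hiid : IsIIDGaussianPair P x y) {α : ℝ} (hα : 0 < α) (b : ℝ) {r : ℝ} (hr : 0 ≤ r)
include hiid hα hr

/-- The unnormalized form has fourth central moment O(N²), from Frobenius norm squared at most N/α²;
the factor (r/N)⁴ leaves the summable order N⁻². -/
lemma lintegral_quadDev_le (hN : 0 < N) (k : Fin K) :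
    ∫⁻ ω, ENNReal.ofReal (quadDev α b r (fun i j => x i j ω) k ^ 4) ∂P ≤
      ENNReal.ofReal (3 * quadConst ^ 2 * (r ^ 4 * (1 / α) ^ 4) / N ^ 2) := by
  have h := hiid.lintegral_row_quadForm_le k (A := fun z => resolvent α b (scaledMatrix r z))
    ((continuous_resolvent hα b).comp (continuous_scaledMatrix r))
    (fun z => resolvent_isHermitian b _) (fun z => sum_norm_sq_resolvent_le hα b _)
  have hN' : (0 : ℝ) < N := by exact_mod_cast hN
  have e : ∀ ω, ENNReal.ofReal (quadDev α b r (fun i j => x i j ω) k ^ 4) =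
      ENNReal.ofReal ((r / N) ^ 4) * ENNReal.ofReal ((((fun j => x k j ω) ⬝ᵥ
        resolvent α b (scaledMatrix r (Function.update (fun i j => x i j ω) k 0)) *ᵥ
          star (fun j => x k j ω)).re -
        (resolvent α b (scaledMatrix r (Function.update (fun i j => x i j ω) k 0))).trace.re) ^ 4) :=
    fun ω => by
      rw [← ENNReal.ofReal_mul (by positivity), ← mul_pow, quadDev, looQuad_scaledMatrix b hr,
        updateRow_scaledMatrix, trRes, mul_sub]
  simp_rw [e]
  rw [lintegral_const_mul' _ _ ENNReal.ofReal_ne_top]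
  refine (mul_le_mul_right h _).trans (le_of_eq ?_)
  rw [← ENNReal.ofReal_mul (by positivity), Fintype.card_fin]
  congr 1
  field_simp

lemma lintegral_quadDevSq_le (hN : 0 < N) (k : Fin K) :
    ∫⁻ ω, ENNReal.ofReal (quadDevSq α b r (fun i j => x i j ω) k ^ 4) ∂P ≤
      ENNReal.ofReal (3 * quadConst ^ 2 * (r ^ 4 * (1 / α) ^ 8) / N ^ 2) := by
  have h := hiid.lintegral_row_quadForm_le k
    (A := fun z => resolvent α b (scaledMatrix r z) * resolvent α b (scaledMatrix r z))
    (((continuous_resolvent hα b).comp (continuous_scaledMatrix r)).matrix_mul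
      ((continuous_resolvent hα b).comp (continuous_scaledMatrix r)))
    (fun z => by
      have := resolvent_isHermitian (α := α) b (scaledMatrix r z)
      rw [Matrix.IsHermitian, Matrix.conjTranspose_mul, this.eq])
    (fun z => sum_norm_sq_resolvent_sq_le hα b _)
  have hN' : (0 : ℝ) < N := by exact_mod_cast hN
  have e : ∀ ω, ENNReal.ofReal (quadDevSq α b r (fun i j => x i j ω) k ^ 4) =
      ENNReal.ofReal ((r / N) ^ 4) * ENNReal.ofReal ((((fun j => x k j ω) ⬝ᵥ
        (resolvent α b (scaledMatrix r (Function.update (fun i j => x i j ω) k 0)) *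
          resolvent α b (scaledMatrix r (Function.update (fun i j => x i j ω) k 0))) *ᵥ
          star (fun j => x k j ω)).re -
        (resolvent α b (scaledMatrix r (Function.update (fun i j => x i j ω) k 0)) *
          resolvent α b (scaledMatrix r (Function.update (fun i j => x i j ω) k 0))).trace.re) ^ 4) :=
    fun ω => by
      rw [← ENNReal.ofReal_mul (by positivity), ← mul_pow, quadDevSq, looQuadSq_scaledMatrix b hr,
        updateRow_scaledMatrix, trResSq, mul_sub]
  simp_rw [e]
  rw [lintegral_const_mul' _ _ ENNReal.ofReal_ne_top]
  refine (mul_le_mul_right h _).trans (le_of_eq ?_)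
  rw [← ENNReal.ofReal_mul (by positivity), Fintype.card_fin]
  congr 1
  field_simp

end IsIIDGaussianPair

/-! ### The power normalization -/

/-- The mean normalized transmit power of the precoder `b (b² Hᴴ H + α)⁻¹ Hᴴ`. -/
noncomputable def meanPower (P : Measure Ω) (α b r : ℝ) (x : Fin K → Fin N → Ω → ℂ) : ℝ :=
  ∫ ω, (1 / (N : ℝ)) * (trRes α b (scaledMatrix r fun i j => x i j ω) -
    α * trResSq α b (scaledMatrix r fun i j => x i j ω)) ∂P

lemma meanPower_nonneg {α : ℝ} (hα : 0 < α) (b r : ℝ) (x : Fin K → Fin N → Ω → ℂ) :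
    0 ≤ meanPower P α b r x :=
  integral_nonneg fun ω => mul_nonneg (by positivity)
    (sub_nonneg.2 (mul_trResSq_le hα b _))

/-- The initial value a, divided by the initial value 1 of the maximum, is the total power
constraint. Allowing a = 0 avoids having to know that the mean power is nonzero. -/
lemma fold_min_mul_eq_div {ι : Type*} [DecidableEq ι] (s : Finset ι) {a : ℝ} (ha : 0 ≤ a)
    {t u : ι → ℝ} (ht : ∀ i, 0 < t i) (hu : ∀ i, 0 < u i) :
    s.fold min a (fun i => a * (t i / u i)) = a / s.fold max 1 (fun i => u i / t i) ∧
      1 ≤ s.fold max 1 (fun i => u i / t i) := by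
  induction s using Finset.induction_on with
  | empty => simp
  | insert i s his ih =>
    rw [Finset.fold_insert his, Finset.fold_insert his, ih.1]
    refine ⟨?_, le_max_of_le_right ih.2⟩
    have e : a * (t i / u i) = a / (u i / t i) := by
      rw [div_div_eq_mul_div, mul_div_assoc]
    have h1 : 0 < u i / t i := div_pos (hu i) (ht i)
    have h2 : 0 < s.fold max 1 (fun i => u i / t i) := zero_lt_one.trans_le ih.2
    rw [e]
    rcases le_total (u i / t i) (s.fold max 1 fun i => u i / t i) with h | h
    · rw [max_eq_right h, min_eq_right (by gcongr)]
    · rw [max_eq_left h, min_eq_left (by gcongr)]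

/-- A crude bound growing with N; it only serves integrability at a fixed dimension. -/
lemma norm_precoderGram_apply_le {α : ℝ} (hα : 0 < α) (b : ℝ) (H : Matrix (Fin K) (Fin N) ℂ)
    (i j : Fin N) :
    ‖(resolvent α b H - (α : ℂ) • (resolvent α b H * resolvent α b H)) i j‖ ≤
      √(N * (1 / α) ^ 2) + α * √(N * (1 / α) ^ 4) := by
  have key : ∀ (A : Matrix (Fin N) (Fin N) ℂ) (B : ℝ), ∑ i, ∑ j, ‖A i j‖ ^ 2 ≤ B →
      ‖A i j‖ ≤ √B := fun A B h => by
    refine Real.le_sqrt_of_sq_le (le_trans ?_ h)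
    calc ‖A i j‖ ^ 2 ≤ ∑ j, ‖A i j‖ ^ 2 :=
          Finset.single_le_sum (f := fun j => ‖A i j‖ ^ 2) (fun _ _ => by positivity)
            (Finset.mem_univ j)
      _ ≤ _ := Finset.single_le_sum (f := fun i => ∑ j, ‖A i j‖ ^ 2)
            (fun _ _ => by positivity) (Finset.mem_univ i)
  have h1 := key _ _ (sum_norm_sq_resolvent_le hα b H)
  have h2 := key _ _ (sum_norm_sq_resolvent_sq_le hα b H)
  rw [Fintype.card_fin] at h1 h2
  rw [Matrix.sub_apply, Matrix.smul_apply, smul_eq_mul]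
  refine (norm_sub_le _ _).trans ?_
  rw [norm_mul, Complex.norm_real, Real.norm_of_nonneg hα.le]
  gcongr

omit [MeasurableSpace Ω] in
lemma mul_mul_conjTranspose_channel_apply {r₂ : Fin L → ℝ} (hr₂ : ∀ l, 0 ≤ r₂ l)
    (y : Fin L → Fin N → Ω → ℂ) (ω : Ω) (B : Matrix (Fin N) (Fin N) ℂ) (l : Fin L) :
    ((channel r₂ y ω * B * (channel r₂ y ω)ᴴ) l l).re =
      r₂ l / N * ((fun j => y l j ω) ⬝ᵥ B *ᵥ star (fun j => y l j ω)).re := by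
  have hst : ∀ c : ℝ, star (c : ℂ) = c := fun c => Complex.conj_ofReal c
  have e : (channel r₂ y ω * B * (channel r₂ y ω)ᴴ) l l =
      channel r₂ y ω l ⬝ᵥ B *ᵥ star (channel r₂ y ω l) := by
    rw [Matrix.mul_assoc, Matrix.mul_apply]
    rfl
  rw [e, channel_apply, star_smul, hst, Matrix.mulVec_smul, dotProduct_smul, smul_dotProduct,
    smul_smul, ← Complex.ofReal_mul, ← sq, sq_sqrt_mul_inv_sqrt (hr₂ l), smul_eq_mul,
    Complex.re_ofReal_mul]

namespace IsIIDGaussianPair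

variable [IsProbabilityMeasure P] {x : Fin K → Fin N → Ω → ℂ} {y : Fin L → Fin N → Ω → ℂ}
  (hiid : IsIIDGaussianPair P x y)
include hiid

omit [IsProbabilityMeasure P] in
/-- If there are as many primary users as transmit antennas, the precoder almost surely does not
depend on the primary channel. -/
lemma ae_rawPrecoder_eq (hL : L = N) (α β : ℝ) {r₂ : Fin L → ℝ} (hr₂ : ∀ l, 0 < r₂ l)
    (H : Ω → Matrix (Fin K) (Fin N) ℂ) :
    ∀ᵐ ω ∂P, rawPrecoder α β (H ω) (channel r₂ y ω) = precoder α (1 - β) (H ω) := by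
  subst hL
  -- The determinant of a matrix of indeterminates is a nonzero polynomial, hence almost surely
  -- nonzero at the Gaussian entries.
  have h := ae_eval_mvPolynomial_ne_zero (ν := stdComplexGaussian) _
    (Matrix.det_mvPolynomialX_ne_zero (Fin L) ℂ)
  rw [← hiid.hasLaw_right.map_eq] at h
  filter_upwards [ae_of_ae_map hiid.hasLaw_right.aemeasurable h] with ω hω
  refine rawPrecoder_eq α β (H ω) _ ?_
  rw [Matrix.eval_det_mvPolynomialX] at hω
  rw [channel, Matrix.det_mul, Matrix.det_diagonal, isUnit_iff_ne_zero]
  refine mul_ne_zero (Finset.prod_ne_zero_iff.2 fun l _ => ?_) ?_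
  · exact Complex.ofReal_ne_zero.2 (Real.sqrt_pos.2 (hr₂ l)).ne'
  · have e : (Matrix.of fun i j => ((1 / √(L : ℝ) : ℝ) : ℂ) * y i j ω) =
        ((1 / √(L : ℝ) : ℝ) : ℂ) • Matrix.of fun i j => y i j ω := by
      ext i j; simp
    rw [e, Matrix.det_smul]
    rcases Nat.eq_zero_or_pos L with h0 | h0
    · subst h0; simp
    · refine mul_ne_zero (pow_ne_zero _ (Complex.ofReal_ne_zero.2 ?_)) ?_
      · have : (0 : ℝ) < L := by exact_mod_cast h0
        positivity
      · exact hω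

variable {α : ℝ} (hα : 0 < α)
include hα

/-- The precoder depends on x only, and the rows of y are independent of it with identity
covariance, so averaging over y turns the quadratic form into a trace. The factor 1/N of the channel
matches that of the transmit power. -/
lemma integral_interference (b r : ℝ) {r₂ : Fin L → ℝ} (hr₂ : ∀ l, 0 < r₂ l) (l : Fin L) :
    Integrable (fun ω => interference (channel r₂ y ω)
      (precoder α b (channel (fun _ => r) x ω)) l) P ∧
    ∫ ω, interference (channel r₂ y ω) (precoder α b (channel (fun _ => r) x ω)) l ∂P =
      r₂ l * meanPower P α b r x := by
  have h := hiid.integral_right_quadForm l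
    (B := fun z => resolvent α b (scaledMatrix r z) -
      (α : ℂ) • (resolvent α b (scaledMatrix r z) * resolvent α b (scaledMatrix r z)))
    (by
      have h1 := (continuous_resolvent hα b).comp (continuous_scaledMatrix (K := K) (N := N) r)
      have h2 : Continuous fun z : Fin K → Fin N → ℂ =>
          resolvent α b (scaledMatrix r z) * resolvent α b (scaledMatrix r z) := h1.matrix_mul h1
      have h3 : Continuous fun z : Fin K → Fin N → ℂ => (α : ℂ) •
          (resolvent α b (scaledMatrix r z) * resolvent α b (scaledMatrix r z)) :=
        Continuous.const_smul h2 (α : ℂ)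
      exact h1.sub h3)
    (fun z i j => norm_precoderGram_apply_le hα b _ i j)
  simp_rw [interference, precoder_mul_conjTranspose hα,
    mul_mul_conjTranspose_channel_apply (fun l => (hr₂ l).le), channel_eq_scaledMatrix]
  refine ⟨h.1.const_mul _, ?_⟩
  rw [integral_const_mul, h.2, meanPower, integral_const_mul]
  simp_rw [Matrix.trace_sub, Matrix.trace_smul, trRes, trResSq, smul_eq_mul, Complex.sub_re,
    Complex.re_ofReal_mul]
  ring

variable (hL : L = N) (β r : ℝ) {r₂ : Fin L → ℝ} (hr₂ : ∀ l, 0 < r₂ l)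
include hL hr₂

omit [IsProbabilityMeasure P] in
lemma integral_txPower_rawPrecoder :
    ∫ ω, txPower (rawPrecoder α β (channel (fun _ => r) x ω) (channel r₂ y ω)) ∂P =
      meanPower P α (1 - β) r x := by
  refine integral_congr_ae ?_
  filter_upwards [hiid.ae_rawPrecoder_eq hL α β hr₂ (channel (fun _ => r) x)] with ω hω
  rw [hω, txPower_precoder hα, channel_eq_scaledMatrix]

lemma integral_interference_rawPrecoder (l : Fin L) :
    ∫ ω, interference (channel r₂ y ω)
      (rawPrecoder α β (channel (fun _ => r) x ω) (channel r₂ y ω)) l ∂P =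
      r₂ l * meanPower P α (1 - β) r x := by
  rw [← (hiid.integral_interference hα (1 - β) r hr₂ l).2]
  refine integral_congr_ae ?_
  filter_upwards [hiid.ae_rawPrecoder_eq hL α β hr₂ (channel (fun _ => r) x)] with ω hω
  rw [hω]

lemma integral_totalInterference_rawPrecoder :
    ∫ ω, totalInterference (channel r₂ y ω)
      (rawPrecoder α β (channel (fun _ => r) x ω) (channel r₂ y ω)) ∂P =
      (∑ l, r₂ l) * meanPower P α (1 - β) r x := by
  have e : ∀ ω, totalInterference (channel r₂ y ω) (precoder α (1 - β) (channel (fun _ => r) x ω)) =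
      ∑ l, interference (channel r₂ y ω) (precoder α (1 - β) (channel (fun _ => r) x ω)) l :=
    fun ω => Complex.re_sum _ _
  rw [Finset.sum_mul, ← Finset.sum_congr rfl fun l _ =>
      (hiid.integral_interference hα (1 - β) r hr₂ l).2, ← integral_finsetSum _ fun l _ =>
      (hiid.integral_interference hα (1 - β) r hr₂ l).1]
  refine integral_congr_ae ?_
  filter_upwards [hiid.ae_rawPrecoder_eq hL α β hr₂ (channel (fun _ => r) x)] with ω hω
  rw [hω, e]

lemma xiSqPerUser_eq {PT : ℝ} (hPT : 0 < PT) {θ : Fin L → ℝ} (hθ : ∀ l, 0 < θ l) :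
    xiSqPerUser P α β PT θ (channel (fun _ => r) x) (channel r₂ y) =
      PT / meanPower P α (1 - β) r x / Finset.univ.fold max 1 (fun l => r₂ l / θ l) := by
  have ha : 0 ≤ PT / meanPower P α (1 - β) r x := div_nonneg hPT.le (meanPower_nonneg hα _ _ _)
  rw [xiSqPerUser, hiid.integral_txPower_rawPrecoder hα hL β r hr₂,
    ← (fold_min_mul_eq_div Finset.univ ha hθ hr₂).1]
  congr 1
  ext l
  rw [hiid.integral_interference_rawPrecoder hα hL β r hr₂, mul_comm (θ l), mul_comm (r₂ l),
    mul_div_mul_comm]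

lemma xiSqSum_eq (hN : 0 < N) {PT : ℝ} (hPT : 0 < PT) {θall : ℝ} (hθ : 0 < θall) :
    xiSqSum P α β PT θall (channel (fun _ => r) x) (channel r₂ y) =
      PT / meanPower P α (1 - β) r x / max 1 ((∑ l, r₂ l) / θall) := by
  have ha : 0 ≤ PT / meanPower P α (1 - β) r x := div_nonneg hPT.le (meanPower_nonneg hα _ _ _)
  have hs : 0 < ∑ l, r₂ l :=
    Finset.sum_pos (fun l _ => hr₂ l) ⟨⟨0, hL ▸ hN⟩, Finset.mem_univ _⟩
  -- The sum constraint is the per-user statement over a one-point index set.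
  have h := (fold_min_mul_eq_div (Finset.univ : Finset Unit) ha (t := fun _ => θall)
    (u := fun _ => ∑ l, r₂ l) (fun _ => hθ) (fun _ => hs)).1
  simp only [Finset.univ_unique, Finset.fold_singleton] at h
  rw [xiSqSum, hiid.integral_txPower_rawPrecoder hα hL β r hr₂,
    hiid.integral_totalInterference_rawPrecoder hα hL β r hr₂, max_comm, ← h, min_comm,
    mul_comm θall, mul_comm (∑ l, r₂ l), mul_div_mul_comm]

end IsIIDGaussianPair

end FixedDimension

/-! ### The scalar fixed-point equation -/

lemma isFixedPoint_iff {c α β r e : ℝ} (hc : 0 < c) (hα : 0 < α) (hr : 0 < r) (he : 0 < e) :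
    IsFixedPoint c α β r e ↔
      c * α * e * (1 + e * (1 - β) ^ 2) + c * r * (1 - β) ^ 2 * e = r * (1 + e * (1 - β) ^ 2) := by
  have h1 : 0 < c * α * (1 + e * (1 - β) ^ 2) + c * r * (1 - β) ^ 2 := by positivity
  rw [IsFixedPoint, eq_div_iff h1.ne']
  constructor <;> intro h <;> linarith

/-- Clearing denominators gives A e² + B e = r with A, r > 0, a quadratic whose roots have a
negative product, so exactly one is positive. -/
lemma existsUnique_isFixedPoint {c α β r : ℝ} (hc : 0 < c) (hα : 0 < α) (hr : 0 < r) (hβ : β < 1) :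
    ∃! e : ℝ, 0 < e ∧ IsFixedPoint c α β r e := by
  have hb : 0 < (1 - β) ^ 2 := pow_pos (sub_pos.2 hβ) 2
  set A := c * α * (1 - β) ^ 2 with hA
  set B := c * α + c * r * (1 - β) ^ 2 - r * (1 - β) ^ 2 with hB
  have hA0 : 0 < A := by positivity
  have hiff : ∀ e, 0 < e → (IsFixedPoint c α β r e ↔ A * e ^ 2 + B * e = r) := fun e he => by
    rw [isFixedPoint_iff hc hα hr he, hA, hB]
    constructor <;> intro h <;> linarith
  have hD : B ^ 2 < B ^ 2 + 4 * A * r := by nlinarith [mul_pos hA0 hr]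
  have hs : B < √(B ^ 2 + 4 * A * r) :=
    lt_of_le_of_lt (le_abs_self B) (by rw [← Real.sqrt_sq_eq_abs]; exact Real.sqrt_lt_sqrt (sq_nonneg B) hD)
  have hpos : 0 < (√(B ^ 2 + 4 * A * r) - B) / (2 * A) := div_pos (sub_pos.2 hs) (by positivity)
  refine ⟨(√(B ^ 2 + 4 * A * r) - B) / (2 * A), ⟨hpos, ?_⟩, ?_⟩
  · refine (hiff _ hpos).2 ?_
    have h2 := Real.sq_sqrt ((sq_nonneg B).trans hD.le)
    generalize √(B ^ 2 + 4 * A * r) = s at h2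
    field_simp
    linear_combination h2
  · rintro e ⟨he, hfe⟩
    have h1 := (hiff e he).1 hfe
    set e' := (√(B ^ 2 + 4 * A * r) - B) / (2 * A) with he'
    have h2 : A * e' ^ 2 + B * e' = r := by
      have h2 := Real.sq_sqrt ((sq_nonneg B).trans hD.le)
      rw [he']
      generalize √(B ^ 2 + 4 * A * r) = s at h2
      field_simp
      linear_combination h2
    -- Eliminating B between the two equations leaves a second factor that is positive.
    have h3 : (e - e') * (A * e * e' + r) = 0 := by linear_combination e' * h1 - e * h2
    have h4 : 0 < A * e * e' + r := by positivity
    have := (mul_eq_zero.1 h3).resolve_right h4.ne'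
    linarith

/-! ### Deterministic equivalents -/

/-- The deterministic equivalent of `(r / N) tr R`. -/
noncomputable def mBar (c α r e : ℝ) : ℝ := e + r * (1 - 1 / c) / α

/-- The deterministic equivalent of `(r / N) tr R²`. -/
noncomputable def vBar (c α b r e : ℝ) : ℝ :=
  mBar c α r e / (b ^ 2 * r / (c * (1 + b ^ 2 * mBar c α r e) ^ 2) + α)

/-- The deterministic equivalent of the mean normalized transmit power. -/
noncomputable def tauBar (c α b r e : ℝ) : ℝ := (mBar c α r e - α * vBar c α b r e) / r

section Bar

variable {c α β r e : ℝ} (hc : 0 < c) (hα : 0 < α) (hr : 0 < r) (hβ : β < 1) (he : 0 < e)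
  (hfix : IsFixedPoint c α β r e)
include hc hα hr hβ he hfix

omit hβ in
-- The reason for the form of `mBar`: in this variable the fixed-point equation says that c α e / r
-- is the reciprocal of 1 + (1 - β)² m.
lemma mul_one_add_mBar :
    c * α * e / r * (1 + (1 - β) ^ 2 * mBar c α r e) = 1 := by
  have h := (isFixedPoint_iff hc hα hr he).1 hfix
  rw [mBar]
  field_simp
  linear_combination h

/-- Not visible from the definition when c < 1. The fixed-point equation forces c α e < r, so 1 + (1
- β)² m, the reciprocal of c α e / r, exceeds 1. -/
lemma mBar_pos : 0 < mBar c α r e := by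
  have h := (isFixedPoint_iff hc hα hr he).1 hfix
  have h1 := mul_one_add_mBar hc hα hr he hfix
  have hb : 0 < (1 - β) ^ 2 := pow_pos (sub_pos.2 hβ) 2
  have hX : c * α * e / r < 1 := by
    rw [div_lt_one hr]
    have h2 : 0 < c * r * (1 - β) ^ 2 * e := by positivity
    have h3 : c * α * e * (1 + e * (1 - β) ^ 2) < r * (1 + e * (1 - β) ^ 2) := by linarith
    exact lt_of_mul_lt_mul_right h3 (by positivity)
  have hX0 : 0 < c * α * e / r := by positivity
  by_contra! hm
  have : (1 - β) ^ 2 * mBar c α r e ≤ 0 := mul_nonpos_of_nonneg_of_nonpos hb.le hm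
  nlinarith

/-- The scalar form of `sum_looQuad_eq` divided by N, with 1/c = K/N. -/
lemma mBar_equation :
    1 / c * ((1 - β) ^ 2 * mBar c α r e / (1 + (1 - β) ^ 2 * mBar c α r e)) +
      α * mBar c α r e / r = 1 := by
  have h1 := mul_one_add_mBar hc hα hr he hfix
  have hm := mBar_pos hc hα hr hβ he hfix
  have hpos : 0 < 1 + (1 - β) ^ 2 * mBar c α r e := by positivity
  have h2 : (1 - β) ^ 2 * mBar c α r e / (1 + (1 - β) ^ 2 * mBar c α r e) = 1 - c * α * e / r := by
    rw [div_eq_iff hpos.ne']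
    linear_combination h1
  rw [h2, mBar]
  field_simp
  ring

lemma mBar_le : mBar c α r e ≤ r / α := by
  have h := mBar_equation hc hα hr hβ he hfix
  have hm := mBar_pos hc hα hr hβ he hfix
  have : 0 ≤ 1 / c * ((1 - β) ^ 2 * mBar c α r e / (1 + (1 - β) ^ 2 * mBar c α r e)) := by positivity
  have h2 : α * mBar c α r e / r ≤ 1 := by linarith
  rw [div_le_one hr] at h2
  rw [le_div_iff₀ hα]; linarith

lemma one_le_mul_mBar : 1 ≤ (1 / c * (1 - β) ^ 2 + α / r) * mBar c α r e := by
  have h := mBar_equation hc hα hr hβ he hfix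
  have hm := mBar_pos hc hα hr hβ he hfix
  have h1 : (1 - β) ^ 2 * mBar c α r e / (1 + (1 - β) ^ 2 * mBar c α r e) ≤
      (1 - β) ^ 2 * mBar c α r e := by
    refine div_le_self (by positivity) ?_
    have : 0 ≤ (1 - β) ^ 2 * mBar c α r e := by positivity
    linarith
  have h2 : 1 / c * ((1 - β) ^ 2 * mBar c α r e / (1 + (1 - β) ^ 2 * mBar c α r e)) ≤
      1 / c * ((1 - β) ^ 2 * mBar c α r e) := by gcongr
  calc 1 ≤ 1 / c * ((1 - β) ^ 2 * mBar c α r e) + α * mBar c α r e / r := by linarith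
    _ = _ := by ring

/-- The scalar form of `sum_looQuadSq_eq`. It is linear in v once m is known, and `vBar` is its
solution. -/
lemma vBar_equation :
    1 / c * ((1 - β) ^ 2 * vBar c α (1 - β) r e / (1 + (1 - β) ^ 2 * mBar c α r e) ^ 2) =
      (mBar c α r e - α * vBar c α (1 - β) r e) / r := by
  have hm := mBar_pos hc hα hr hβ he hfix
  have hb : 0 < 1 - β := sub_pos.2 hβ
  have hpos : 0 < 1 + (1 - β) ^ 2 * mBar c α r e := by positivity
  have hden : 0 < (1 - β) ^ 2 * r / (c * (1 + (1 - β) ^ 2 * mBar c α r e) ^ 2) + α := by positivity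
  have h : vBar c α (1 - β) r e *
      ((1 - β) ^ 2 * r / (c * (1 + (1 - β) ^ 2 * mBar c α r e) ^ 2) + α) = mBar c α r e := by
    rw [vBar, div_mul_cancel₀ _ hden.ne']
  rw [eq_div_iff hr.ne']
  calc _ = vBar c α (1 - β) r e * ((1 - β) ^ 2 * r / (c * (1 + (1 - β) ^ 2 * mBar c α r e) ^ 2)) := by
        field_simp
    _ = _ := by linear_combination h

lemma vBar_nonneg : 0 ≤ vBar c α (1 - β) r e := by
  have hm := mBar_pos hc hα hr hβ he hfix
  unfold vBar
  positivity

lemma tauBar_eq :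
    tauBar c α (1 - β) r e = mBar c α r e * (1 - β) ^ 2 /
      ((1 - β) ^ 2 * r + α * c * (1 + (1 - β) ^ 2 * mBar c α r e) ^ 2) := by
  have hm := mBar_pos hc hα hr hβ he hfix
  have hb : 0 < 1 - β := sub_pos.2 hβ
  have hpos : 0 < 1 + (1 - β) ^ 2 * mBar c α r e := by positivity
  rw [tauBar, ← vBar_equation hc hα hr hβ he hfix, vBar]
  field_simp

lemma tauBar_pos : 0 < tauBar c α (1 - β) r e := by
  have hm := mBar_pos hc hα hr hβ he hfix
  have hb : 0 < 1 - β := sub_pos.2 hβ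
  rw [tauBar_eq hc hα hr hβ he hfix]
  positivity

lemma tauBar_le : tauBar c α (1 - β) r e ≤ 1 / α := by
  have h1 := mBar_le hc hα hr hβ he hfix
  have h2 := mul_nonneg hα.le (vBar_nonneg hc hα hr hβ he hfix)
  rw [tauBar, div_le_iff₀ hr]
  calc _ ≤ r / α := by linarith
    _ = _ := by ring

/-- The mean power is a denominator in the normalization, so it must stay away from zero uniformly
for c between a and B. -/
lemma le_tauBar {a B : ℝ} (ha : 0 < a) (hac : a ≤ c) (hcB : c ≤ B) :
    (1 / (1 / a * (1 - β) ^ 2 + α / r)) * (1 - β) ^ 2 /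
      ((1 - β) ^ 2 * r + α * B * (1 + (1 - β) ^ 2 * (r / α)) ^ 2) ≤ tauBar c α (1 - β) r e := by
  have hm := mBar_pos hc hα hr hβ he hfix
  have hb : 0 < 1 - β := sub_pos.2 hβ
  have hB : 0 < B := hc.trans_le hcB
  rw [tauBar_eq hc hα hr hβ he hfix]
  have h1 : 1 / (1 / a * (1 - β) ^ 2 + α / r) ≤ mBar c α r e := by
    rw [div_le_iff₀ (by positivity), mul_comm]
    refine (one_le_mul_mBar hc hα hr hβ he hfix).trans ?_
    gcongr
  have h2 := mBar_le hc hα hr hβ he hfix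
  gcongr

/-- The right side is the expression of `sinr_precoder` with its ingredients replaced by their
deterministic equivalents, after ν is moved into the denominator. -/
lemma gammaBar_eq (ρ : ℝ) (hρ : 0 < ρ) {ν : ℝ} (hν : 0 < ν) :
    gammaBar ρ c α r e (r * ν) = ρ * ((1 - β) ^ 2 * mBar c α r e ^ 2) /
      (ρ * (mBar c α r e - α * vBar c α (1 - β) r e) +
        ν * (tauBar c α (1 - β) r e * (1 + (1 - β) ^ 2 * mBar c α r e) ^ 2)) := by
  have hm := mBar_pos hc hα hr hβ he hfix
  have hb : 0 < 1 - β := sub_pos.2 hβ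
  have hX := mul_one_add_mBar hc hα hr he hfix
  have hE := mBar_equation hc hα hr hβ he hfix
  have ht := tauBar_eq hc hα hr hβ he hfix
  have hmv : mBar c α r e - α * vBar c α (1 - β) r e = r * tauBar c α (1 - β) r e := by
    rw [tauBar, mul_div_cancel₀ _ hr.ne']
  rw [hmv, ht]
  generalize 1 - β = b at *
  generalize mBar c α r e = m at *
  have hp : 0 < 1 + b ^ 2 * m := by positivity
  obtain ⟨p, hpdef⟩ : ∃ p, p = 1 + b ^ 2 * m := ⟨_, rfl⟩
  rw [← hpdef] at hX hE hp ⊢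
  have hbm : b ^ 2 * m = p - 1 := by linarith
  have hcae : c * α * e = r / p := by
    rw [eq_div_iff hp.ne']
    field_simp at hX
    linarith
  have hE2 : (p - 1) * b ^ 2 * r + c * α * (p - 1) * p = c * b ^ 2 * r * p := by
    rw [hbm] at hE
    have hmm : m = (p - 1) / b ^ 2 := by rw [eq_div_iff (by positivity)]; linarith
    rw [hmm] at hE
    field_simp at hE
    linarith
  have hp1 : 0 < p - 1 := by rw [← hbm]; positivity
  have hden1 : 0 < ρ * (r / p) ^ 2 + r * ν := by positivity
  have hden2 : 0 < ρ * (r * (m * b ^ 2 / (b ^ 2 * r + α * c * p ^ 2))) +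
      ν * (m * b ^ 2 / (b ^ 2 * r + α * c * p ^ 2) * p ^ 2) := by positivity
  have hD : 0 < b ^ 2 * r + α * c * p ^ 2 := by positivity
  -- With c α e = r/p, the numerator of `gammaBar` is ρ r² q / p². The fixed-point equation enters
  -- through `key`, after which α and c can be eliminated in favour of p and q.
  obtain ⟨q, hq⟩ : ∃ q, q = c * p ^ 2 - (p - 1) ^ 2 := ⟨_, rfl⟩
  have key : r * b ^ 2 * q = (p - 1) * (b ^ 2 * r + α * c * p ^ 2) := by
    rw [hq]; linear_combination -p * hE2
  have hq0 : 0 < q := by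
    have h1 : 0 < r * b ^ 2 * q := by rw [key]; positivity
    exact pos_of_mul_pos_right h1 (by positivity)
  have hT : m * b ^ 2 / (b ^ 2 * r + α * c * p ^ 2) = (p - 1) ^ 2 / (r * b ^ 2 * q) := by
    rw [mul_comm m, hbm, key]
    field_simp
  have hcq : c = (q + (p - 1) ^ 2) / p ^ 2 := by
    rw [eq_div_iff (by positivity), hq]; ring
  rw [hT] at hden2
  rw [gammaBar, hcae, hT, div_eq_div_iff hden1.ne' hden2.ne']
  have hmm : m = (p - 1) / b ^ 2 := by rw [eq_div_iff (by positivity)]; linarith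
  rw [hmm, hcq]
  field_simp
  ring

end Bar

/-! ### Deterministic stability estimates -/

lemma abs_div_one_add_sub_le {s u m : ℝ} (hs : 0 ≤ s) (hu : 0 ≤ u) (hm : 0 ≤ m) :
    |s * u / (1 + s * u) - s * m / (1 + s * m)| ≤ s * |u - m| := by
  have h1 : 1 ≤ 1 + s * u := by have := mul_nonneg hs hu; linarith
  have h2 : 1 ≤ 1 + s * m := by have := mul_nonneg hs hm; linarith
  have h12 : 1 ≤ (1 + s * u) * (1 + s * m) := one_le_mul_of_one_le_of_one_le h1 h2
  have e : s * u / (1 + s * u) - s * m / (1 + s * m) =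
      s * (u - m) / ((1 + s * u) * (1 + s * m)) := by
    rw [div_sub_div _ _ (by positivity) (by positivity)]
    congr 1; ring
  rw [e, abs_div, abs_mul, abs_of_nonneg hs, abs_of_pos (by positivity : 0 < (1 + s * u) * (1 + s * m))]
  exact div_le_self (by positivity) h12

lemma abs_div_one_add_sq_sub_le {s u m w v : ℝ} (hs : 0 ≤ s) (hu : 0 ≤ u) (hm : 0 ≤ m)
    (hv : 0 ≤ v) :
    |w / (1 + s * u) ^ 2 - v / (1 + s * m) ^ 2| ≤ |w - v| + 2 * s * v * |u - m| := by
  have hp : 1 ≤ 1 + s * u := by have := mul_nonneg hs hu; linarith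
  have hq : 1 ≤ 1 + s * m := by have := mul_nonneg hs hm; linarith
  have hd : |s * (m - u)| = s * |u - m| := by rw [abs_mul, abs_of_nonneg hs, abs_sub_comm]
  obtain ⟨p, hpe⟩ : ∃ p, p = 1 + s * u := ⟨_, rfl⟩
  obtain ⟨q, hqe⟩ : ∃ q, q = 1 + s * m := ⟨_, rfl⟩
  rw [← hpe] at hp ⊢
  rw [← hqe] at hq ⊢
  have hqp : s * (m - u) = q - p := by rw [hpe, hqe]; ring
  rw [hqp] at hd
  have hp0 : 0 < p := by linarith
  have hq0 : 0 < q := by linarith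
  have e : w / p ^ 2 - v / q ^ 2 = (w - v) / p ^ 2 + v * ((q - p) * ((q + p) / (p ^ 2 * q ^ 2))) := by
    field_simp; ring
  have h1 : |(w - v) / p ^ 2| ≤ |w - v| := by
    rw [abs_div, abs_of_pos (by positivity : 0 < p ^ 2)]
    exact div_le_self (abs_nonneg _) (one_le_pow₀ hp)
  have h3 : (q + p) / (p ^ 2 * q ^ 2) ≤ 2 := by
    rw [div_le_iff₀ (by positivity)]
    have a1 : p ≤ p ^ 2 * q ^ 2 := by
      calc p = p * 1 := (mul_one p).symm
        _ ≤ p * (p * q ^ 2) := by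
          gcongr; exact one_le_mul_of_one_le_of_one_le hp (one_le_pow₀ hq)
        _ = _ := by ring
    have a2 : q ≤ p ^ 2 * q ^ 2 := by
      calc q = q * 1 := (mul_one q).symm
        _ ≤ q * (p ^ 2 * q) := by
          gcongr; exact one_le_mul_of_one_le_of_one_le (one_le_pow₀ hp) hq
        _ = _ := by ring
    linarith
  have h2 : |v * ((q - p) * ((q + p) / (p ^ 2 * q ^ 2)))| ≤ 2 * s * v * |u - m| := by
    rw [abs_mul, abs_mul, abs_of_nonneg hv,
      abs_of_pos (by positivity : 0 < (q + p) / (p ^ 2 * q ^ 2))]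
    calc v * (|q - p| * ((q + p) / (p ^ 2 * q ^ 2))) ≤ v * (|q - p| * 2) := by gcongr
      _ = v * (s * |u - m| * 2) := by rw [hd]
      _ = _ := by ring
  rw [e]
  refine (abs_add_le _ _).trans ?_
  linarith

/-- A ratio whose denominator contains a possibly large factor `ν ≥ 1` depends on its other
ingredients in a Lipschitz way, uniformly in `ν`. -/
lemma abs_ratio_sub_le {A A' B B' C C' ν δ M : ℝ} (hδ : 0 < δ) (hν : 1 ≤ ν) (hB : 0 ≤ B)
    (hB' : 0 ≤ B') (hC : δ ≤ C) (hC' : δ ≤ C') (hA' : |A'| ≤ M) :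
    |A / (B + ν * C) - A' / (B' + ν * C')| ≤
      |A - A'| / δ + M * ((|B - B'| + |C - C'|) / δ ^ 2) := by
  have hν0 : 0 < ν := by linarith
  have hD : ν * δ ≤ B + ν * C := by
    have := mul_le_mul_of_nonneg_left hC hν0.le; linarith
  have hD' : ν * δ ≤ B' + ν * C' := by
    have := mul_le_mul_of_nonneg_left hC' hν0.le; linarith
  have hνδ : 0 < ν * δ := by positivity
  have hD0 := hνδ.trans_le hD
  have hD0' := hνδ.trans_le hD'
  have hM : 0 ≤ M := (abs_nonneg _).trans hA'
  have e : A / (B + ν * C) - A' / (B' + ν * C') =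
      (A - A') / (B + ν * C) +
        A' * (((B' - B) + ν * (C' - C)) / ((B + ν * C) * (B' + ν * C'))) := by
    field_simp
    ring
  have h1 : |(A - A') / (B + ν * C)| ≤ |A - A'| / δ := by
    rw [abs_div, abs_of_pos hD0]
    gcongr
    nlinarith
  have h2 : |((B' - B) + ν * (C' - C)) / ((B + ν * C) * (B' + ν * C'))| ≤
      (|B - B'| + |C - C'|) / δ ^ 2 := by
    rw [abs_div, abs_of_pos (mul_pos hD0 hD0')]
    have h3 : |(B' - B) + ν * (C' - C)| ≤ ν * (|B - B'| + |C - C'|) := by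
      refine (abs_add_le _ _).trans ?_
      rw [abs_mul, abs_of_pos hν0, abs_sub_comm B', abs_sub_comm C']
      nlinarith [abs_nonneg (B - B')]
    -- Each denominator is at least ν δ. One factor ν cancels the ν of the numerator, the other is
    -- at least 1.
    have h4 : ν * δ ^ 2 ≤ (B + ν * C) * (B' + ν * C') := by
      calc ν * δ ^ 2 ≤ ν * (ν * δ ^ 2) := le_mul_of_one_le_left (by positivity) hν |>.trans (by
            nlinarith [sq_nonneg δ])
        _ = (ν * δ) * (ν * δ) := by ring
        _ ≤ _ := mul_le_mul hD hD' hνδ.le hD0.le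
    calc _ ≤ ν * (|B - B'| + |C - C'|) / (ν * δ ^ 2) := by gcongr
      _ = _ := by field_simp
  rw [e]
  refine (abs_add_le _ _).trans (add_le_add h1 ?_)
  rw [abs_mul]
  exact mul_le_mul hA' h2 (abs_nonneg _) hM

section Estimates

variable {K N : ℕ} (X : Fin K → Fin N → ℂ) {α r : ℝ} (hα : 0 < α) (hr : 0 < r)
include hα hr

/-- Random deviation from the trace of R_k, plus r/N times the O(1) change of the trace when R_k is
replaced by R. -/
lemma abs_looQuad_sub_le (b : ℝ) (k : Fin K) :
    |looQuad α b (scaledMatrix r X) k - r / N * trRes α b (scaledMatrix r X)| ≤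
      |quadDev α b r X k| + r / N * (1 / α) := by
  have h := abs_trRes_updateRow_sub_le hα b (scaledMatrix r X) k
  have hN : 0 ≤ r / (N : ℝ) := by positivity
  have e : looQuad α b (scaledMatrix r X) k - r / N * trRes α b (scaledMatrix r X) =
      quadDev α b r X k + r / N * (trRes α b ((scaledMatrix r X).updateRow k 0) -
        trRes α b (scaledMatrix r X)) := by
    rw [quadDev]; ring
  rw [e]
  refine (abs_add_le _ _).trans ?_
  rw [abs_mul, abs_of_nonneg hN]
  gcongr

lemma abs_looQuadSq_sub_le (b : ℝ) (k : Fin K) :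
    |looQuadSq α b (scaledMatrix r X) k - r / N * trResSq α b (scaledMatrix r X)| ≤
      |quadDevSq α b r X k| + r / N * (2 / α ^ 2) := by
  have h := abs_trResSq_updateRow_sub_le hα b (scaledMatrix r X) k
  have hN : 0 ≤ r / (N : ℝ) := by positivity
  have e : looQuadSq α b (scaledMatrix r X) k - r / N * trResSq α b (scaledMatrix r X) =
      quadDevSq α b r X k + r / N * (trResSq α b ((scaledMatrix r X).updateRow k 0) -
        trResSq α b (scaledMatrix r X)) := by
    rw [quadDevSq]; ring
  rw [e]
  refine (abs_add_le _ _).trans ?_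
  rw [abs_mul, abs_of_nonneg hN]
  gcongr

variable (hK : 0 < K) (hN : 0 < N) {β e : ℝ} (hβ : β < 1) (he : 0 < e)
  (hfix : IsFixedPoint ((N : ℝ) / K) α β r e)
include hK hN hβ he hfix

omit hα hr hβ he hfix in
/-- Averages over the users of terms close to a constant. -/
lemma abs_sum_div_sub_le {g : Fin K → ℝ} {g₀ : ℝ} {d : Fin K → ℝ} {ε s : ℝ}
    (h : ∀ k, |g k - g₀| ≤ s * (d k + ε)) :
    |(∑ k, g k) / N - 1 / ((N : ℝ) / K) * g₀| ≤
      1 / ((N : ℝ) / K) * (s * ((1 / (K : ℝ)) * ∑ k, d k + ε)) := by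
  have hK' : (0 : ℝ) < K := by exact_mod_cast hK
  have hN' : (0 : ℝ) < N := by exact_mod_cast hN
  have e1 : (∑ k, g k) / N - 1 / ((N : ℝ) / K) * g₀ = (∑ k, (g k - g₀)) / N := by
    rw [Finset.sum_sub_distrib]
    simp only [Finset.sum_const, Finset.card_univ, Fintype.card_fin, nsmul_eq_mul]
    field_simp
  rw [e1, abs_div, abs_of_pos hN']
  calc _ ≤ (∑ k, s * (d k + ε)) / N := by
        gcongr
        exact (Finset.abs_sum_le_sum_abs _ _).trans (Finset.sum_le_sum fun k _ => h k)
    _ = _ := by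
        rw [← Finset.mul_sum, Finset.sum_add_distrib]
        simp only [Finset.sum_const, Finset.card_univ, Fintype.card_fin, nsmul_eq_mul]
        field_simp

/-- The normalized trace solves `mBar_equation` up to an average of user errors. The left side of
that equation is increasing in m with slope at least α/r, so the error in m is at most r/α times the
residual. -/
lemma abs_trRes_sub_mBar_le :
    |r / N * trRes α (1 - β) (scaledMatrix r X) - mBar ((N : ℝ) / K) α r e| ≤
      r / α * (1 / ((N : ℝ) / K) * ((1 - β) ^ 2 *
        ((1 / (K : ℝ)) * ∑ k, |quadDev α (1 - β) r X k| + r / N * (1 / α)))) := by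
  have hK' : (0 : ℝ) < K := by exact_mod_cast hK
  have hN' : (0 : ℝ) < N := by exact_mod_cast hN
  have hc : 0 < (N : ℝ) / K := by positivity
  have hmb := mBar_pos hc hα hr hβ he hfix
  have hE := mBar_equation hc hα hr hβ he hfix
  have hm0 : 0 ≤ r / N * trRes α (1 - β) (scaledMatrix r X) :=
    mul_nonneg (by positivity) (trRes_nonneg hα _ _)
  have hsum := sum_looQuad_eq hα (1 - β) (scaledMatrix r X)
  have h := abs_sum_div_sub_le hK hN (g := fun k => (1 - β) ^ 2 * looQuad α (1 - β) (scaledMatrix r X) k /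
      (1 + (1 - β) ^ 2 * looQuad α (1 - β) (scaledMatrix r X) k))
    (d := fun k => |quadDev α (1 - β) r X k|) (ε := r / N * (1 / α)) (s := (1 - β) ^ 2)
    (fun k => (abs_div_one_add_sub_le (sq_nonneg (1 - β)) (looQuad_nonneg hα _ _ k) hm0).trans
      (mul_le_mul_of_nonneg_left (abs_looQuad_sub_le X hα hr (1 - β) k) (sq_nonneg _)))
  rw [hsum, Fintype.card_fin] at h
  have e1 : ((N : ℝ) - α * trRes α (1 - β) (scaledMatrix r X)) / N =
      1 - α / r * (r / N * trRes α (1 - β) (scaledMatrix r X)) := by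
    field_simp
  rw [e1] at h
  generalize r / N * trRes α (1 - β) (scaledMatrix r X) = m at *
  generalize mBar ((N : ℝ) / K) α r e = M at *
  generalize 1 / ((N : ℝ) / K) * ((1 - β) ^ 2 *
        ((1 / (K : ℝ)) * ∑ k, |quadDev α (1 - β) r X k| + r / N * (1 / α))) = ε at *
  have hci : 0 < 1 / ((N : ℝ) / K) := by positivity
  generalize 1 / ((N : ℝ) / K) = κ at *
  have hs := sq_nonneg (1 - β)
  generalize (1 - β) ^ 2 = s at *
  have hsm : 0 ≤ s * m := mul_nonneg hs hm0
  have hsM : 0 ≤ s * M := mul_nonneg hs hmb.le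
  have hdiff : s * m / (1 + s * m) - s * M / (1 + s * M) =
      (s / ((1 + s * m) * (1 + s * M))) * (m - M) := by
    field_simp
    ring
  -- The difference quotient of s m / (1 + s m); only its sign matters.
  set L := s / ((1 + s * m) * (1 + s * M)) with hL
  have hL0 : 0 ≤ L := by positivity
  have hkey : (κ * L + α / r) * (m - M) =
      -(1 - α / r * m - κ * (s * m / (1 + s * m))) := by
    have : α * M / r = α / r * M := by ring
    rw [this] at hE
    linear_combination -κ * hdiff - hE
  have habs : (κ * L + α / r) * |m - M| ≤ ε := by
    rw [← abs_of_nonneg (by positivity : 0 ≤ κ * L + α / r), ← abs_mul, hkey, abs_neg]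
    exact h
  have h3 : α / r * |m - M| ≤ ε := by
    have := mul_nonneg (mul_nonneg hci.le hL0) (abs_nonneg (m - M))
    linarith
  calc |m - M| = r / α * (α / r * |m - M|) := by field_simp
    _ ≤ r / α * ε := by gcongr

/-- The same stability argument for an affine equation with slope at least α/r; the error already
known for tr R enters as a perturbation of its coefficients. -/
lemma abs_trResSq_sub_vBar_le :
    |r / N * trResSq α (1 - β) (scaledMatrix r X) - vBar ((N : ℝ) / K) α (1 - β) r e| ≤
      r / α * (|r / N * trRes α (1 - β) (scaledMatrix r X) - mBar ((N : ℝ) / K) α r e| / r +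
        1 / ((N : ℝ) / K) * ((1 - β) ^ 2 * ((1 / (K : ℝ)) *
          ∑ k, (|quadDevSq α (1 - β) r X k| +
            2 * (1 - β) ^ 2 * (r / α ^ 2) * |quadDev α (1 - β) r X k|) +
          (r / N * (2 / α ^ 2) + 2 * (1 - β) ^ 2 * (r / α ^ 2) * (r / N * (1 / α) +
            |r / N * trRes α (1 - β) (scaledMatrix r X) - mBar ((N : ℝ) / K) α r e|))))) := by
  have hK' : (0 : ℝ) < K := by exact_mod_cast hK
  have hN' : (0 : ℝ) < N := by exact_mod_cast hN
  have hc : 0 < (N : ℝ) / K := by positivity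
  have hmb := mBar_pos hc hα hr hβ he hfix
  have hE := vBar_equation hc hα hr hβ he hfix
  have hs := sq_nonneg (1 - β)
  have hv0 : 0 ≤ r / N * trResSq α (1 - β) (scaledMatrix r X) :=
    mul_nonneg (by positivity) (trResSq_nonneg _ _)
  -- An a priori bound on the normalized trace, which makes the Lipschitz constant in the `looQuad`
  -- variable deterministic.
  have hv1 : r / N * trResSq α (1 - β) (scaledMatrix r X) ≤ r / α ^ 2 := by
    have h1 := mul_trResSq_le hα (1 - β) (scaledMatrix r X)
    have h2 := mul_trRes_le hα (1 - β) (scaledMatrix r X)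
    rw [Fintype.card_fin] at h2
    have h3 : α ^ 2 * trResSq α (1 - β) (scaledMatrix r X) ≤ N := by nlinarith
    rw [le_div_iff₀ (by positivity), div_mul_eq_mul_div, div_mul_eq_mul_div, div_le_iff₀ hN']
    nlinarith
  have hsum := sum_looQuadSq_eq hα (1 - β) (scaledMatrix r X)
  have h := abs_sum_div_sub_le hK hN
    (g := fun k => (1 - β) ^ 2 * (looQuadSq α (1 - β) (scaledMatrix r X) k /
      (1 + (1 - β) ^ 2 * looQuad α (1 - β) (scaledMatrix r X) k) ^ 2))
    (g₀ := (1 - β) ^ 2 * (r / N * trResSq α (1 - β) (scaledMatrix r X) /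
      (1 + (1 - β) ^ 2 * mBar ((N : ℝ) / K) α r e) ^ 2))
    (d := fun k => |quadDevSq α (1 - β) r X k| +
            2 * (1 - β) ^ 2 * (r / α ^ 2) * |quadDev α (1 - β) r X k|)
    (ε := r / N * (2 / α ^ 2) + 2 * (1 - β) ^ 2 * (r / α ^ 2) * (r / N * (1 / α) +
            |r / N * trRes α (1 - β) (scaledMatrix r X) - mBar ((N : ℝ) / K) α r e|))
    (s := (1 - β) ^ 2)
    (fun k => by
      rw [← mul_sub, abs_mul, abs_of_nonneg hs]
      refine mul_le_mul_of_nonneg_left ?_ hs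
      refine (abs_div_one_add_sq_sub_le hs (looQuad_nonneg hα _ _ k) hmb.le hv0).trans ?_
      have b1 := abs_looQuadSq_sub_le X hα hr (1 - β) k
      have b2 := abs_looQuad_sub_le X hα hr (1 - β) k
      have b3 := abs_sub_le (looQuad α (1 - β) (scaledMatrix r X) k)
        (r / N * trRes α (1 - β) (scaledMatrix r X)) (mBar ((N : ℝ) / K) α r e)
      have b4 : 2 * (1 - β) ^ 2 * (r / N * trResSq α (1 - β) (scaledMatrix r X)) *
          |looQuad α (1 - β) (scaledMatrix r X) k - mBar ((N : ℝ) / K) α r e| ≤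
          2 * (1 - β) ^ 2 * (r / α ^ 2) * (|quadDev α (1 - β) r X k| + r / N * (1 / α) +
            |r / N * trRes α (1 - β) (scaledMatrix r X) - mBar ((N : ℝ) / K) α r e|) := by
        gcongr
        linarith
      linarith)
  simp_rw [mul_div_assoc] at hsum
  rw [hsum] at h
  have e1 : (trRes α (1 - β) (scaledMatrix r X) - α * trResSq α (1 - β) (scaledMatrix r X)) / N =
      (r / N * trRes α (1 - β) (scaledMatrix r X) -
        α * (r / N * trResSq α (1 - β) (scaledMatrix r X))) / r := by
    field_simp
  rw [e1] at h
  have hci : 0 < 1 / ((N : ℝ) / K) := by positivity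
  generalize r / N * trRes α (1 - β) (scaledMatrix r X) = m at *
  generalize r / N * trResSq α (1 - β) (scaledMatrix r X) = v at *
  generalize vBar ((N : ℝ) / K) α (1 - β) r e = V at *
  generalize mBar ((N : ℝ) / K) α r e = M at *
  generalize 1 / ((N : ℝ) / K) * ((1 - β) ^ 2 * (1 / (K : ℝ) *
    ∑ k, (|quadDevSq α (1 - β) r X k| + 2 * (1 - β) ^ 2 * (r / α ^ 2) * |quadDev α (1 - β) r X k|) +
    (r / N * (2 / α ^ 2) + 2 * (1 - β) ^ 2 * (r / α ^ 2) * (r / N * (1 / α) + |m - M|)))) = ε at *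
  generalize 1 / ((N : ℝ) / K) = κ at *
  generalize (1 - β) ^ 2 = s at *
  have hp : 0 < (1 + s * M) ^ 2 := by
    have := mul_nonneg hs hmb.le
    positivity
  generalize (1 + s * M) ^ 2 = p at *
  have hL0 : 0 ≤ κ * (s / p) := by positivity
  have hkey : (κ * (s / p) + α / r) * (v - V) =
      (m - M) / r - ((m - α * v) / r - κ * (s * (v / p))) := by
    linear_combination -hE
  have habs : (κ * (s / p) + α / r) * |v - V| ≤ |m - M| / r + ε := by
    rw [← abs_of_nonneg (by positivity : 0 ≤ κ * (s / p) + α / r), ← abs_mul, hkey]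
    refine (abs_sub _ _).trans (add_le_add ?_ h)
    rw [abs_div, abs_of_pos hr]
  have h3 : α / r * |v - V| ≤ |m - M| / r + ε := by
    have := mul_nonneg hL0 (abs_nonneg (v - V))
    linarith
  calc |v - V| = r / α * (α / r * |v - V|) := by field_simp
    _ ≤ r / α * (|m - M| / r + ε) := by gcongr

end Estimates

/-! ### Almost sure convergence -/

/-- The sum of the fourth powers has finite expectation, hence is almost surely finite. No relation
between different n is needed; strict monotonicity gives N n ≥ n + 1 and so summability. -/
lemma ae_tendsto_zero_of_lintegral_pow_four_le {Ω : Type*} [MeasurableSpace Ω] {P : Measure Ω}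
    {N : ℕ → ℕ} (hN : StrictMono N) (hN0 : ∀ n, 0 < N n) {f : ℕ → Ω → ℝ}
    (hf : ∀ n, AEMeasurable (f n) P) {C : ℝ} (hC : 0 ≤ C)
    (h : ∀ n, ∫⁻ ω, ENNReal.ofReal (f n ω ^ 4) ∂P ≤ ENNReal.ofReal (C / (N n : ℝ) ^ 2)) :
    ∀ᵐ ω ∂P, Tendsto (fun n => f n ω) atTop (𝓝 0) := by
  have hNn : ∀ n, n + 1 ≤ N n := fun n => by
    induction n with
    | zero => exact hN0 0
    | succ n ih => exact Nat.succ_le_of_lt (lt_of_le_of_lt ih (hN n.lt_succ_self))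
  have hsum : Summable fun n : ℕ => C / ((n : ℝ) + 1) ^ 2 := by
    have h1 : Summable fun n : ℕ => 1 / ((n + 1 : ℕ) : ℝ) ^ 2 :=
      (summable_nat_add_iff 1).2 (Real.summable_one_div_nat_pow.2 (by norm_num))
    refine (h1.mul_left C).congr fun n => ?_
    push_cast
    ring
  have hfin : ∫⁻ ω, ∑' n, ENNReal.ofReal (f n ω ^ 4) ∂P ≠ ⊤ := by
    rw [lintegral_tsum fun n => ((hf n).pow_const 4).ennreal_ofReal]
    refine ne_top_of_le_ne_top (hsum.tsum_ofReal_ne_top) (ENNReal.tsum_le_tsum fun n => (h n).trans ?_)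
    refine ENNReal.ofReal_le_ofReal ?_
    have : (n : ℝ) + 1 ≤ N n := by exact_mod_cast hNn n
    gcongr
  have hae := ae_lt_top' (AEMeasurable.tsum fun n => ((hf n).pow_const 4).ennreal_ofReal) hfin
  filter_upwards [hae] with ω hω
  have h1 := ENNReal.tendsto_atTop_zero_of_tsum_ne_top hω.ne
  have h2 : Tendsto (fun n => f n ω ^ 4) atTop (𝓝 0) := by
    have := (ENNReal.tendsto_toReal ENNReal.zero_ne_top).comp h1
    refine this.congr fun n => ?_
    simp only [Function.comp]
    rw [ENNReal.toReal_ofReal (by positivity)]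
  rw [tendsto_zero_iff_abs_tendsto_zero]
  have hs : Tendsto Real.sqrt (𝓝 0) (𝓝 0) := by
    simpa using Real.continuous_sqrt.tendsto 0
  have h3 := hs.comp (hs.comp h2)
  refine h3.congr fun n => ?_
  simp only [Function.comp]
  rw [show f n ω ^ 4 = (f n ω ^ 2) ^ 2 by ring, Real.sqrt_sq (sq_nonneg _), Real.sqrt_sq_eq_abs]

/-- By Jensen an average inherits the bound of its terms, so the sum rules need no estimate uniform
over the users. -/
lemma lintegral_average_pow_four_le {Ω : Type*} [MeasurableSpace Ω] {P : Measure Ω} {K : ℕ}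
    (hK : 0 < K) {f : Fin K → Ω → ℝ} (hf : ∀ k, AEMeasurable (f k) P) {C : ENNReal}
    (h : ∀ k, ∫⁻ ω, ENNReal.ofReal (f k ω ^ 4) ∂P ≤ C) :
    ∫⁻ ω, ENNReal.ofReal ((1 / (K : ℝ) * ∑ k, |f k ω|) ^ 4) ∂P ≤ C := by
  have hK' : (0 : ℝ) < K := by exact_mod_cast hK
  have h1 : ∀ ω, (1 / (K : ℝ) * ∑ k, |f k ω|) ^ 4 ≤ ∑ k, 1 / (K : ℝ) * f k ω ^ 4 := fun ω => by
    have := Real.pow_arith_mean_le_arith_mean_pow (Finset.univ : Finset (Fin K))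
      (fun _ => 1 / (K : ℝ)) (fun k => |f k ω|) (fun _ _ => by positivity)
      (by simp [hK'.ne']) (fun _ _ => abs_nonneg _) 4
    rw [Finset.mul_sum]
    refine this.trans (le_of_eq (Finset.sum_congr rfl fun k _ => ?_))
    rw [show |f k ω| ^ 4 = (|f k ω| ^ 2) ^ 2 by ring, sq_abs]
    ring
  calc _ ≤ ∫⁻ ω, ∑ k, ENNReal.ofReal (1 / (K : ℝ)) * ENNReal.ofReal (f k ω ^ 4) ∂P := by
        refine lintegral_mono fun ω => (ENNReal.ofReal_le_ofReal (h1 ω)).trans (le_of_eq ?_)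
        rw [ENNReal.ofReal_sum_of_nonneg fun k _ => by positivity]
        exact Finset.sum_congr rfl fun k _ => ENNReal.ofReal_mul (by positivity)
    _ = ∑ k, ENNReal.ofReal (1 / (K : ℝ)) * ∫⁻ ω, ENNReal.ofReal (f k ω ^ 4) ∂P := by
        rw [lintegral_finsetSum' _ fun k _ =>
          (((hf k).pow_const 4).ennreal_ofReal.const_mul _)]
        exact Finset.sum_congr rfl fun k _ => lintegral_const_mul' _ _ ENNReal.ofReal_ne_top
    _ ≤ ∑ _k : Fin K, ENNReal.ofReal (1 / (K : ℝ)) * C :=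
        Finset.sum_le_sum fun k _ => mul_le_mul_right (h k) _
    _ = C := by
        rw [Finset.sum_const, Finset.card_univ, Fintype.card_fin, nsmul_eq_mul, ← mul_assoc,
          ← ENNReal.ofReal_natCast, ← ENNReal.ofReal_mul hK'.le, mul_one_div_cancel hK'.ne',
          ENNReal.ofReal_one, one_mul]

lemma tendsto_mul_sub_mul {a b a' b' : ℕ → ℝ} {A B : ℝ} (hA : ∀ n, |a' n| ≤ A)
    (hB : ∀ n, |b' n| ≤ B) (ha : Tendsto (fun n => a n - a' n) atTop (𝓝 0))
    (hb : Tendsto (fun n => b n - b' n) atTop (𝓝 0)) :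
    Tendsto (fun n => a n * b n - a' n * b' n) atTop (𝓝 0) := by
  have h : Tendsto (fun n => |a n - a' n| * |b n - b' n| + A * |b n - b' n| + |a n - a' n| * B)
      atTop (𝓝 (|0| * |0| + A * |0| + |0| * B)) :=
    ((ha.abs.mul hb.abs).add (hb.abs.const_mul A)).add (ha.abs.mul_const B)
  simp only [abs_zero, mul_zero, zero_mul, add_zero] at h
  refine squeeze_zero_norm (fun n => ?_) h
  have e : a n * b n - a' n * b' n =
      (a n - a' n) * (b n - b' n) + a' n * (b n - b' n) + (a n - a' n) * b' n := by ring
  rw [e, Real.norm_eq_abs]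
  refine (abs_add_three _ _ _).trans ?_
  rw [abs_mul, abs_mul, abs_mul]
  gcongr
  · exact hA n
  · exact hB n

/-- Multiplying numerator and denominator by τ ν / σ2 leaves ν only as a factor in the denominator,
where `abs_ratio_sub_le` is uniform in ν. No upper bound on ν is required. -/
lemma tendsto_ratio_sub_ratio {U V m v t τ ν : ℕ → ℝ} {α s M T δ PT σ2 : ℝ}
    (hU : Tendsto (fun n => U n - m n) atTop (𝓝 0)) (hV : Tendsto (fun n => V n - v n) atTop (𝓝 0))
    (hτ : Tendsto (fun n => τ n - t n) atTop (𝓝 0)) (hU0 : ∀ n, 0 ≤ U n)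
    (hUV : ∀ n, 0 ≤ U n - α * V n) (hm0 : ∀ n, 0 ≤ m n) (hmM : ∀ n, |m n| ≤ M)
    (htT : ∀ n, |t n| ≤ T) (hmv : ∀ n, 0 ≤ m n - α * v n) (hδ : 0 < δ) (ht : ∀ n, 2 * δ ≤ t n)
    (hν : ∀ n, 1 ≤ ν n) (hs : 0 ≤ s) (hPT : 0 < PT) (hσ2 : 0 < σ2) :
    Tendsto (fun n => PT / τ n / ν n * (s * U n ^ 2) /
        (PT / τ n / ν n * (U n - α * V n) + σ2 * (1 + s * U n) ^ 2) -
      PT / σ2 * (s * m n ^ 2) /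
        (PT / σ2 * (m n - α * v n) + ν n * (t n * (1 + s * m n) ^ 2))) atTop (𝓝 0) := by
  set ρ := PT / σ2 with hρ
  have hρ0 : 0 < ρ := by positivity
  -- The lower bound 2δ on t leaves room for an error δ in τ.
  have hτev : ∀ᶠ n in atTop, δ ≤ τ n := by
    filter_upwards [(Metric.tendsto_nhds.1 hτ) δ hδ] with n hn
    rw [Real.dist_eq, sub_zero, abs_lt] at hn
    linarith [ht n]
  have hM0 : 0 ≤ M := (abs_nonneg _).trans (hmM 0)
  have hA : Tendsto (fun n => ρ * (s * U n ^ 2) - ρ * (s * m n ^ 2)) atTop (𝓝 0) := by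
    have h := (tendsto_mul_sub_mul hmM hmM hU hU).const_mul (ρ * s)
    rw [mul_zero] at h
    exact h.congr fun n => by ring
  have hB : Tendsto (fun n => ρ * (U n - α * V n) - ρ * (m n - α * v n)) atTop (𝓝 0) := by
    have h := (hU.sub (hV.const_mul α)).const_mul ρ
    simp only [mul_zero, sub_zero] at h
    exact h.congr fun n => by ring
  have hp : Tendsto (fun n => (1 + s * U n) - (1 + s * m n)) atTop (𝓝 0) := by
    have h := hU.const_mul s
    rw [mul_zero] at h
    exact h.congr fun n => by ring
  have hpM : ∀ n, |1 + s * m n| ≤ 1 + s * M := fun n => by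
    have := mul_nonneg hs (hm0 n)
    rw [abs_of_nonneg (by linarith)]
    have := (abs_le.1 (hmM n)).2
    gcongr
  have hpp : ∀ n, |(1 + s * m n) * (1 + s * m n)| ≤ (1 + s * M) * (1 + s * M) := fun n => by
    rw [abs_mul]
    exact mul_le_mul (hpM n) (hpM n) (abs_nonneg _) (by positivity)
  have hC : Tendsto (fun n => τ n * (1 + s * U n) ^ 2 - t n * (1 + s * m n) ^ 2) atTop (𝓝 0) :=
    (tendsto_mul_sub_mul htT hpp hτ (tendsto_mul_sub_mul hpM hpM hp hp)).congr fun n => by ring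
  have hlim := (hA.abs.div_const δ).add (((hB.abs.add hC.abs).div_const (δ ^ 2)).const_mul
    (ρ * (s * M ^ 2)))
  simp only [abs_zero, zero_div, add_zero, mul_zero] at hlim
  refine squeeze_zero_norm' ?_ hlim
  filter_upwards [hτev] with n hn
  have hτ0 : 0 < τ n := hδ.trans_le hn
  have hν0 : 0 < ν n := zero_lt_one.trans_le (hν n)
  have hsU : 1 ≤ (1 + s * U n) ^ 2 := one_le_pow₀ (by have := mul_nonneg hs (hU0 n); linarith)
  have hsm : 1 ≤ (1 + s * m n) ^ 2 := one_le_pow₀ (by have := mul_nonneg hs (hm0 n); linarith)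
  have e : PT / τ n / ν n * (s * U n ^ 2) /
        (PT / τ n / ν n * (U n - α * V n) + σ2 * (1 + s * U n) ^ 2) =
      ρ * (s * U n ^ 2) / (ρ * (U n - α * V n) + ν n * (τ n * (1 + s * U n) ^ 2)) := by
    have hc : 0 < τ n * ν n / σ2 := by positivity
    rw [← mul_div_mul_left _ _ hc.ne', hρ]
    congr 1
    · field_simp
    · field_simp
  rw [e, Real.norm_eq_abs]
  refine abs_ratio_sub_le hδ (hν n) (mul_nonneg hρ0.le (hUV n)) (mul_nonneg hρ0.le (hmv n)) ?_ ?_ ?_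
  · exact hn.trans (le_mul_of_one_le_right hτ0.le hsU)
  · have h1 : δ ≤ t n := by linarith [ht n]
    exact h1.trans (le_mul_of_one_le_right (hδ.le.trans h1) hsm)
  · rw [abs_of_nonneg (mul_nonneg hρ0.le (mul_nonneg hs (sq_nonneg _)))]
    have := (abs_le.1 (hmM n)).2
    have := hm0 n
    gcongr

-- Passage to the limit at sample points where the quadratic forms concentrate

section Limit

variable {Ω : Type*} [MeasurableSpace Ω] {P : Measure Ω} [IsProbabilityMeasure P]
  {N K : ℕ → ℕ} {x : (n : ℕ) → Fin (K n) → Fin (N n) → Ω → ℂ}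

/-- `ω` is a sample point at which the leave-one-out quadratic forms concentrate, both for the
chosen users and on average over the users. -/
structure QuadConcentration (α b r : ℝ) (x : (n : ℕ) → Fin (K n) → Fin (N n) → Ω → ℂ)
    (k : (n : ℕ) → Fin (K n)) (ω : Ω) : Prop where
  dev : Tendsto (fun n => quadDev α b r (fun i j => x n i j ω) (k n)) atTop (𝓝 0)
  devSq : Tendsto (fun n => quadDevSq α b r (fun i j => x n i j ω) (k n)) atTop (𝓝 0)
  avg : Tendsto (fun n => 1 / (K n : ℝ) * ∑ i, |quadDev α b r (fun i j => x n i j ω) i|)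
    atTop (𝓝 0)
  avgSq : Tendsto (fun n => 1 / (K n : ℝ) * ∑ i, |quadDevSq α b r (fun i j => x n i j ω) i|)
    atTop (𝓝 0)

lemma ae_quadConcentration (hN : StrictMono N) (hN0 : ∀ n, 0 < N n) (hK0 : ∀ n, 0 < K n)
    {L : ℕ → ℕ} {y : (n : ℕ) → Fin (L n) → Fin (N n) → Ω → ℂ}
    (hiid : ∀ n, IsIIDGaussianPair P (x n) (y n)) {α r : ℝ} (hα : 0 < α) (hr : 0 < r) (b : ℝ)
    (k : (n : ℕ) → Fin (K n)) :
    ∀ᵐ ω ∂P, QuadConcentration α b r x k ω := by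
  have m1 : ∀ n i, AEMeasurable (fun ω => quadDev α b r (fun i j => x n i j ω) i) P := fun n i =>
    (continuous_quadDev hα b hr.le i).measurable.comp_aemeasurable (hiid n).aemeasurable_left
  have m2 : ∀ n i, AEMeasurable (fun ω => quadDevSq α b r (fun i j => x n i j ω) i) P := fun n i =>
    (continuous_quadDevSq hα b hr.le i).measurable.comp_aemeasurable (hiid n).aemeasurable_left
  have b1 := fun n => (hiid n).lintegral_quadDev_le hα b hr.le (hN0 n)
  have b2 := fun n => (hiid n).lintegral_quadDevSq_le hα b hr.le (hN0 n)
  have hC1 : 0 ≤ 3 * quadConst ^ 2 * (r ^ 4 * (1 / α) ^ 4) := by positivity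
  have hC2 : 0 ≤ 3 * quadConst ^ 2 * (r ^ 4 * (1 / α) ^ 8) := by positivity
  filter_upwards [
    ae_tendsto_zero_of_lintegral_pow_four_le hN hN0 (fun n => m1 n (k n)) hC1 fun n => b1 n (k n),
    ae_tendsto_zero_of_lintegral_pow_four_le hN hN0 (fun n => m2 n (k n)) hC2 fun n => b2 n (k n),
    ae_tendsto_zero_of_lintegral_pow_four_le hN hN0
      (f := fun n ω => 1 / (K n : ℝ) * ∑ i, |quadDev α b r (fun i j => x n i j ω) i|)
      (fun n => (Finset.aemeasurable_fun_sum _ fun i _ => (m1 n i).abs).const_mul _) hC1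
      fun n => lintegral_average_pow_four_le (hK0 n) (m1 n) (b1 n),
    ae_tendsto_zero_of_lintegral_pow_four_le hN hN0
      (f := fun n ω => 1 / (K n : ℝ) * ∑ i, |quadDevSq α b r (fun i j => x n i j ω) i|)
      (fun n => (Finset.aemeasurable_fun_sum _ fun i _ => (m2 n i).abs).const_mul _) hC2
      fun n => lintegral_average_pow_four_le (hK0 n) (m2 n) (b2 n)] with ω h1 h2 h3 h4
  exact ⟨h1, h2, h3, h4⟩

variable (hN : StrictMono N) (hN0 : ∀ n, 0 < N n) (hK0 : ∀ n, 0 < K n)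
  {a : ℝ} (ha : 0 < a) (hac : ∀ n, a ≤ (N n : ℝ) / K n)
  {α r β : ℝ} (hα : 0 < α) (hr : 0 < r) (hβ : β < 1)
  {e : ℕ → ℝ} (he : ∀ n, 0 < e n ∧ IsFixedPoint ((N n : ℝ) / K n) α β r (e n))
  {k : (n : ℕ) → Fin (K n)}

include hN in
lemma tendsto_div_strictMono (r : ℝ) : Tendsto (fun n => r / (N n : ℝ)) atTop (𝓝 0) :=
  (tendsto_const_div_atTop_nhds_zero_nat r).comp hN.tendsto_atTop

include hN hN0 hK0 ha hac hα hr hβ he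

omit [MeasurableSpace Ω] in
lemma QuadConcentration.tendsto_trRes {ω : Ω} (h : QuadConcentration α (1 - β) r x k ω) :
    Tendsto (fun n => r / N n * trRes α (1 - β) (scaledMatrix r fun i j => x n i j ω) -
      mBar ((N n : ℝ) / K n) α r (e n)) atTop (𝓝 0) := by
  have hlim : Tendsto (fun n => r / α * (1 / a * ((1 - β) ^ 2 *
      ((1 / (K n : ℝ)) * ∑ i, |quadDev α (1 - β) r (fun i j => x n i j ω) i| +
        r / N n * (1 / α))))) atTop (𝓝 (r / α * (1 / a * ((1 - β) ^ 2 * (0 + 0 * (1 / α)))))) :=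
    (((h.avg.add ((tendsto_div_strictMono hN r).mul_const _)).const_mul _).const_mul _).const_mul _
  simp only [zero_mul, add_zero, mul_zero] at hlim
  refine squeeze_zero_norm (fun n => ?_) hlim
  rw [Real.norm_eq_abs]
  refine (abs_trRes_sub_mBar_le _ hα hr (hK0 n) (hN0 n) hβ (he n).1 (he n).2).trans ?_
  -- Bounds the factor K/N by 1/a.
  have := hac n
  gcongr

omit [MeasurableSpace Ω] in
lemma QuadConcentration.tendsto_trResSq {ω : Ω} (h : QuadConcentration α (1 - β) r x k ω) :
    Tendsto (fun n => r / N n * trResSq α (1 - β) (scaledMatrix r fun i j => x n i j ω) -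
      vBar ((N n : ℝ) / K n) α (1 - β) r (e n)) atTop (𝓝 0) := by
  have hm := (h.tendsto_trRes hN hN0 hK0 ha hac hα hr hβ he).abs
  have ht := tendsto_div_strictMono hN r
  have hd : Tendsto (fun n => 1 / (K n : ℝ) * ∑ i, (|quadDevSq α (1 - β) r (fun i j => x n i j ω) i| +
      2 * (1 - β) ^ 2 * (r / α ^ 2) * |quadDev α (1 - β) r (fun i j => x n i j ω) i|))
      atTop (𝓝 (0 + 2 * (1 - β) ^ 2 * (r / α ^ 2) * 0)) := by
    refine (h.avgSq.add (h.avg.const_mul (2 * (1 - β) ^ 2 * (r / α ^ 2)))).congr fun n => ?_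
    rw [Finset.sum_add_distrib, ← Finset.mul_sum]
    ring
  have hlim := (((hm.div_const r).add (((hd.add ((ht.mul_const (2 / α ^ 2)).add
    (((ht.mul_const (1 / α)).add hm).const_mul (2 * (1 - β) ^ 2 * (r / α ^ 2))))).const_mul
      ((1 - β) ^ 2)).const_mul (1 / a))).const_mul (r / α))
  simp only [abs_zero, zero_mul, add_zero, mul_zero, zero_div] at hlim
  refine squeeze_zero_norm (fun n => ?_) hlim
  rw [Real.norm_eq_abs]
  refine (abs_trResSq_sub_vBar_le _ hα hr (hK0 n) (hN0 n) hβ (he n).1 (he n).2).trans ?_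
  have := hac n
  gcongr

omit [MeasurableSpace Ω] in
lemma QuadConcentration.tendsto_looQuad {ω : Ω} (h : QuadConcentration α (1 - β) r x k ω) :
    Tendsto (fun n => looQuad α (1 - β) (scaledMatrix r fun i j => x n i j ω) (k n) -
      mBar ((N n : ℝ) / K n) α r (e n)) atTop (𝓝 0) := by
  have h1 : Tendsto (fun n => looQuad α (1 - β) (scaledMatrix r fun i j => x n i j ω) (k n) -
      r / N n * trRes α (1 - β) (scaledMatrix r fun i j => x n i j ω)) atTop (𝓝 0) := by
    have hlim := h.dev.abs.add ((tendsto_div_strictMono hN r).mul_const (1 / α))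
    simp only [abs_zero, zero_mul, add_zero] at hlim
    exact squeeze_zero_norm (fun n => abs_looQuad_sub_le _ hα hr (1 - β) (k n)) hlim
  simpa using h1.add (h.tendsto_trRes hN hN0 hK0 ha hac hα hr hβ he)

omit [MeasurableSpace Ω] in
lemma QuadConcentration.tendsto_looQuadSq {ω : Ω} (h : QuadConcentration α (1 - β) r x k ω) :
    Tendsto (fun n => looQuadSq α (1 - β) (scaledMatrix r fun i j => x n i j ω) (k n) -
      vBar ((N n : ℝ) / K n) α (1 - β) r (e n)) atTop (𝓝 0) := by
  have h1 : Tendsto (fun n => looQuadSq α (1 - β) (scaledMatrix r fun i j => x n i j ω) (k n) -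
      r / N n * trResSq α (1 - β) (scaledMatrix r fun i j => x n i j ω)) atTop (𝓝 0) := by
    have hlim := h.devSq.abs.add ((tendsto_div_strictMono hN r).mul_const (2 / α ^ 2))
    simp only [abs_zero, zero_mul, add_zero] at hlim
    exact squeeze_zero_norm (fun n => abs_looQuadSq_sub_le _ hα hr (1 - β) (k n)) hlim
  simpa using h1.add (h.tendsto_trResSq hN hN0 hK0 ha hac hα hr hβ he)

/-- Dominated convergence: the normalized power and `tauBar` both lie in [0, 1/α]. The varying
deterministic equivalent is subtracted first, so that the integrands converge to zero. -/
lemma tendsto_meanPower {L : ℕ → ℕ} {y : (n : ℕ) → Fin (L n) → Fin (N n) → Ω → ℂ}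
    (hiid : ∀ n, IsIIDGaussianPair P (x n) (y n)) (k : (n : ℕ) → Fin (K n)) :
    Tendsto (fun n => meanPower P α (1 - β) r (x n) -
      tauBar ((N n : ℝ) / K n) α (1 - β) r (e n)) atTop (𝓝 0) := by
  have hc : ∀ n, 0 < (N n : ℝ) / K n := fun n => ha.trans_le (hac n)
  have hm : ∀ n, AEStronglyMeasurable (fun ω => (1 / (N n : ℝ)) *
      (trRes α (1 - β) (scaledMatrix r fun i j => x n i j ω) -
        α * trResSq α (1 - β) (scaledMatrix r fun i j => x n i j ω))) P := fun n =>
    ((continuous_const.mul (((continuous_trRes hα (1 - β)).comp (continuous_scaledMatrix r)).sub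
      (continuous_const.mul ((continuous_trResSq hα (1 - β)).comp
        (continuous_scaledMatrix r))))).measurable.comp_aemeasurable
        (hiid n).aemeasurable_left).aestronglyMeasurable
  have hb : ∀ n ω, |(1 / (N n : ℝ)) *
      (trRes α (1 - β) (scaledMatrix r fun i j => x n i j ω) -
        α * trResSq α (1 - β) (scaledMatrix r fun i j => x n i j ω))| ≤ 1 / α := fun n ω => by
    have hN' : (0 : ℝ) < N n := by exact_mod_cast hN0 n
    have h1 := mul_trResSq_le hα (1 - β) (scaledMatrix r fun i j => x n i j ω)
    have h2 := mul_trRes_le hα (1 - β) (scaledMatrix r fun i j => x n i j ω)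
    have h3 := mul_nonneg hα.le (trResSq_nonneg (α := α) (1 - β) (scaledMatrix r fun i j => x n i j ω))
    rw [Fintype.card_fin] at h2
    rw [abs_of_nonneg (mul_nonneg (by positivity) (sub_nonneg.2 h1)), one_div_mul_eq_div,
      div_le_div_iff₀ hN' hα]
    nlinarith
  have hint : ∀ n, Integrable (fun ω => (1 / (N n : ℝ)) *
      (trRes α (1 - β) (scaledMatrix r fun i j => x n i j ω) -
        α * trResSq α (1 - β) (scaledMatrix r fun i j => x n i j ω))) P := fun n =>
    Integrable.of_bound (hm n) (1 / α) (ae_of_all _ fun ω => hb n ω)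
  have hlim := tendsto_integral_of_dominated_convergence (μ := P) (f := fun _ => (0 : ℝ))
    (F := fun n ω => (1 / (N n : ℝ)) *
      (trRes α (1 - β) (scaledMatrix r fun i j => x n i j ω) -
        α * trResSq α (1 - β) (scaledMatrix r fun i j => x n i j ω)) -
        tauBar ((N n : ℝ) / K n) α (1 - β) r (e n)) (fun _ => 1 / α + 1 / α)
    (fun n => (hm n).sub aestronglyMeasurable_const) (integrable_const _)
    (fun n => ae_of_all _ fun ω => by
      refine (norm_sub_le _ _).trans (add_le_add (hb n ω) ?_)
      rw [Real.norm_of_nonneg (tauBar_pos (hc n) hα hr hβ (he n).1 (he n).2).le]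
      exact tauBar_le (hc n) hα hr hβ (he n).1 (he n).2)
    (by
      filter_upwards [ae_quadConcentration hN hN0 hK0 hiid hα hr (1 - β) k] with ω h
      have h1 := h.tendsto_trRes hN hN0 hK0 ha hac hα hr hβ he
      have h2 := h.tendsto_trResSq hN hN0 hK0 ha hac hα hr hβ he
      have h3 := (h1.sub (h2.const_mul α)).div_const r
      simp only [mul_zero, sub_zero, zero_div] at h3
      refine h3.congr fun n => ?_
      rw [tauBar]
      field_simp
      ring)
  rw [integral_zero] at hlim
  refine hlim.congr fun n => ?_
  rw [integral_sub (hint n) (integrable_const _), meanPower]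
  simp

/-- The limit theorem for the SINR of the precoder normalized to power `PT / (τ ν)`. -/
lemma ae_tendsto_sinr {B : ℝ} (hcB : ∀ n, (N n : ℝ) / K n ≤ B)
    {L : ℕ → ℕ} {y : (n : ℕ) → Fin (L n) → Fin (N n) → Ω → ℂ}
    (hiid : ∀ n, IsIIDGaussianPair P (x n) (y n)) (k : (n : ℕ) → Fin (K n))
    {PT σ2 : ℝ} (hPT : 0 < PT) (hσ2 : 0 < σ2) {ν : ℕ → ℝ} (hν : ∀ n, 1 ≤ ν n) :
    ∀ᵐ ω ∂P, Tendsto (fun n =>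
      sinr σ2 (scaledMatrix r fun i j => x n i j ω)
        (((√(PT / meanPower P α (1 - β) r (x n) / ν n) : ℝ) : ℂ) •
          precoder α (1 - β) (scaledMatrix r fun i j => x n i j ω)) (k n) -
      gammaBar (PT / σ2) ((N n : ℝ) / K n) α r (e n) (r * ν n)) atTop (𝓝 0) := by
  have hc : ∀ n, 0 < (N n : ℝ) / K n := fun n => ha.trans_le (hac n)
  have hτ := tendsto_meanPower hN hN0 hK0 ha hac hα hr hβ he hiid k
  obtain ⟨δ, hδ0, hδ⟩ : ∃ δ : ℝ, 0 < δ ∧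
      ∀ n, 2 * δ ≤ tauBar ((N n : ℝ) / K n) α (1 - β) r (e n) := by
    have hb : 0 < 1 - β := sub_pos.2 hβ
    have hB : 0 < B := (hc 0).trans_le (hcB 0)
    refine ⟨((1 / (1 / a * (1 - β) ^ 2 + α / r)) * (1 - β) ^ 2 /
      ((1 - β) ^ 2 * r + α * B * (1 + (1 - β) ^ 2 * (r / α)) ^ 2)) / 2, by positivity, fun n => ?_⟩
    rw [mul_div_cancel₀ _ two_ne_zero]
    exact le_tauBar (hc n) hα hr hβ (he n).1 (he n).2 ha (hac n) (hcB n)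
  filter_upwards [ae_quadConcentration hN hN0 hK0 hiid hα hr (1 - β) k] with ω h
  have hU := h.tendsto_looQuad hN hN0 hK0 ha hac hα hr hβ he
  have hV := h.tendsto_looQuadSq hN hN0 hK0 ha hac hα hr hβ he
  have hU0 : ∀ n, 0 ≤ looQuad α (1 - β) (scaledMatrix r fun i j => x n i j ω) (k n) :=
    fun n => looQuad_nonneg hα _ _ _
  have hUV : ∀ n, 0 ≤ looQuad α (1 - β) (scaledMatrix r fun i j => x n i j ω) (k n) -
      α * looQuadSq α (1 - β) (scaledMatrix r fun i j => x n i j ω) (k n) :=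
    fun n => sub_nonneg.2 (mul_looQuadSq_le hα _ _ _)
  have hs : ∀ n, sinr σ2 (scaledMatrix r fun i j => x n i j ω)
        (((√(PT / meanPower P α (1 - β) r (x n) / ν n) : ℝ) : ℂ) •
          precoder α (1 - β) (scaledMatrix r fun i j => x n i j ω)) (k n) = _ :=
    fun n => sinr_precoder hα (1 - β) _ σ2 (div_nonneg (div_nonneg hPT.le (meanPower_nonneg hα _ _ _))
      (zero_le_one.trans (hν n))) (k n)
  have hm0 : ∀ n, 0 < mBar ((N n : ℝ) / K n) α r (e n) :=
    fun n => mBar_pos (hc n) hα hr hβ (he n).1 (he n).2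
  have hmM : ∀ n, |mBar ((N n : ℝ) / K n) α r (e n)| ≤ r / α := fun n => by
    rw [abs_of_pos (hm0 n)]
    exact mBar_le (hc n) hα hr hβ (he n).1 (he n).2
  have ht0 : ∀ n, 0 < tauBar ((N n : ℝ) / K n) α (1 - β) r (e n) :=
    fun n => tauBar_pos (hc n) hα hr hβ (he n).1 (he n).2
  have htM : ∀ n, |tauBar ((N n : ℝ) / K n) α (1 - β) r (e n)| ≤ 1 / α := fun n => by
    rw [abs_of_pos (ht0 n)]
    exact tauBar_le (hc n) hα hr hβ (he n).1 (he n).2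
  have hmv : ∀ n, 0 ≤ mBar ((N n : ℝ) / K n) α r (e n) -
      α * vBar ((N n : ℝ) / K n) α (1 - β) r (e n) := fun n => by
    have := (ht0 n).le
    rw [tauBar] at this
    exact (div_nonneg_iff.1 this).elim (fun h => h.1) fun h => absurd h.2 (not_le.2 hr)
  have hγ : ∀ n, gammaBar (PT / σ2) ((N n : ℝ) / K n) α r (e n) (r * ν n) = _ := fun n =>
    gammaBar_eq (hc n) hα hr hβ (he n).1 (he n).2 (PT / σ2) (by positivity)
      (zero_lt_one.trans_le (hν n))
  simp_rw [hs, hγ]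
  exact tendsto_ratio_sub_ratio hU hV hτ hU0 hUV (fun n => (hm0 n).le) hmM htM hmv hδ0 hδ hν
    (sq_nonneg _) hPT hσ2

end Limit

end CogRadio

-- The main theorem

theorem corollary1 {Ω : Type*} [MeasurableSpace Ω] (P : Measure Ω) [IsProbabilityMeasure P]
    -- the dimensions along the large-system limit, with `c₁ = N / K` bounded and `c₂ = L / N = 1`
    (N K L : ℕ → ℕ) (hN : StrictMono N) (hN0 : ∀ n, 0 < N n) (hK0 : ∀ n, 0 < K n)
    (hc₁ : ∃ a b : ℝ, 0 < a ∧ ∀ n, a ≤ (N n : ℝ) / K n ∧ (N n : ℝ) / K n ≤ b)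
    (hc₂ : ∀ n, L n = N n)
    -- small-scale fading
    (h : (n : ℕ) → Fin (K n) → Fin (N n) → Ω → ℂ)
    (f : (n : ℕ) → Fin (L n) → Fin (N n) → Ω → ℂ)
    (hiid : ∀ n, CogRadio.IsIIDGaussianPair P (h n) (f n))
    -- path gains
    (r₁ : ℝ) (hr₁ : 0 < r₁)
    (r₂ : (n : ℕ) → Fin (L n) → ℝ) (hr₂ : ∀ n l, 0 < r₂ n l)
    (hr₂b : ∃ C : ℝ, ∀ n l, r₂ n l ≤ C)
    -- transmit power, noise variance, interference thresholds, precoder parameters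
    (PT σ2 α β : ℝ) (hPT : 0 < PT) (hσ2 : 0 < σ2) (hα : 0 < α) (hβ0 : 0 ≤ β) (hβ1 : β < 1)
    (θ : (n : ℕ) → Fin (L n) → ℝ) (hθ : ∀ n l, 0 < θ n l)
    (θall : ℕ → ℝ) (hθall : ∀ n, 0 < θall n) :
    -- existence and uniqueness of the positive solution of the fixed-point equation
    (∀ n, ∃! e : ℝ, 0 < e ∧ CogRadio.IsFixedPoint ((N n : ℝ) / K n) α β r₁ e) ∧
    ∀ e : ℕ → ℝ,
      (∀ n, 0 < e n ∧ CogRadio.IsFixedPoint ((N n : ℝ) / K n) α β r₁ (e n)) →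
      ∀ k : (n : ℕ) → Fin (K n),
        -- Case I
        (∀ᵐ ω ∂P, Tendsto
          (fun n =>
            CogRadio.sinrPerUser P α β PT σ2 (θ n)
              (CogRadio.channel (fun _ => r₁) (h n)) (CogRadio.channel (r₂ n) (f n)) (k n) ω
            - CogRadio.gammaBar (PT / σ2) ((N n : ℝ) / K n) α r₁ (e n)
                (CogRadio.nuPerUser r₁ (r₂ n) (θ n)))
          atTop (𝓝 0)) ∧
        -- Case II
        (∀ᵐ ω ∂P, Tendsto
          (fun n =>
            CogRadio.sinrSum P α β PT σ2 (θall n)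
              (CogRadio.channel (fun _ => r₁) (h n)) (CogRadio.channel (r₂ n) (f n)) (k n) ω
            - CogRadio.gammaBar (PT / σ2) ((N n : ℝ) / K n) α r₁ (e n)
                (CogRadio.nuSum r₁ (r₂ n) (θall n)))
          atTop (𝓝 0)) := by
  obtain ⟨a, B, ha, hab⟩ := hc₁
  have hc : ∀ n, 0 < (N n : ℝ) / K n := fun n => ha.trans_le (hab n).1
  refine ⟨fun n => CogRadio.existsUnique_isFixedPoint (hc n) hα hr₁ hβ1, fun e he k => ?_⟩
  -- A countable union of null sets: outside one null set the precoder is free of the primary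
  -- channel for all n at once.
  have hT : ∀ᵐ ω ∂P, ∀ n, CogRadio.rawPrecoder α β (CogRadio.channel (fun _ => r₁) (h n) ω)
      (CogRadio.channel (r₂ n) (f n) ω) =
        CogRadio.precoder α (1 - β) (CogRadio.channel (fun _ => r₁) (h n) ω) :=
    ae_all_iff.2 fun n => (hiid n).ae_rawPrecoder_eq (hc₂ n) α β (hr₂ n) _
  -- Kept general in ν, so that each case is the same limit with its own maximum inserted.
  have hlim := fun {ν : ℕ → ℝ} (hν : ∀ n, 1 ≤ ν n) =>
    CogRadio.ae_tendsto_sinr hN hN0 hK0 ha (fun n => (hab n).1) hα hr₁ hβ1 he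
      (fun n => (hab n).2) hiid k hPT hσ2 hν
  constructor
  · filter_upwards [hT, hlim fun n => (CogRadio.fold_min_mul_eq_div Finset.univ zero_le_one
      (hθ n) (hr₂ n)).2] with ω hω hω2
    refine hω2.congr fun n => ?_
    rw [CogRadio.sinrPerUser, hω n, (hiid n).xiSqPerUser_eq hα (hc₂ n) β r₁ (hr₂ n) hPT (hθ n),
      CogRadio.channel_eq_scaledMatrix, CogRadio.nuPerUser]
  · filter_upwards [hT, hlim fun n => le_max_left 1 ((∑ l, r₂ n l) / θall n)] with ω hω hω2
    refine hω2.congr fun n => ?_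
    rw [CogRadio.sinrSum, hω n, (hiid n).xiSqSum_eq hα (hc₂ n) β r₁ (hr₂ n) (hN0 n) hPT (hθall n),
      CogRadio.channel_eq_scaledMatrix, CogRadio.nuSum, Matrix.trace_diagonal]
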